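/- **Local super spectral curves.** A *local super spectral curve* is given by complex numbers $\tau_l$ ($l\ge1$), $\phi_{kl}=\phi_{lk}$ ($k,l\ge 1$) and $\psi_{kl}$ ($k,l\ge0$) with $(\tau_1,\tau_3)\neq(0,0)$, $\psi_{00}=0$ and $\psi_{kl}+\psi_{lk}+\psi_{0k}\psi_{0l}=0$ for all $k,l\ge 0$. It is *regular* if $\tau_1=0$ and *irregular* otherwise. Let $\Theta$ be a symbol with $\Theta^2=z\,dz$, and let $\sigma$ be the involution $z\mapsto -z$, $dz\mapsto -dz$, $\Theta\mapsto\Theta$. Put $d\xi_l=z^{l-1}dz$ and $d\xi_{-l}=\frac{dz}{z^{l+1}}+\sum_{m\ge1}\frac{\phi_{lm}}{l}z^{m-1}dz$ for $l\ge1$, and $\eta_l=z^{l-1}\Theta$ for $l\geq 1$, $\eta_{-l}=\bigl(z^{-l-1}+\sum_{k\ge0}\psi_{lk}z^{k-1}\bigr)\Theta$ for $l\ge0$. Let $V^{B+}=\mathbb C[[z]]\,dz$, $V^{F+}=\mathbb C[[z]]\,\Theta$, $V^{B-}=\mathrm{span}(d\xi_{-l})_{l\ge1}$, $V^{F0}=\mathbb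 C\,\eta_0$, $V^{F0,-}=\mathrm{span}(\eta_{-l})_{l\ge0}$, and $$\omega_{0,1|0}(z)=\sum_{l\ge1}\tau_l\,d\xi_l(z),\qquad \omega_{0,2|0}(z_1,z_2|)=\frac{dz_1dz_2}{(z_1-z_2)^2}+\sum_{k,l\ge1}\phi_{kl}\,d\xi_k(z_1)\,d\xi_l(z_2),$$ $$\omega_{0,0|2}(|z_1,z_2)=-\frac12\,\frac{z_1+z_2}{z_1-z_2}\,\frac{\Theta_1\Theta_2}{z_1z_2}-\sum_{k,l\ge0}\frac{\psi_{kl}-\psi_{lk}}{1+\delta_{kl,0}}\,\frac{z_1^{l-1}z_2^{k-1}}{2}\,\Theta_1\Theta_2 .$$ Here $\delta_{kl,0}$ is $1$ if the product $kl$ is $0$, and $0$ otherwise. **Correlators.** Consider families $\omega_{g,n|2m}$ ($g,n,m\ge0$, $2g+n+2m>2$, $(n,m)\ne(0,0)$) of multidifferentials. The family *respects the polarization* if each $\omega_{g,n|2m}$ lies in $(V^{B-})^{\otimes n}\otimes(V^{F0,-})^{\otimes 2m}$ and is symmetric in its first $n$ and antisymmetric in its last $2m$ entries. Together with $\omega_{0,1|0},\omega_{0,2|0},\omega_{0,0|2}$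 (correlators of negative genus or with an odd number of fermionic entries are $0$) set $$\mathcal L^B_{g,n+1|2m}(z,J|K)=\omega_{g,n+1|2m}(z,J|K)+\omega_{g,n+1|2m}(\sigma(z),J|K),\qquad \mathcal L^F_{g,n|2m}(J|z,K)=\omega_{g,n|2m}(J|z,K)+\omega_{g,n|2m}(J|\sigma(z),K),$$ and, with $\sum'$ denoting the sum over $g_1+g_2=g$, $J_1\sqcup J_2=J$, $K_1\sqcup K_2=K$ and $(-1)^\rho$ the sign of the permutation taking $K$ to $(K_1,K_2)$, $$\mathcal Q^{FB}_{g,n|2m}(J|z,K)=\omega_{g-1,n+1|2m}(z,J|\sigma(z),K)+\omega_{g-1,n+1|2m}(\sigma(z),J|z,K)+\sum{}'(-1)^\rho\bigl(\omega_{g_1}(z,J_1|K_1)\,\omega_{g_2}(J_2|\sigma(z),K_2)+\omega_{g_1}(\sigma(z),J_1|K_1)\,\omega_{g_2}(J_2|z,K_2)\bigr),$$ $$\mathcal Q^{BB}_{g,n+1|2m}(z,J|K)=\omega_{g-1,n+2|2m}(z,\sigma(z),J|K)+\sum{}'(-1)^\rho\,\omega_{g_1}(z,J_1|K_1)\,\omega_{g_2}(\sigma(z),J_2|K_2),$$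 $$\begin{aligned}\mathcal Q^{FF}_{g,n+1|2m}(z,J|K)={}&-\tfrac12\bigl(\mathcal D_z\omega_{g-1,n|2m+2}(J|z,u,K)+\mathcal D_u\omega_{g-1,n|2m+2}(J|u,z,K)\bigr)\big|_{u=\sigma(z)}\\&+\tfrac12\sum{}'(-1)^\rho\bigl(\mathcal D_z\omega_{g_1}(J_1|z,K_1)\,\omega_{g_2}(J_2|\sigma(z),K_2)+\mathcal D_z\omega_{g_1}(J_1|\sigma(z),K_1)\,\omega_{g_2}(J_2|z,K_2)\bigr),\end{aligned}$$ where $\mathcal D_z(f(z)\Theta)=f'(z)\,dz\,\Theta$; the subscripts $n,m$ of the factors are determined by the numbers of their arguments, and everything is expanded for $z$ closer to $0$ than the variables in $J,K$. The *$\mathcal N=1$ abstract super loop equations* are $$\mathcal L^B_{g,n+1|2m}(z,J|K)\in V_z^{B+},\qquad \mathcal L^F_{g,n|2m}(J|z,K)\in V_z^{F+},$$ $$\mathcal Q^{BB}_{g,n+1|2m}+\mathcal Q^{FF}_{g,n+1|2m}\in zV_z^{B+}\otimes zV_z^{B+}=z^2\mathbb C[[z]]\,dz^2,\qquad \mathcal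 Q^{FB}_{g,n|2m}\in zV_z^{B+}\otimes V_z^{F+}=z\,\mathbb C[[z]]\,dz\,\Theta$$ if the curve is regular; if it is irregular, the two quadratic conditions are replaced by $\mathcal Q^{BB}+\mathcal Q^{FF}\in V_z^{B+}\otimes V_z^{B+}=\mathbb C[[z]]\,dz^2$ and $\mathcal Q^{FB}\in V_z^{B+}\otimes(V_z^{F0}\oplus V_z^{F+})=z^{-1}\mathbb C[[z]]\,dz\,\Theta$. **Recursion.** Let $\tilde{\mathcal Q}$ be $\mathcal Q$ without the terms involving $\omega_{0,1|0}$, and let $$K^{BB}(z_0,z)=\frac{\int_0^z\omega_{0,2|0}(z_0,\cdot|)}{\omega_{0,1|0}(z)-\omega_{0,1|0}(\sigma(z))},\qquad K^{BF}(u,z)=\frac{\omega_{0,0|2}(|z,u)-\frac12\eta_0(z)\eta_0(u)}{\omega_{0,1|0}(z)-\omega_{0,1|0}(\sigma(z))}.$$ The *$\mathcal N=1$ super topological recursion* consists of the formulae, for all stable indices, $$\omega_{g,n+1|2m}(z_0,J|K)=\operatorname*{Res}_{z\to0}K^{BB}(z_0,z)\bigl(\tilde{\mathcal Q}^{BB}_{g,n+1|2m}+\tilde{\mathcal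 Q}^{FF}_{g,n+1|2m}\bigr)(z,J|K),$$ $$\omega_{g,n|2m+2}(J|u_1,u_2,K)=\hat\omega_{g,n|2m+2}(J|u_1,u_2,K)-\eta_0(u_1)\operatorname*{Res}_{z\to0}\hat\omega_{g,n|2m+2}(J|u_2,z,K)\,\eta_0(z),$$ with $\hat\omega_{g,n|2m+2}(J|u_1,u_2,K)=\operatorname*{Res}_{z\to0}K^{BF}(u_1,z)\,\tilde{\mathcal Q}^{FB}_{g,n|2m+2}(J|z,u_2,K)$. **Corollary 4.4.** For every local super spectral curve there exists a family $(\omega_{g,n|2m})$ that respects the polarization and solves the $\mathcal N=1$ abstract super loop equations. This solution is unique; it satisfies the super topological recursion, and it is the only family of multidifferentials satisfying the super topological recursion. -/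

import Mathlib

/-!
Conventions.  All expansions are formal.  In a bosonic variable `z` a one-form `f(z) dz` is recorded
by the Laurent series `f`; in a fermionic variable `u` an element `f(u) Θ(u)` is recorded by `f`.
Here `Θ² = z dz`, and `Θ` is invariant under the involution `σ : z ↦ -z`, while `dz ↦ -dz`.
A multidifferential in `n` bosonic and `k` fermionic variables is recorded by its array of
coefficients of `∏ zᵢ^{aᵢ} dzᵢ ∏ uⱼ^{bⱼ} Θⱼ`.
-/

namespace SuperTR

noncomputable section

/-- The data of a local super spectral curve with one component.  Only `τ l` with `1 ≤ l` and
`φ k l` with `1 ≤ k`, `1 ≤ l` are meaningful; `ψ k l` is meaningful for all `k, l ≥ 0`. -/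
structure LocalSuperSpectralCurve where
  /-- dilaton shift parameters -/
  τ : ℕ → ℂ
  /-- bosonic polarization parameters -/
  φ : ℕ → ℕ → ℂ
  /-- fermionic polarization parameters -/
  ψ : ℕ → ℕ → ℂ
  admissible : τ 1 ≠ 0 ∨ τ 3 ≠ 0
  φ_symm : ∀ k l, 1 ≤ k → 1 ≤ l → φ k l = φ l k
  ψ_zero : ψ 0 0 = 0
  ψ_rel : ∀ k l, ψ k l + ψ l k + ψ 0 k * ψ 0 l = 0

/-- The coordinate `z`. -/
def Z : LaurentSeries ℂ := HahnSeries.single 1 1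

open Classical in
/-- The Laurent series with coefficients `f` (`0` if `f` has infinitely many polar terms). -/
def ser (f : ℤ → ℂ) : LaurentSeries ℂ :=
  if h : BddBelow (Function.support f) then HahnSeries.ofSuppBddBelow f h else 0

/-- A power series as a Laurent series. -/
def ofSeq (f : ℕ → ℂ) : LaurentSeries ℂ := HahnSeries.ofPowerSeries ℤ ℂ (PowerSeries.mk f)

/-- The residue at `z = 0` of the one-form `f dz`. -/
def res (f : LaurentSeries ℂ) : ℂ := f.coeff (-1)

/-- The space `z^d ℂ[[z]]`. -/
def orderGE (d : ℤ) : Submodule ℂ (LaurentSeries ℂ) where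
  carrier := {f | ∀ a < d, f.coeff a = 0}
  zero_mem' := fun a _ => by simp
  add_mem' := fun {f g} hf hg a ha => by simp [hf a ha, hg a ha]
  smul_mem' := fun c f hf a ha => by simp [hf a ha]

/-- The involution on one-forms: `f(z) dz ↦ f(-z) d(-z) = -f(-z) dz`. -/
def σB (f : LaurentSeries ℂ) : LaurentSeries ℂ := ser fun a => (-1 : ℂ) ^ (a + 1) * f.coeff a

/-- The involution on fermionic forms: `f(z) Θ ↦ f(-z) Θ`. -/
def σF (f : LaurentSeries ℂ) : LaurentSeries ℂ := ser fun a => (-1 : ℂ) ^ a * f.coeff a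

/-- The derivative `d/dz`, so that `𝒟 · (f Θ) = f' dz Θ`. -/
def D (f : LaurentSeries ℂ) : LaurentSeries ℂ := LaurentSeries.derivative ℂ f

/-! ### The polarization -/

/-- `dξ_{-l} = dz / z^{l+1} + ∑_{m ≥ 1} (φ_{lm} / l) z^{m-1} dz`, for `l ≥ 1`. -/
def dξNeg (C : LocalSuperSpectralCurve) (l : ℕ) : LaurentSeries ℂ :=
  HahnSeries.single (-(l : ℤ) - 1) 1 + ofSeq fun j => C.φ l (j + 1) / l

/-- `η_{-l} = (1 / z^{l+1} + ∑_{k ≥ 0} ψ_{lk} z^{k-1}) Θ`, for `l ≥ 0`. -/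
def ηNeg (C : LocalSuperSpectralCurve) (l : ℕ) : LaurentSeries ℂ :=
  HahnSeries.single (-(l : ℤ) - 1) 1 + HahnSeries.single (-1) 1 * ofSeq (C.ψ l)

/-- `V^{B+} = ℂ[[z]] dz`. -/
def VBPlus : Submodule ℂ (LaurentSeries ℂ) := orderGE 0

/-- `V^{F+} = ℂ[[z]] Θ`, spanned (topologically) by `η_l = z^{l-1} Θ`, `l ≥ 1`. -/
def VFPlus : Submodule ℂ (LaurentSeries ℂ) := orderGE 0

/-- `V^{B-}`. -/
def VBMinus (C : LocalSuperSpectralCurve) : Submodule ℂ (LaurentSeries ℂ) :=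
  Submodule.span ℂ {f | ∃ l : ℕ, 1 ≤ l ∧ f = dξNeg C l}

/-- `V^{F0,-} = V^{F0} ⊕ V^{F-}`. -/
def VFZeroMinus (C : LocalSuperSpectralCurve) : Submodule ℂ (LaurentSeries ℂ) :=
  Submodule.span ℂ (Set.range (ηNeg C))

/-- Coefficient arrays of multidifferentials in `n` bosonic and `k` fermionic variables. -/
abbrev MultiDiff (n k : ℕ) : Type := (Fin n → ℤ) → (Fin k → ℤ) → ℂ

/-- The (algebraic) tensor product `(⨂ V^{B-}) ⊗ (⨂ V^{F0,-})`, as a space of coefficient arrays. -/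
def polarized (C : LocalSuperSpectralCurve) (n k : ℕ) : Submodule ℂ (MultiDiff n k) :=
  Submodule.span ℂ {w | ∃ (f : Fin n → LaurentSeries ℂ) (h : Fin k → LaurentSeries ℂ),
    (∀ i, f i ∈ VBMinus C) ∧ (∀ j, h j ∈ VFZeroMinus C) ∧
    w = fun a b => (∏ i, (f i).coeff (a i)) * ∏ j, (h j).coeff (b j)}

/-! ### The unstable correlators -/

/-- `ω_{0,1|0}(z) = ∑_{l ≥ 1} τ_l z^{l-1} dz`. -/
def w010 (C : LocalSuperSpectralCurve) : LaurentSeries ℂ := ofSeq fun j => C.τ (j + 1)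

/-- The coefficient of `z₁^a z₂^b dz₁ dz₂` in
`ω_{0,2|0} = dz₁ dz₂ / (z₁ - z₂)² + ∑_{k,l ≥ 1} φ_{kl} z₁^{k-1} z₂^{l-1} dz₁ dz₂`,
expanded in the domain `|z₁| < |z₂|`. -/
def w020 (C : LocalSuperSpectralCurve) (a b : ℤ) : ℂ :=
  (if 0 ≤ a ∧ a + b = -2 then (a : ℂ) + 1 else 0) +
    (if 0 ≤ a ∧ 0 ≤ b then C.φ (a + 1).toNat (b + 1).toNat else 0)

/-- The coefficient of `z₁^{p-1} z₂^{q-1} Θ₁ Θ₂` in the part of `ω_{0,0|2}` that is regular along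
`z₁ = z₂`. -/
def ψPart (C : LocalSuperSpectralCurve) (p q : ℕ) : ℂ :=
  -((C.ψ q p - C.ψ p q) / (1 + if q * p = 0 then 1 else 0)) / 2

/-- The coefficient of `z₁^a z₂^b Θ₁ Θ₂` in
`ω_{0,0|2} = -(1/2) (z₁ + z₂)/(z₁ - z₂) Θ₁ Θ₂/(z₁ z₂) + ∑_{p,q ≥ 0} ψPart p q z₁^{p-1} z₂^{q-1} Θ₁ Θ₂`,
expanded in the domain `|z₁| < |z₂|`, where the first summand is
`(1/2) z₁⁻¹ z₂⁻¹ + ∑_{a ≥ 0} z₁^a z₂^{-a-2}`. -/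
def w002 (C : LocalSuperSpectralCurve) (a b : ℤ) : ℂ :=
  (if a = -1 ∧ b = -1 then 1 / 2 else if 0 ≤ a ∧ a + b = -2 then 1 else 0) +
    (if -1 ≤ a ∧ -1 ≤ b then ψPart C (a + 1).toNat (b + 1).toNat else 0)

/-- `ω_{0,2|0}(z, σ(z))`, as coefficient of `dz²`; the first summand of `ω_{0,2|0}` contributes
`dz d(-z) / (2z)² = -(1/4) z⁻² dz²`. -/
def w020Diag (C : LocalSuperSpectralCurve) : LaurentSeries ℂ :=
  HahnSeries.single (-2) (-1 / 4) +
    ofSeq fun c => ∑ p ∈ Finset.HasAntidiagonal.antidiagonal c, (-1 : ℂ) ^ (p.2 + 1) * C.φ (p.1 + 1) (p.2 + 1)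

/-- `(𝒟_z ω_{0,0|2}(z, u) + 𝒟_u ω_{0,0|2}(u, z))` at `u = σ(z)`, as coefficient of `dz²` (using
`Θ² = z dz`).  The first summand of `ω_{0,0|2}` contributes `1/(4z³) dz Θ² + 1/(4z³) dz Θ²`; a term
`z₁^a z₂^b Θ₁ Θ₂` contributes `a ((-1)^b + (-1)^a) z^{a+b} dz²`. -/
def w002Diag (C : LocalSuperSpectralCurve) : LaurentSeries ℂ :=
  HahnSeries.single (-2) (1 / 2) +
    HahnSeries.single (-2) 1 * ofSeq fun c => ∑ p ∈ Finset.HasAntidiagonal.antidiagonal c,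
      ((p.1 : ℂ) - 1) * ((-1 : ℂ) ^ (p.2 + 1) + (-1 : ℂ) ^ (p.1 + 1)) * ψPart C p.1 p.2

/-! ### Families of correlators -/

/-- A family `ω g n k` of multidifferentials of genus `g` with `n` bosonic, `k` fermionic entries. -/
abbrev Correlators : Type := (g n k : ℕ) → MultiDiff n k

/-- The unstable members of the family are those of the curve, and there is always an even number
of fermionic entries.  (For the two-point functions the first entry is the one closer to `0`.) -/
structure HasUnstableData (C : LocalSuperSpectralCurve) (ω : Correlators) : Prop where
  one : ∀ a b, ω 0 1 0 a b = (w010 C).coeff (a 0)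
  two : ∀ a b, ω 0 2 0 a b = w020 C (a 0) (a 1)
  ferm : ∀ a b, ω 0 0 2 a b = w002 C (b 0) (b 1)
  odd : ∀ g n k, Odd k → ω g n k = 0

/-- The stable `ω_{g,n|2m}` lie in `(⨂ V^{B-}) ⊗ (⨂ V^{F0,-})`, are symmetric in the bosonic entries
and antisymmetric in the fermionic ones. -/
structure RespectsPolarization (C : LocalSuperSpectralCurve) (ω : Correlators) : Prop where
  mem : ∀ g n m, 2 < 2 * g + n + 2 * m → ω g n (2 * m) ∈ polarized C n (2 * m)
  symm : ∀ g n m, 2 < 2 * g + n + 2 * m → ∀ (s : Equiv.Perm (Fin n)) a b,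
    ω g n (2 * m) (a ∘ s) b = ω g n (2 * m) a b
  antisymm : ∀ g n m, 2 < 2 * g + n + 2 * m → ∀ (s : Equiv.Perm (Fin (2 * m))) a b,
    ω g n (2 * m) a (b ∘ s) = ((Equiv.Perm.sign s : ℤ) : ℂ) * ω g n (2 * m) a b

/-- `ω_{g,n+1|k}(z, J | K)` as a Laurent series in `z`, at given exponents of `J`, `K`. -/
def bos (ω : Correlators) (g : ℕ) {n k : ℕ} (J : Fin n → ℤ) (K : Fin k → ℤ) : LaurentSeries ℂ :=
  ser fun a => ω g (n + 1) k (Fin.cons a J) K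

/-- `ω_{g,n|k+1}(J | z, K)` as a Laurent series in `z`, at given exponents of `J`, `K`. -/
def fer (ω : Correlators) (g : ℕ) {n k : ℕ} (J : Fin n → ℤ) (K : Fin k → ℤ) : LaurentSeries ℂ :=
  ser fun b => ω g n (k + 1) J (Fin.cons b K)

/-- The subtuple of `J` with positions in `S`, in increasing order. -/
def sub {n : ℕ} (J : Fin n → ℤ) (S : Finset (Fin n)) : Fin S.card → ℤ :=
  fun i => J (S.orderEmbOfFin rfl i)

/-- `(-1)^ρ`: the sign of the permutation that lists first `T`, then its complement, both in
increasing order. -/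
def shuffleSign {k : ℕ} (T : Finset (Fin k)) : ℂ :=
  (-1) ^ ((T ×ˢ Tᶜ).filter fun p => p.2 < p.1).card

/-- `∑_{g₁+g₂=g} ∑_{J₁∪J₂=J, K₁∪K₂=K} (-1)^ρ P(g₁,J₁,K₁; g₂,J₂,K₂)`. -/
def splitSum (g : ℕ) {n k : ℕ} (J : Fin n → ℤ) (K : Fin k → ℤ)
    (P : (g₁ : ℕ) → {n₁ k₁ : ℕ} → (Fin n₁ → ℤ) → (Fin k₁ → ℤ) →
      (g₂ : ℕ) → {n₂ k₂ : ℕ} → (Fin n₂ → ℤ) → (Fin k₂ → ℤ) → LaurentSeries ℂ) :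
    LaurentSeries ℂ :=
  ∑ p ∈ Finset.HasAntidiagonal.antidiagonal g, ∑ S : Finset (Fin n), ∑ T : Finset (Fin k),
    shuffleSign T • P p.1 (sub J S) (sub K T) p.2 (sub J Sᶜ) (sub K Tᶜ)

/-- `𝓛^B_{g,n+1|k}(z, J | K)`. -/
def LB (ω : Correlators) (g : ℕ) {n k : ℕ} (J : Fin n → ℤ) (K : Fin k → ℤ) : LaurentSeries ℂ :=
  bos ω g J K + σB (bos ω g J K)

/-- `𝓛^F_{g,n|k+1}(J | z, K)`. -/
def LF (ω : Correlators) (g : ℕ) {n k : ℕ} (J : Fin n → ℤ) (K : Fin k → ℤ) : LaurentSeries ℂ :=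
  fer ω g J K + σF (fer ω g J K)

/-- `𝓠^{FB}_{g,n|k+1}(J | z, K)`, as coefficient of `dz Θ`. -/
def QFB (ω : Correlators) (g : ℕ) {n k : ℕ} (J : Fin n → ℤ) (K : Fin k → ℤ) : LaurentSeries ℂ :=
  (if g = 0 then 0 else
    ser fun c => ∑ᶠ a : ℤ, ((-1 : ℂ) ^ (c - a) + (-1 : ℂ) ^ (a + 1)) *
      ω (g - 1) (n + 1) (k + 1) (Fin.cons a J) (Fin.cons (c - a) K)) +
  splitSum g J K (fun g₁ _ _ J₁ K₁ g₂ _ _ J₂ K₂ => bos ω g₁ J₁ K₁ * σF (fer ω g₂ J₂ K₂)) +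
  splitSum g J K (fun g₁ _ _ J₁ K₁ g₂ _ _ J₂ K₂ => σB (bos ω g₁ J₁ K₁) * fer ω g₂ J₂ K₂)

/-- `𝓠^{BB}_{g,n+1|k}(z, J | K)`, as coefficient of `dz²`. -/
def QBB (C : LocalSuperSpectralCurve) (ω : Correlators) (g : ℕ) {n k : ℕ}
    (J : Fin n → ℤ) (K : Fin k → ℤ) : LaurentSeries ℂ :=
  (if g = 0 then 0 else if g = 1 ∧ n = 0 ∧ k = 0 then w020Diag C else
    ser fun c => ∑ᶠ a : ℤ, (-1 : ℂ) ^ (c - a + 1) *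
      ω (g - 1) (n + 2) k (Fin.cons a (Fin.cons (c - a) J)) K) +
  splitSum g J K (fun g₁ _ _ J₁ K₁ g₂ _ _ J₂ K₂ => bos ω g₁ J₁ K₁ * σB (bos ω g₂ J₂ K₂))

/-- `𝓠^{FF}_{g,n+1|k}(z, J | K)`, as coefficient of `dz²` (using `Θ² = z dz`).  In the first line,
`z^a u^b Θ_z Θ_u` contributes `a ((-1)^b + (-1)^a) z^{a+b} dz²`. -/
def QFF (C : LocalSuperSpectralCurve) (ω : Correlators) (g : ℕ) {n k : ℕ}
    (J : Fin n → ℤ) (K : Fin k → ℤ) : LaurentSeries ℂ :=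
  (-1 / 2 : ℂ) • (if g = 0 then 0 else if g = 1 ∧ n = 0 ∧ k = 0 then w002Diag C else
    ser fun c => ∑ᶠ a : ℤ, (a : ℂ) * ((-1 : ℂ) ^ (c - a) + (-1 : ℂ) ^ a) *
      ω (g - 1) n (k + 2) J (Fin.cons a (Fin.cons (c - a) K))) +
  (1 / 2 : ℂ) • splitSum g J K
    (fun g₁ _ _ J₁ K₁ g₂ _ _ J₂ K₂ => Z * (D (fer ω g₁ J₁ K₁) * σF (fer ω g₂ J₂ K₂))) +
  (1 / 2 : ℂ) • splitSum g J K
    (fun g₁ _ _ J₁ K₁ g₂ _ _ J₂ K₂ => Z * (D (σF (fer ω g₁ J₁ K₁)) * fer ω g₂ J₂ K₂))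

/-! ### The super loop equations -/

/-- The `𝒩 = 1` abstract super loop equations.  For a regular curve (`τ₁ = 0`) the quadratic
equations say that the bosonic quantity lies in `zV^{B+} ⊗ zV^{B+} = z² ℂ[[z]] dz²` and the fermionic
one in `zV^{B+} ⊗ V^{F+} = z ℂ[[z]] dz Θ`; for an irregular curve (`τ₁ ≠ 0`) both orders of vanishing
are lowered by two. -/
structure LoopEquations (C : LocalSuperSpectralCurve) (ω : Correlators) : Prop where
  linB : ∀ g n m (J : Fin n → ℤ) (K : Fin (2 * m) → ℤ), LB ω g J K ∈ VBPlus
  linF : ∀ g n m (J : Fin n → ℤ) (K : Fin (2 * m + 1) → ℤ), LF ω g J K ∈ VFPlus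
  quadB : ∀ g n m (J : Fin n → ℤ) (K : Fin (2 * m) → ℤ),
    QBB C ω g J K + QFF C ω g J K ∈ orderGE (if C.τ 1 = 0 then 2 else 0)
  quadF : ∀ g n m (J : Fin n → ℤ) (K : Fin (2 * m + 1) → ℤ),
    QFB ω g J K ∈ orderGE (if C.τ 1 = 0 then 1 else -1)

/-- A solution of the super loop equations that respects the polarization. -/
structure IsPolarizedSolution (C : LocalSuperSpectralCurve) (ω : Correlators) : Prop where
  unstable : HasUnstableData C ω
  polarization : RespectsPolarization C ω
  loop : LoopEquations C ω

/-! ### The super topological recursion -/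

/-- The family with `ω_{0,1|0}` replaced by `0`: the quantities `𝓠` formed with it are the
`𝓠̃`, from which all terms involving `ω_{0,1|0}` are left out. -/
def dropOne (ω : Correlators) : Correlators := fun g n k =>
  if g = 0 ∧ n = 1 ∧ k = 0 then 0 else ω g n k

/-- `ω_{0,1|0}(z) - ω_{0,1|0}(σ(z))`, as coefficient of `dz`. -/
def kernelDenom (C : LocalSuperSpectralCurve) : LaurentSeries ℂ := w010 C - σB (w010 C)

/-- `K^{BB}(z₀, z, σ(z))`: the coefficient of `z₀^b dz₀ / dz`, as a Laurent series in `z`, with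
numerator `∫₀^z ω_{0,2|0}(z₀, ·)`. -/
def KBB (C : LocalSuperSpectralCurve) (b : ℤ) : LaurentSeries ℂ :=
  (ser fun a => w020 C (a - 1) b / a) / kernelDenom C

/-- `K^{BF}(u, z, σ(z))`: the coefficient of `u^b Θ_z Θ_u / dz`, as a Laurent series in `z`, with
numerator `ω_{0,0|2}(z, u) - (1/2) η₀(z) η₀(u)`. -/
def KBF (C : LocalSuperSpectralCurve) (b : ℤ) : LaurentSeries ℂ :=
  (ser fun a => w002 C a b - 1 / 2 * (ηNeg C 0).coeff a * (ηNeg C 0).coeff b) / kernelDenom C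

/-- `ω̂_{g,n|k+2}(J | u₁, u₂, K) = Res_z K^{BF}(u₁, z, σ(z)) 𝓠̃^{FB}(J | z, u₂, K)`. -/
def wHat (C : LocalSuperSpectralCurve) (ω : Correlators) (g : ℕ) {n k : ℕ}
    (J : Fin n → ℤ) (b₁ b₂ : ℤ) (K : Fin k → ℤ) : ℂ :=
  res (Z * (KBF C b₁ * QFB (dropOne ω) g J (Fin.cons b₂ K)))

/-- The `𝒩 = 1` super topological recursion. -/
structure TopologicalRecursion (C : LocalSuperSpectralCurve) (ω : Correlators) : Prop where
  bosonic : ∀ g n m, 2 < 2 * g + (n + 1) + 2 * m →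
    ∀ (b : ℤ) (J : Fin n → ℤ) (K : Fin (2 * m) → ℤ),
      ω g (n + 1) (2 * m) (Fin.cons b J) K =
        res (KBB C b * (QBB C (dropOne ω) g J K + QFF C (dropOne ω) g J K))
  fermionic : ∀ g n m, 2 < 2 * g + n + (2 * m + 2) →
    ∀ (b₁ b₂ : ℤ) (J : Fin n → ℤ) (K : Fin (2 * m) → ℤ),
      ω g n (2 * m + 2) J (Fin.cons b₁ (Fin.cons b₂ K)) =
        wHat C ω g J b₁ b₂ K -
          (ηNeg C 0).coeff b₁ * res (Z * ((ser fun c => wHat C ω g J b₂ c K) * ηNeg C 0))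

end

end SuperTR

/-! Existence. The stable correlators are sought as the Taylor coefficients of a free energy `S`
over ℂ[ħ] in even and odd coordinates dual to the forms dξ_{-l} and η_{-l}; polarization and
(anti)symmetry are then automatic. The bosonic and fermionic fields are the derivatives of `S` plus
a `source` built from the unstable correlators, and `Op` is ħ times a derivative plus multiplication
by a field, that is, a free field conjugated by exp(S/ħ). The two expansions of a two-point
function, for |z₁| < |z₂| and |z₁| > |z₂|, differ by a delta function (`w020_sub`, `w002_add`), so
the modes odd under the involution form a free boson and a free fermion (`oscillators`). Their
bilinears `G n` and `T n` satisfy the relations of the N = 1 superconformal algebra (`G_G_of_ne`,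
`G_G_neg_one_zero`, `T_G`, `T_T`).

In these terms the linear loop equations follow if `S` does not depend on the letters of odd index,
and the quadratic ones follow from G_n·1 = T_n·1 = 0 for n < `kind C`. These constraints are solved
degree by degree, where ħ^g times a word w has degree 2g + |w|. To leading order a mode acts as ħ
times a first-order operator with constant coefficients (`G_lead`, `T_lead`); this system is
triangular, and invertible since its diagonal entry is τ₁, or τ₃ when τ₁ = 0. The algebra relations
make the lowest-degree obstruction closed (`DL_obstr`), and the Poincaré lemma for superfunctions
(`exists_potential`) supplies the correction. Evaluating the approximate solutions gives `corr`; the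
product rule `EV_mul` turns the quadratic quantities 𝓠 into values of G_n·1 and T_n·1. Only in genus
one without further entries is a comparison of normal-ordering constants needed.

Recursion. Separating ω_{0,1|0} from 𝓠, the terms containing it equal, up to a product of σ-even
sums of high order, minus half of (ω_{0,1|0} - σω_{0,1|0})(ω - σω). Division by the kernel
denominator and the loop equations leave only the residue of the numerator against ω, which
reproduces ω from its principal part (`res_numB_mul`, `res_numF_mul`). In the fermionic case the
η₀-component is lost; antisymmetry allows it to be recovered from the other entry, which is the role
of the second term of the fermionic recursion.

Uniqueness. The right-hand sides of the recursion involve only correlators of smaller 2g + n + k, so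
induction on this number shows that the unstable data determine everything. A polarized solution
satisfies the recursion, hence is unique as well. -/

namespace SuperTR

noncomputable section

/-! ### Locally finite sums of operators -/

section LocallyFinite

variable {R V : Type*} [CommRing R] [AddCommGroup V] [Module R V]

/-- The sum of a locally finite family of operators. -/
def lfSum {ι : Type*} (O : ι → V →ₗ[R] V) (h : ∀ x, (Function.support fun i => O i x).Finite) :
    V →ₗ[R] V where
  toFun x := ∑ᶠ i, O i x
  map_add' x y := by
    simp only [map_add]
    exact finsum_add_distrib (h x) (h y)
  map_smul' r x := by
    simp only [map_smul, RingHom.id_apply]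
    exact (smul_finsum' r (h x)).symm

lemma finite_int_support {M : Type*} [Zero M] {f : ℤ → M} (a b : ℤ)
    (ha : ∀ i < a, f i = 0) (hb : ∀ i, b < i → f i = 0) : (Function.support f).Finite := by
  refine (Set.finite_Icc a b).subset fun i hi => ?_
  by_contra h
  rw [Set.mem_Icc, not_and_or, not_le, not_le] at h
  exact hi (h.elim (ha i) (hb i))

lemma finite_support_add {ι M : Type*} [AddMonoid M] {f g : ι → M}
    (hf : (Function.support f).Finite) (hg : (Function.support g).Finite) :
    (Function.support fun i => f i + g i).Finite :=
  (hf.union hg).subset (Function.support_add f g)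

lemma finite_support_ite {ι M : Type*} [Zero M] [DecidableEq ι] (i₀ : ι) (P : ι → Prop)
    [DecidablePred P] (hP : ∀ i, P i → i = i₀) (f : ι → M) :
    (Function.support fun i => if P i then f i else 0).Finite :=
  (Set.finite_singleton i₀).subset fun i hi => by
    by_contra h
    exact hi (if_neg fun hp => h (hP i hp))

lemma finsum_ite_unique {ι M : Type*} [AddCommMonoid M] (i₀ : ι) (P : ι → Prop)
    [DecidablePred P] (hP : ∀ i, P i ↔ i = i₀) (f : ι → M) :
    ∑ᶠ i, (if P i then f i else 0) = f i₀ := by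
  rw [finsum_eq_single _ i₀ fun i hi => if_neg fun hp => hi ((hP i).1 hp)]
  exact if_pos ((hP i₀).2 rfl)

lemma finite_support_smul {ι : Type*} {f : ι → V} (r : ι → R)
    (hf : (Function.support f).Finite) : (Function.support fun i => r i • f i).Finite :=
  hf.subset fun i hi h => hi (by simp only [h, smul_zero])

lemma finite_support_map {ι : Type*} {f : ι → V} (φ : V →ₗ[R] V) (hf : (Function.support f).Finite) :
    (Function.support fun i => φ (f i)).Finite :=
  hf.subset fun i hi h => hi (by simp only [h, map_zero])

end LocallyFinite

/-! ### Free boson and free fermion: the super Virasoro relations -/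

/-- Modes of a half-integer moded free boson `β` and an integer moded free fermion `γ`, with
commutators proportional to `h`, acting locally finitely. -/
structure Oscillators {R V : Type*} [CommRing R] [AddCommGroup V] [Module R V] (h : R)
    (β γ : ℤ → V →ₗ[R] V) : Prop where
  ββ : ∀ i j x, β i (β j x) = β j (β i x) + if i + j = -1 then (h * (2 * j + 1)) • x else 0
  γγ : ∀ i j x, γ i (γ j x) = -γ j (γ i x) + if i + j = 0 then h • x else 0
  βγ : ∀ i j x, β i (γ j x) = γ j (β i x)
  lfβ : ∀ x, ∃ N : ℤ, ∀ i < N, β i x = 0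
  lfγ : ∀ x, ∃ N : ℤ, ∀ i < N, γ i x = 0

namespace Oscillators

variable {R V : Type*} [CommRing R] [AddCommGroup V] [Module R V] {h : R}
  {β γ : ℤ → V →ₗ[R] V}

/-- Modes of very negative index annihilate `x`: for small `i` this applies to `β i` after it is
commuted past `γ`, for large `i` to `γ (n - i)`. -/
lemma finite_βγ (O : Oscillators h β γ) (n : ℤ) (x : V) :
    (Function.support fun i => β i (γ (n - i) x)).Finite := by
  obtain ⟨N, hN⟩ := O.lfβ x
  obtain ⟨M, hM⟩ := O.lfγ x
  refine finite_int_support N (n - M) (fun i hi => ?_) (fun i hi => ?_)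
  · rw [O.βγ, hN i hi, map_zero]
  · rw [hM _ (by lia), map_zero]

/-- The normally ordered product of two bosonic modes. -/
def nβ (β : ℤ → V →ₗ[R] V) (i j : ℤ) : V →ₗ[R] V := if j ≤ i then β i ∘ₗ β j else β j ∘ₗ β i

/-- The normally ordered product of two fermionic modes. -/
def nγ (γ : ℤ → V →ₗ[R] V) (i j : ℤ) : V →ₗ[R] V := if j ≤ i then γ i ∘ₗ γ j else -(γ j ∘ₗ γ i)

/-- Normal ordering lets the mode of smaller index act first, and that index tends to -∞ in both
directions of the sum. -/
lemma finite_nβ (O : Oscillators h β γ) (n : ℤ) (x : V) :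
    (Function.support fun i => nβ β i (n - i) x).Finite := by
  obtain ⟨N, hN⟩ := O.lfβ x
  refine finite_int_support (min N (n - N)) (max N (n - N) + |n|) (fun i hi => ?_) (fun i hi => ?_)
  all_goals
    unfold nβ
    split_ifs with h1
  · rw [LinearMap.comp_apply, hN _ (by grind), map_zero]
  · rw [LinearMap.comp_apply, hN _ (by grind), map_zero]
  · rw [LinearMap.comp_apply, hN _ (by grind), map_zero]
  · rw [LinearMap.comp_apply, hN _ (by grind), map_zero]

lemma finite_nγ (O : Oscillators h β γ) (n : ℤ) (x : V) :
    (Function.support fun i => nγ γ i (n - i) x).Finite := by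
  obtain ⟨N, hN⟩ := O.lfγ x
  refine finite_int_support (min N (n - N)) (max N (n - N) + |n|) (fun i hi => ?_) (fun i hi => ?_)
  all_goals
    unfold nγ
    split_ifs with h1
  · rw [LinearMap.comp_apply, hN _ (by grind), map_zero]
  · rw [LinearMap.neg_apply, LinearMap.comp_apply, hN _ (by grind), map_zero, neg_zero]
  · rw [LinearMap.comp_apply, hN _ (by grind), map_zero]
  · rw [LinearMap.neg_apply, LinearMap.comp_apply, hN _ (by grind), map_zero, neg_zero]

/-- The modes of the supercurrent. -/
def G (O : Oscillators h β γ) (n : ℤ) : V →ₗ[R] V :=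
  lfSum (fun i => β i ∘ₗ γ (n - i)) (O.finite_βγ n)

lemma G_apply (O : Oscillators h β γ) (n : ℤ) (x : V) :
    O.G n x = ∑ᶠ i, β i (γ (n - i) x) := rfl

/-- The modes of the stress tensor. -/
def T (O : Oscillators h β γ) (n : ℤ) : V →ₗ[R] V :=
  lfSum (fun i => nβ β i (n - i)) (O.finite_nβ n) +
    lfSum (fun i => ((2 * i - 1 : ℤ) : R) • nγ γ i (n + 1 - i))
      (fun x => finite_support_smul _ (O.finite_nγ (n + 1) x)) +
    if n = -1 then h • LinearMap.id else 0

lemma T_apply (O : Oscillators h β γ) (n : ℤ) (x : V) :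
    O.T n x = ∑ᶠ i, nβ β i (n - i) x + ∑ᶠ i, ((2 * i - 1 : ℤ) : R) • nγ γ i (n + 1 - i) x +
      if n = -1 then h • x else 0 := by
  unfold T
  split_ifs <;> rfl

/-- The commutator with `β k` meets exactly one summand, the one with i = -1 - k. -/
lemma G_β (O : Oscillators h β γ) (m k : ℤ) (x : V) :
    O.G m (β k x) = β k (O.G m x) + (h * (2 * k + 1)) • γ (m + 1 + k) x := by
  have e : ∀ i, β i (γ (m - i) (β k x)) =
      β k (β i (γ (m - i) x)) + if i + k = -1 then (h * (2 * k + 1)) • γ (m - i) x else 0 := by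
    intro i
    rw [← O.βγ, O.ββ]
  rw [G_apply, finsum_congr e, finsum_add_distrib, finsum_ite_unique (-1 - k), G_apply,
    map_finsum _ (O.finite_βγ m x), show m - (-1 - k) = m + 1 + k by ring]
  · intro i; constructor <;> intro <;> lia
  · exact finite_support_map (β k) (O.finite_βγ m x)
  · exact finite_support_ite (-1 - k) _ (fun i hi => by lia) _

lemma G_γ (O : Oscillators h β γ) (m k : ℤ) (x : V) :
    O.G m (γ k x) = -γ k (O.G m x) + h • β (m + k) x := by
  have e : ∀ i, β i (γ (m - i) (γ k x)) =
      (-γ k) (β i (γ (m - i) x)) + if m - i + k = 0 then h • β i x else 0 := by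
    intro i
    rw [O.γγ, map_add, map_neg, O.βγ, LinearMap.neg_apply]
    split_ifs <;> simp
  rw [G_apply, finsum_congr e, finsum_add_distrib, finsum_ite_unique (m + k), G_apply,
    ← map_finsum (-γ k) (O.finite_βγ m x), LinearMap.neg_apply]
  · intro i; constructor <;> intro <;> lia
  · exact finite_support_map (-γ k) (O.finite_βγ m x)
  · exact finite_support_ite (m + k) _ (fun i hi => by lia) _

/-- Commutators of modes are scalars, so the ordering of the pair is irrelevant to its commutator
with a third mode. -/
lemma nβ_β (O : Oscillators h β γ) (i j k : ℤ) (x : V) :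
    nβ β i j (β k x) = β k (nβ β i j x) +
      ((if i + k = -1 then (h * (2 * k + 1)) • β j x else 0) +
        if j + k = -1 then (h * (2 * k + 1)) • β i x else 0) := by
  unfold nβ
  by_cases h0 : j ≤ i <;> by_cases h1 : i + k = -1 <;> by_cases h2 : j + k = -1 <;>
    simp only [LinearMap.comp_apply, O.ββ _ k, map_add, h0, h1, h2, if_true, if_false,
      map_smul, add_zero, zero_add] <;> abel

lemma nγ_γ (O : Oscillators h β γ) (i j k : ℤ) (x : V) :
    nγ γ i j (γ k x) = γ k (nγ γ i j x) +
      ((if i + k = 0 then -h • γ j x else 0) + if j + k = 0 then h • γ i x else 0) := by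
  unfold nγ
  by_cases h0 : j ≤ i <;> by_cases h1 : i + k = 0 <;> by_cases h2 : j + k = 0 <;>
    simp only [LinearMap.comp_apply, LinearMap.neg_apply, O.γγ _ k, map_add, h0, h1, h2, if_true,
      if_false, map_smul, map_neg, neg_smul, add_zero, zero_add] <;> abel

lemma nβ_γ (O : Oscillators h β γ) (i j k : ℤ) (x : V) :
    nβ β i j (γ k x) = γ k (nβ β i j x) := by
  unfold nβ
  split_ifs <;> simp only [LinearMap.comp_apply, O.βγ]

lemma nγ_β (O : Oscillators h β γ) (i j k : ℤ) (x : V) :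
    nγ γ i j (β k x) = β k (nγ γ i j x) := by
  unfold nγ
  split_ifs <;> simp only [LinearMap.comp_apply, LinearMap.neg_apply, O.βγ, map_neg]

lemma T_β (O : Oscillators h β γ) (n k : ℤ) (x : V) :
    O.T n (β k x) = β k (O.T n x) + (2 * h * (2 * k + 1)) • β (n + 1 + k) x := by
  have hf1 := finite_support_map (β k) (O.finite_nβ n x)
  have hf2 := finite_support_smul (fun i => ((2 * i - 1 : ℤ) : R)) (O.finite_nγ (n + 1) x)
  have hf3 : (Function.support fun i => if i + k = -1 then (h * (2 * k + 1)) • β (n - i) x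
      else 0).Finite := finite_support_ite (-1 - k) _ (fun i hi => by lia) _
  have hf4 : (Function.support fun i => if n - i + k = -1 then (h * (2 * k + 1)) • β i x
      else 0).Finite := finite_support_ite (n + 1 + k) _ (fun i hi => by lia) _
  have e1 : ∑ᶠ i, nβ β i (n - i) (β k x) = β k (∑ᶠ i, nβ β i (n - i) x) +
      (2 * h * (2 * k + 1)) • β (n + 1 + k) x := by
    simp_rw [O.nβ_β]
    rw [finsum_add_distrib hf1 (finite_support_add hf3 hf4), finsum_add_distrib hf3 hf4,
      finsum_ite_unique (-1 - k), finsum_ite_unique (n + 1 + k), map_finsum _ (O.finite_nβ n x),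
      show n - (-1 - k) = n + 1 + k by ring, ← add_smul]
    · congr 2; ring
    · intro i; constructor <;> intro <;> lia
    · intro i; constructor <;> intro <;> lia
  have e2 : ∑ᶠ i, ((2 * i - 1 : ℤ) : R) • nγ γ i (n + 1 - i) (β k x) =
      β k (∑ᶠ i, ((2 * i - 1 : ℤ) : R) • nγ γ i (n + 1 - i) x) := by
    rw [map_finsum _ hf2]
    simp_rw [O.nγ_β, map_smul]
  rw [T_apply, T_apply, e1, e2]
  split_ifs <;> simp only [map_add, map_smul, map_zero] <;> abel

/-- The two contractions carry the weights -(2(-k) - 1) and 2(n + 1 + k) - 1, whose sum is 2n + 2 +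
4k. -/
lemma T_γ (O : Oscillators h β γ) (n k : ℤ) (x : V) :
    O.T n (γ k x) = γ k (O.T n x) + (h * (2 * n + 2 + 4 * k)) • γ (n + 1 + k) x := by
  have hf2 := finite_support_smul (fun i => ((2 * i - 1 : ℤ) : R)) (O.finite_nγ (n + 1) x)
  have hf1 := finite_support_map (γ k) hf2
  have hf3 : (Function.support fun i => if i + k = 0 then
      ((2 * i - 1 : ℤ) : R) • (-h • γ (n + 1 - i) x) else 0).Finite :=
    finite_support_ite (-k) _ (fun i hi => by lia) _
  have hf4 : (Function.support fun i => if n + 1 - i + k = 0 then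
      ((2 * i - 1 : ℤ) : R) • (h • γ i x) else 0).Finite :=
    finite_support_ite (n + 1 + k) _ (fun i hi => by lia) _
  have e1 : ∑ᶠ i, nβ β i (n - i) (γ k x) = γ k (∑ᶠ i, nβ β i (n - i) x) := by
    rw [map_finsum _ (O.finite_nβ n x)]
    simp_rw [O.nβ_γ]
  have e2 : ∑ᶠ i, ((2 * i - 1 : ℤ) : R) • nγ γ i (n + 1 - i) (γ k x) =
      γ k (∑ᶠ i, ((2 * i - 1 : ℤ) : R) • nγ γ i (n + 1 - i) x) +
        (h * (2 * n + 2 + 4 * k)) • γ (n + 1 + k) x := by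
    have : ∀ i, ((2 * i - 1 : ℤ) : R) • nγ γ i (n + 1 - i) (γ k x) =
        γ k (((2 * i - 1 : ℤ) : R) • nγ γ i (n + 1 - i) x) +
        ((if i + k = 0 then ((2 * i - 1 : ℤ) : R) • (-h • γ (n + 1 - i) x) else 0) +
          if n + 1 - i + k = 0 then ((2 * i - 1 : ℤ) : R) • (h • γ i x) else 0) := by
      intro i
      rw [O.nγ_γ, smul_add, smul_add, map_smul, smul_ite, smul_ite, smul_zero]
    rw [finsum_congr this, finsum_add_distrib hf1 (finite_support_add hf3 hf4),
      finsum_add_distrib hf3 hf4, finsum_ite_unique (-k), finsum_ite_unique (n + 1 + k),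
      map_finsum _ hf2, show n + 1 - (-k) = n + 1 + k by ring, smul_smul, smul_smul, ← add_smul]
    · congr 2; push_cast; ring
    · intro i; constructor <;> intro <;> lia
    · intro i; constructor <;> intro <;> lia
  rw [T_apply, T_apply, e1, e2]
  split_ifs <;> simp only [map_add, map_smul, map_zero] <;> abel

/-- T_n acts on each β_i γ_{a-i} as a derivation. After shifting the index in the terms where β is
hit, the weights 2n + 2 + 4(a - i) and 2(2(i - n - 1) + 1) add up to 4a - 2n, independent of i. -/
lemma T_G (O : Oscillators h β γ) (n a : ℤ) (x : V) :
    O.T n (O.G a x) = O.G a (O.T n x) + (h * (4 * a - 2 * n)) • O.G (n + 1 + a) x := by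
  have e : ∀ i, O.T n (β i (γ (a - i) x)) = β i (γ (a - i) (O.T n x)) +
      ((h * (2 * n + 2 + 4 * ((a - i : ℤ) : R))) • β i (γ (n + 1 + a - i) x) +
        (2 * h * (2 * i + 1)) • β (n + 1 + i) (γ (n + 1 + a - (n + 1 + i)) x)) := by
    intro i
    rw [O.T_β, O.T_γ, map_add, map_smul, show n + 1 + a - i = n + 1 + (a - i) by ring,
      show n + 1 + a - (n + 1 + i) = a - i by ring, add_assoc]
  have hf := O.finite_βγ (n + 1 + a) x
  have hf1 := finite_support_smul (fun i : ℤ => h * (2 * n + 2 + 4 * ((a - i : ℤ) : R))) hf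
  have hf2 := finite_support_smul (fun i : ℤ => 2 * h * (2 * ((i - (n + 1) : ℤ) : R) + 1)) hf
  have hf3 := hf2.preimage (f := fun i => n + 1 + i) (by intro x _ y _; simp)
  have hf3' : (Function.support fun i : ℤ => (2 * h * (2 * (i : R) + 1)) •
      β (n + 1 + i) (γ (n + 1 + a - (n + 1 + i)) x)).Finite := by
    refine hf3.subset fun i hi => ?_
    simpa using hi
  rw [G_apply, map_finsum _ (O.finite_βγ a x), finsum_congr e,
    finsum_add_distrib (O.finite_βγ a _) (finite_support_add hf1 hf3'),
    finsum_add_distrib hf1 hf3', ← O.G_apply a]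
  congr 1
  have : ∑ᶠ i : ℤ, (2 * h * (2 * (i : R) + 1)) • β (n + 1 + i) (γ (n + 1 + a - (n + 1 + i)) x) =
      ∑ᶠ i : ℤ, (2 * h * (2 * ((i - (n + 1) : ℤ) : R) + 1)) • β i (γ (n + 1 + a - i) x) := by
    conv_rhs => rw [← finsum_comp_equiv (Equiv.addLeft (n + 1))]
    refine finsum_congr fun i => ?_
    rw [Equiv.coe_addLeft, add_sub_cancel_left]
  rw [this, ← finsum_add_distrib hf1 hf2, G_apply, smul_finsum' _ hf]
  refine finsum_congr fun i => ?_
  rw [← add_smul]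
  congr 1
  push_cast
  ring

/-- The outer supercurrent is commuted through each β_i γ_{n-i}. The bosonic and fermionic parts
stay together, since for m + n = -1 only their sum is locally finite in general. -/
lemma G_G_eq_finsum (O : Oscillators h β γ) (m n : ℤ) (x : V) :
    (Function.support fun i => h • (β i (β (m + n - i) x) +
        ((2 * i + 1 : ℤ) : R) • γ (m + 1 + i) (γ (n - i) x))).Finite ∧
    O.G m (O.G n x) + O.G n (O.G m x) =
      ∑ᶠ i, h • (β i (β (m + n - i) x) +
        ((2 * i + 1 : ℤ) : R) • γ (m + 1 + i) (γ (n - i) x)) := by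
  have e : ∀ i, O.G m (β i (γ (n - i) x)) + β i (γ (n - i) (O.G m x)) =
      h • (β i (β (m + n - i) x) + ((2 * i + 1 : ℤ) : R) • γ (m + 1 + i) (γ (n - i) x)) := by
    intro i
    rw [O.G_β, O.G_γ, map_add, map_neg, map_smul, smul_add, smul_smul,
      show m + (n - i) = m + n - i by ring]
    push_cast
    abel
  have hf1 := finite_support_map (O.G m) (O.finite_βγ n x)
  have hf2 := O.finite_βγ n (O.G m x)
  refine ⟨(finite_support_add hf1 hf2).subset fun i hi => ?_, ?_⟩
  · rw [Function.mem_support, ← e] at hi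
    exact hi
  · rw [O.G_apply n, O.G_apply n, map_finsum _ (O.finite_βγ n x), ← finsum_congr e]
    exact (finsum_add_distrib hf1 hf2).symm

/-- For m + n ≠ -1 the paired modes have no contraction, so normal ordering changes nothing. What
remains is a mismatch -2m of the fermionic weights, which multiplies a sum that vanishes by
antisymmetry. -/
lemma G_G_of_ne [Invertible (2 : R)] (O : Oscillators h β γ) {m n : ℤ} (hmn : m + n ≠ -1) (x : V) :
    O.G m (O.G n x) + O.G n (O.G m x) = h • O.T (m + n) x := by
  have hβ : ∀ i, nβ β i (m + n - i) x = β i (β (m + n - i) x) := by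
    intro i
    unfold nβ
    split_ifs
    · rfl
    · rw [LinearMap.comp_apply, O.ββ, if_neg (by lia), add_zero]
  have hγ : ∀ i, nγ γ i (m + n + 1 - i) x = γ i (γ (m + n + 1 - i) x) := by
    intro i
    unfold nγ
    split_ifs
    · rfl
    · rw [LinearMap.neg_apply, LinearMap.comp_apply, O.γγ, if_neg (by lia), add_zero, neg_neg]
  have hfβ : (Function.support fun i => β i (β (m + n - i) x)).Finite := by
    simpa only [hβ] using O.finite_nβ (m + n) x
  have hfγ : (Function.support fun i => γ i (γ (m + n + 1 - i) x)).Finite := by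
    simpa only [hγ] using O.finite_nγ (m + n + 1) x
  -- The reflection i ↦ m + n + 1 - i changes the sign of the sum, and 2 is invertible.
  have hs : ∑ᶠ i, γ i (γ (m + n + 1 - i) x) = 0 := by
    have h1 : ∑ᶠ i, γ i (γ (m + n + 1 - i) x) = -∑ᶠ i, γ i (γ (m + n + 1 - i) x) := by
      conv_lhs => rw [← finsum_comp_equiv (Equiv.subLeft (m + n + 1))]
      rw [← finsum_neg_distrib]
      refine finsum_congr fun i => ?_
      rw [Equiv.subLeft_apply, sub_sub_cancel, O.γγ, if_neg (by lia), add_zero]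
    have h2 : (2 : R) • ∑ᶠ i, γ i (γ (m + n + 1 - i) x) = 0 := by
      rw [two_smul]
      nth_rewrite 1 [h1]
      exact neg_add_cancel _
    rw [← one_smul R (∑ᶠ i, γ i (γ (m + n + 1 - i) x)), ← invOf_mul_self (2 : R), mul_smul, h2,
      smul_zero]
  rw [(O.G_G_eq_finsum m n x).2]
  have hfγ1 := finite_support_smul (fun i : ℤ => ((2 * i - 1 : ℤ) : R)) hfγ
  have hfγ2 := finite_support_smul (fun i : ℤ => ((2 * (i - (m + 1)) + 1 : ℤ) : R)) hfγ
  have hfγ3 := hfγ2.preimage (f := fun i => m + 1 + i) (by intro x _ y _; simp)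
  have hfγ4 : (Function.support fun i : ℤ => ((2 * i + 1 : ℤ) : R) •
      γ (m + 1 + i) (γ (n - i) x)).Finite := by
    refine hfγ3.subset fun i hi => ?_
    have : m + n + 1 - (m + 1 + i) = n - i := by ring
    simpa [this] using hi
  rw [← smul_finsum' h (finite_support_add hfβ hfγ4), finsum_add_distrib hfβ hfγ4, T_apply,
    if_neg hmn, add_zero]
  simp only [hβ, hγ]
  congr 2
  have : ∑ᶠ i : ℤ, ((2 * i + 1 : ℤ) : R) • γ (m + 1 + i) (γ (n - i) x) =
      ∑ᶠ i : ℤ, ((2 * (i - (m + 1)) + 1 : ℤ) : R) • γ i (γ (m + n + 1 - i) x) := by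
    conv_rhs => rw [← finsum_comp_equiv (Equiv.addLeft (m + 1))]
    refine finsum_congr fun i => ?_
    rw [Equiv.coe_addLeft, show m + n + 1 - (m + 1 + i) = n - i by ring, add_sub_cancel_left]
  rw [this, ← sub_eq_zero, ← finsum_sub_distrib hfγ2 hfγ1]
  calc _ = ∑ᶠ i, ((-2 * m : ℤ) : R) • γ i (γ (m + n + 1 - i) x) := by
        refine finsum_congr fun i => ?_
        rw [← sub_smul]
        congr 1
        push_cast
        ring
    _ = 0 := by rw [← smul_finsum' _ hfγ, hs, smul_zero]

/-- For total index -1 each summand is normally ordered separately: the bosonic and fermionic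
constants ∓(2i + 1)h cancel. The weight 2i + 1 exceeds the one in `T` by 2, and twice the normally
ordered fermion bilinear is `h`; this is the constant in `T (-1)`. -/
lemma G_G_neg_one_zero (O : Oscillators h β γ) (x : V) :
    O.G (-1) (O.G 0 x) + O.G 0 (O.G (-1) x) = h • O.T (-1) x := by
  have e : ∀ i : ℤ, β i (β (-1 + 0 - i) x) +
      ((2 * i + 1 : ℤ) : R) • γ (-1 + 1 + i) (γ (0 - i) x) =
      nβ β i (-1 - i) x + (((2 * i - 1 : ℤ) : R) • nγ γ i (-1 + 1 - i) x +
        (2 : R) • nγ γ i (-1 + 1 - i) x) := by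
    intro i
    rw [← add_smul, show ((2 * i - 1 : ℤ) : R) + 2 = ((2 * i + 1 : ℤ) : R) by push_cast; ring]
    simp only [neg_add_cancel, zero_add, add_zero]
    unfold nβ nγ
    by_cases hi : 0 ≤ i
    · rw [if_pos (by lia), if_pos (by lia)]
      rfl
    · rw [if_neg (by lia), if_neg (by lia), LinearMap.neg_apply, LinearMap.comp_apply,
        LinearMap.comp_apply, O.ββ, O.γγ i, if_pos (by lia), if_pos (by lia), smul_add, smul_smul]
      have : h * (2 * ((-1 - i : ℤ) : R) + 1) = -(((2 * i + 1 : ℤ) : R) * h) := by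
        push_cast; ring
      rw [this, neg_smul]
      abel
  have hf := O.finite_nγ (-1 + 1) x
  -- Normally ordered pairs cancel under i ↦ -i except for the zero mode, whose square is half of
  -- `h`.
  have hs : (2 : R) • ∑ᶠ i, nγ γ i (-1 + 1 - i) x = h • x := by
    have h1 : ∀ i : ℤ, nγ γ (-i) (-1 + 1 - -i) x =
        -nγ γ i (-1 + 1 - i) x + if i = 0 then h • x else 0 := by
      intro i
      unfold nγ
      rcases lt_trichotomy i 0 with hi | hi | hi
      · rw [if_pos (by lia), if_neg (by lia), if_neg hi.ne, LinearMap.neg_apply]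
        simp
      · subst hi
        simpa using O.γγ 0 0 x
      · rw [if_neg (by lia), if_pos (by lia), if_neg hi.ne', LinearMap.neg_apply]
        simp
    have h2 : ∑ᶠ i, nγ γ i (-1 + 1 - i) x = -∑ᶠ i, nγ γ i (-1 + 1 - i) x + h • x := by
      conv_lhs => rw [← finsum_comp_equiv (Equiv.neg ℤ)]
      simp only [Equiv.neg_apply]
      rw [finsum_congr h1, finsum_add_distrib, finsum_neg_distrib,
        finsum_ite_unique 0 _ (fun i => Iff.rfl)]
      · exact finite_support_map (-(LinearMap.id : V →ₗ[R] V)) hf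
      · exact finite_support_ite 0 _ (fun i hi => hi) _
    rw [two_smul]
    nth_rewrite 1 [h2]
    abel
  have hf1 := finite_support_smul (fun i : ℤ => ((2 * i - 1 : ℤ) : R)) hf
  have hf2 := finite_support_smul (fun _ : ℤ => (2 : R)) hf
  rw [(O.G_G_eq_finsum (-1) 0 x).2]
  simp_rw [e]
  rw [← smul_finsum' h (finite_support_add (O.finite_nβ (-1) x) (finite_support_add hf1 hf2)),
    finsum_add_distrib (O.finite_nβ (-1) x) (finite_support_add hf1 hf2),
    finsum_add_distrib hf1 hf2, ← smul_finsum' _ hf, hs, T_apply, if_pos rfl, add_assoc]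

/-- Once h T_n is the anticommutator of G_a and G_b, its commutator with T_m follows from `T_G`
alone. The factor `h` stays, as `h` may be a zero divisor on `V`; in the application it is cancelled
by `h_smul_mem_Fil`. -/
lemma T_T_of_G_G (O : Oscillators h β γ) {m n a b : ℤ} (hab : a + b = n)
    (h1 : ∀ x, O.G a (O.G b x) + O.G b (O.G a x) = h • O.T n x)
    (h2 : ∀ x, O.G (m + 1 + a) (O.G b x) + O.G b (O.G (m + 1 + a) x) = h • O.T (m + n + 1) x)
    (h3 : ∀ x, O.G a (O.G (m + 1 + b) x) + O.G (m + 1 + b) (O.G a x) = h • O.T (m + n + 1) x)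
    (x : V) :
    h • O.T m (O.T n x) = h • O.T n (O.T m x) + (h * h * (4 * (n - m))) • O.T (m + n + 1) x := by
  have e1 : h • O.T m (O.T n x) = O.T m (O.G a (O.G b x) + O.G b (O.G a x)) := by
    rw [h1, map_smul]
  rw [e1, ← h1, map_add]
  simp only [O.T_G, map_add, map_smul]
  have e2 : (h * h * (4 * (n - m)) : R) • O.T (m + n + 1) x =
      (h * (4 * a - 2 * m)) • (h • O.T (m + n + 1) x) +
        (h * (4 * b - 2 * m)) • (h • O.T (m + n + 1) x) := by
    rw [← add_smul, smul_smul]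
    congr 1
    rw [← hab]
    push_cast
    ring
  rw [e2]
  nth_rewrite 1 [← h2]
  rw [← h3]
  simp only [smul_add]
  abel

lemma T_T [Invertible (2 : R)] (O : Oscillators h β γ) {m n : ℤ} (hm : m ≤ 0) (hn : n < m) (x : V) :
    h • O.T m (O.T n x) = h • O.T n (O.T m x) + (h * h * (4 * (n - m))) • O.T (m + n + 1) x := by
  have h10 := O.G_G_neg_one_zero
  have key : ∀ p q k : ℤ, p + q = k → (k ≠ -1 ∨ (p = -1 ∧ q = 0) ∨ (p = 0 ∧ q = -1)) → ∀ x,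
      O.G p (O.G q x) + O.G q (O.G p x) = h • O.T k x := by
    rintro p q k rfl hk x
    rcases hk with hk | ⟨rfl, rfl⟩ | ⟨rfl, rfl⟩
    · exact O.G_G_of_ne hk x
    · exact O.G_G_neg_one_zero x
    · rw [add_comm (O.G 0 _)]
      exact O.G_G_neg_one_zero x
  -- The decomposition n = a + b is chosen so that all three anticommutators either have total index
  -- different from -1 or use the pair -1, 0, the only one known at total index -1.
  by_cases c1 : n = -1
  · exact O.T_T_of_G_G (a := -1) (b := 0) (by lia) (key _ _ _ (by lia) (by lia))
      (key _ _ _ (by lia) (by lia)) (key _ _ _ (by lia) (by lia)) x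
  by_cases c2 : m + n = -2
  · exact O.T_T_of_G_G (a := -1) (b := -1) (by lia) (key _ _ _ (by lia) (by lia))
      (key _ _ _ (by lia) (by lia)) (key _ _ _ (by lia) (by lia)) x
  · exact O.T_T_of_G_G (a := n) (b := 0) (by lia) (key _ _ _ (by lia) (by lia))
      (key _ _ _ (by lia) (by lia)) (key _ _ _ (by lia) (by lia)) x

end Oscillators

end

end SuperTR

namespace SuperTR

noncomputable section

/-! ### The algebra of words

A superfunction is recorded by its iterated derivatives at the origin: the value at the word
`a :: w` is the value at `w` of the derivative in the direction `a`.  The letter `inl i` stands for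
the coordinate dual to `dξ_{-(i+1)}`, the letter `inr k` for the one dual to `η_{-k}`. -/

/-- Bosonic (`inl`) and fermionic (`inr`) coordinates. -/
abbrev Letter : Type := ℕ ⊕ ℕ

section Words

variable {R : Type*} [CommRing R]

/-- The parity automorphism. -/
def tw (f : List Letter → R) : List Letter → R := fun w => (-1) ^ w.countP Sum.isRight * f w

/-- The parity automorphism, if `b` is odd. -/
def tws (b : Bool) (f : List Letter → R) : List Letter → R := if b then tw f else f

/-- The derivative in the direction of a letter. -/
def dl (a : Letter) (f : List Letter → R) : List Letter → R := fun w => f (a :: w)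

/-- The sign of exchanging elements of parities `b` and `c`. -/
def eps (b c : Bool) : R := if b && c then -1 else 1

/-- The value of a product at a word, by the Leibniz rule. -/
def shAux : List Letter → (List Letter → R) → (List Letter → R) → R
  | [], f, g => f [] * g []
  | a :: w, f, g => shAux w (dl a f) g + shAux w (tws a.isRight f) (dl a g)

/-- The product. -/
def sh (f g : List Letter → R) : List Letter → R := fun w => shAux w f g

lemma dl_sh (a : Letter) (f g : List Letter → R) :
    dl a (sh f g) = sh (dl a f) g + sh (tws a.isRight f) (dl a g) := rfl

lemma dl_add (a : Letter) (f g : List Letter → R) : dl a (f + g) = dl a f + dl a g := rfl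

lemma tw_add (f g : List Letter → R) : tw (f + g) = tw f + tw g := by
  funext w; simp [tw, mul_add]

lemma tw_smul (r : R) (f : List Letter → R) : tw (r • f) = r • tw f := by
  funext w; simp only [tw, Pi.smul_apply, smul_eq_mul]; ring

lemma tw_tw (f : List Letter → R) : tw (tw f) = f := by
  funext w; simp only [tw, ← mul_assoc, ← mul_pow]; simp

lemma tws_add (b : Bool) (f g : List Letter → R) : tws b (f + g) = tws b f + tws b g := by
  cases b <;> simp [tws, tw_add]

lemma tws_smul (b : Bool) (r : R) (f : List Letter → R) : tws b (r • f) = r • tws b f := by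
  cases b <;> simp [tws, tw_smul]

lemma tws_tws (b c : Bool) (f : List Letter → R) : tws b (tws c f) = tws (b ^^ c) f := by
  cases b <;> cases c <;> simp [tws, tw_tw]

lemma dl_tw (a : Letter) (f : List Letter → R) :
    dl a (tw f) = (eps a.isRight true : R) • tw (dl a f) := by
  funext w
  cases a <;> simp [dl, tw, eps, List.countP_cons, pow_succ]

lemma dl_tws (a : Letter) (b : Bool) (f : List Letter → R) :
    dl a (tws b f) = (eps a.isRight b : R) • tws b (dl a f) := by
  cases b
  · simp [tws, eps]
  · simpa [tws] using dl_tw a f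

lemma eps_mul_self (b c : Bool) : (eps b c : R) * eps b c = 1 := by
  cases b <;> cases c <;> simp [eps]

lemma eps_comm (b c : Bool) : (eps b c : R) = eps c b := by
  cases b <;> cases c <;> simp [eps]

lemma shAux_add_left (w : List Letter) : ∀ f f' g : List Letter → R,
    shAux w (f + f') g = shAux w f g + shAux w f' g := by
  induction w with
  | nil => intro f f' g; simp [shAux, add_mul]
  | cons a w ih =>
    intro f f' g
    have : dl a (f + f') = dl a f + dl a f' := rfl
    simp only [shAux, this, tws_add, ih]
    ring

lemma shAux_add_right (w : List Letter) : ∀ f g g' : List Letter → R,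
    shAux w f (g + g') = shAux w f g + shAux w f g' := by
  induction w with
  | nil => intro f f' g; simp [shAux, mul_add]
  | cons a w ih =>
    intro f g g'
    have : dl a (g + g') = dl a g + dl a g' := rfl
    simp only [shAux, this, ih]
    ring

lemma shAux_smul_left (w : List Letter) : ∀ (r : R) (f g : List Letter → R),
    shAux w (r • f) g = r * shAux w f g := by
  induction w with
  | nil => intro r f g; simp [shAux, mul_assoc]
  | cons a w ih =>
    intro r f g
    have : dl a (r • f) = r • dl a f := rfl
    simp only [shAux, this, tws_smul, ih]
    ring

lemma shAux_smul_right (w : List Letter) : ∀ (r : R) (f g : List Letter → R),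
    shAux w f (r • g) = r * shAux w f g := by
  induction w with
  | nil => intro r f g; simp [shAux, mul_left_comm]
  | cons a w ih =>
    intro r f g
    have : dl a (r • g) = r • dl a g := rfl
    simp only [shAux, this, ih]
    ring

lemma sh_add_left (f f' g : List Letter → R) : sh (f + f') g = sh f g + sh f' g :=
  funext fun w => shAux_add_left w f f' g

lemma sh_add_right (f g g' : List Letter → R) : sh f (g + g') = sh f g + sh f g' :=
  funext fun w => shAux_add_right w f g g'

lemma sh_smul_left (r : R) (f g : List Letter → R) : sh (r • f) g = r • sh f g :=
  funext fun w => shAux_smul_left w r f g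

lemma sh_smul_right (r : R) (f g : List Letter → R) : sh f (r • g) = r • sh f g :=
  funext fun w => shAux_smul_right w r f g

lemma tw_shAux (w : List Letter) : ∀ f g : List Letter → R,
    (-1) ^ w.countP Sum.isRight * shAux w f g = shAux w (tw f) (tw g) := by
  induction w with
  | nil => intro f g; simp [shAux, tw]
  | cons a w ih =>
    intro f g
    simp only [shAux, dl_tw, shAux_smul_left, shAux_smul_right]
    cases a with
    | inl i => simp [eps, tws, ← ih, mul_add]
    | inr i => simp [eps, tws, ← ih, mul_add, List.countP_cons, pow_succ]

lemma tw_sh (f g : List Letter → R) : tw (sh f g) = sh (tw f) (tw g) :=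
  funext fun w => tw_shAux w f g

lemma tws_sh (b : Bool) (f g : List Letter → R) : tws b (sh f g) = sh (tws b f) (tws b g) := by
  cases b
  · rfl
  · simpa [tws] using tw_sh f g

lemma sh_assoc (f g k : List Letter → R) : sh (sh f g) k = sh f (sh g k) := by
  funext w
  induction w generalizing f g k with
  | nil => exact mul_assoc _ _ _
  | cons a w ih =>
    change sh (dl a (sh f g)) k w + sh (tws a.isRight (sh f g)) (dl a k) w =
      sh (dl a f) (sh g k) w + sh (tws a.isRight f) (dl a (sh g k)) w
    simp only [dl_sh, tws_sh, sh_add_left, sh_add_right, Pi.add_apply, ih]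
    ring

/-- Homogeneous elements of parity `p`. -/
def HasParity (p : Bool) (f : List Letter → R) : Prop := tw f = (eps true p : R) • f

lemma HasParity.dl {p : Bool} {f : List Letter → R} (hf : HasParity p f) (a : Letter) :
    HasParity (a.isRight ^^ p) (dl a f) := by
  have h := congrArg (SuperTR.dl a) hf
  rw [dl_tw] at h
  have h2 : SuperTR.dl a ((eps true p : R) • f) = (eps true p : R) • SuperTR.dl a f := rfl
  rw [h2] at h
  unfold HasParity
  have h3 := congrArg (fun x => (eps a.isRight true : R) • x) h
  simp only [smul_smul, eps_mul_self, one_smul] at h3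
  rw [h3]
  congr 1
  cases a <;> cases p <;> simp [eps]

lemma HasParity.tws {p : Bool} {f : List Letter → R} (hf : HasParity p f) (b : Bool) :
    tws b f = (eps b p : R) • f := by
  cases b
  · simp [SuperTR.tws, eps]
  · simpa [SuperTR.tws, HasParity] using hf

lemma HasParity.sh {p q : Bool} {f g : List Letter → R} (hf : HasParity p f) (hg : HasParity q g) :
    HasParity (p ^^ q) (sh f g) := by
  unfold HasParity
  rw [tw_sh, hf, hg, sh_smul_left, sh_smul_right, smul_smul]
  congr 1
  cases p <;> cases q <;> simp [eps]

lemma HasParity.add {p : Bool} {f g : List Letter → R} (hf : HasParity p f) (hg : HasParity p g) :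
    HasParity p (f + g) := by
  unfold HasParity
  rw [tw_add, hf, hg, smul_add]

lemma HasParity.smul {p : Bool} {f : List Letter → R} (hf : HasParity p f) (r : R) :
    HasParity p (r • f) := by
  unfold HasParity
  rw [tw_smul, hf, smul_comm]

lemma HasParity.zero (p : Bool) : HasParity p (0 : List Letter → R) := by
  funext w; simp [tw]

/-- Only one factor has to be homogeneous: twisting the other one by the parity automorphism
accounts for the sign. -/
lemma sh_comm {p : Bool} {f : List Letter → R} (hf : HasParity p f) (g : List Letter → R) :
    sh f g = sh (tws p g) f := by
  funext w
  induction w generalizing p f g with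
  | nil =>
    change f [] * g [] = tws p g [] * f []
    cases p <;> simp [tws, tw, mul_comm]
  | cons a w ih =>
    change sh (dl a f) g w + sh (tws a.isRight f) (dl a g) w =
      sh (dl a (tws p g)) f w + sh (tws a.isRight (tws p g)) (dl a f) w
    rw [ih (hf.dl a) g, hf.tws, sh_smul_left, Pi.smul_apply, ih hf, tws_tws, dl_tws, sh_smul_left,
      Pi.smul_apply, add_comm]

/-- The unit. -/
def one : List Letter → R := fun w => if w = [] then 1 else 0

lemma dl_one (a : Letter) : dl a (one : List Letter → R) = 0 := by
  funext w; simp [dl, one]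

lemma sh_zero_left (g : List Letter → R) : sh 0 g = 0 := by
  simpa using sh_smul_left (0 : R) 0 g

lemma sh_zero_right (g : List Letter → R) : sh g 0 = 0 := by
  simpa using sh_smul_right (0 : R) g 0

lemma hasParity_one : HasParity false (one : List Letter → R) := by
  funext w
  by_cases hw : w = [] <;> simp [tw, one, hw, eps]

lemma sh_one (f : List Letter → R) : sh f one = f := by
  funext w
  induction w generalizing f with
  | nil => change f [] * one [] = f []; simp [one]
  | cons a w ih =>
    change sh (dl a f) one w + sh (tws a.isRight f) (dl a one) w = f (a :: w)
    rw [ih, dl_one, sh_zero_right]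
    simp [dl]

lemma one_sh (f : List Letter → R) : sh one f = f := by
  rw [sh_comm hasParity_one, tws, if_neg (by simp), sh_one]

/-- The coordinate functions. -/
def var (a : Letter) : List Letter → R := fun w => if w = [a] then 1 else 0

lemma dl_var (a b : Letter) : dl a (var b : List Letter → R) = if a = b then one else 0 := by
  funext w
  by_cases h : a = b
  · by_cases hw : w = [] <;> simp [dl, var, one, h, hw]
  · simp [dl, var, h]

lemma hasParity_var (a : Letter) : HasParity a.isRight (var a : List Letter → R) := by
  funext w
  by_cases hw : w = [a]
  · cases a <;> simp [tw, var, hw, eps]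
  · simp [tw, var, hw]

/-- Supersymmetric functions of words. -/
def IsSym (f : List Letter → R) : Prop :=
  ∀ u a b v, f (u ++ a :: b :: v) = eps a.isRight b.isRight * f (u ++ b :: a :: v)

lemma IsSym.dl {f : List Letter → R} (hf : IsSym f) (a : Letter) : IsSym (dl a f) :=
  fun u b c v => hf (a :: u) b c v

lemma IsSym.dl_dl {f : List Letter → R} (hf : IsSym f) (a b : Letter) :
    SuperTR.dl a (SuperTR.dl b f) = (eps a.isRight b.isRight : R) •
      SuperTR.dl b (SuperTR.dl a f) := by
  funext w
  rw [eps_comm]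
  exact hf [] b a w

lemma IsSym.add {f g : List Letter → R} (hf : IsSym f) (hg : IsSym g) : IsSym (f + g) := by
  intro u a b v
  simp only [Pi.add_apply, hf u a b v, hg u a b v, mul_add]

lemma IsSym.smul {f : List Letter → R} (hf : IsSym f) (r : R) : IsSym (r • f) := by
  intro u a b v
  simp only [Pi.smul_apply, hf u a b v, smul_eq_mul]
  ring

lemma IsSym.tw {f : List Letter → R} (hf : IsSym f) : IsSym (tw f) := by
  intro u a b v
  have : (u ++ a :: b :: v).countP Sum.isRight = (u ++ b :: a :: v).countP Sum.isRight :=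
    List.Perm.countP_eq _ (List.Perm.append_left u (List.Perm.swap b a v))
  simp only [SuperTR.tw, hf u a b v, this]
  ring

lemma IsSym.tws {f : List Letter → R} (hf : IsSym f) (b : Bool) : IsSym (tws b f) := by
  cases b
  · simpa [SuperTR.tws] using hf
  · simpa [SuperTR.tws] using hf.tw

lemma IsSym.sh {f g : List Letter → R} (hf : IsSym f) (hg : IsSym g) : IsSym (sh f g) := by
  intro u
  induction u generalizing f g with
  | nil =>
    intro a b v
    have key : SuperTR.dl b (SuperTR.dl a (SuperTR.sh f g)) =
        (eps a.isRight b.isRight : R) • SuperTR.dl a (SuperTR.dl b (SuperTR.sh f g)) := by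
      -- Of the four terms of a second derivative, exchanging the letters permutes the two mixed
      -- ones and multiplies the outer ones by the sign.
      have e : ∀ a b, SuperTR.dl b (SuperTR.dl a (SuperTR.sh f g)) =
          SuperTR.sh (SuperTR.dl b (SuperTR.dl a f)) g +
          SuperTR.sh (SuperTR.tws b.isRight (SuperTR.dl a f)) (SuperTR.dl b g) +
          ((eps b.isRight a.isRight : R) •
            SuperTR.sh (SuperTR.tws a.isRight (SuperTR.dl b f)) (SuperTR.dl a g) +
          SuperTR.sh (SuperTR.tws (b.isRight ^^ a.isRight) f)
            (SuperTR.dl b (SuperTR.dl a g))) := by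
        intro a b
        rw [dl_sh]
        rw [dl_add, dl_sh, dl_sh, tws_tws, dl_tws, sh_smul_left]
      rw [e, e, hf.dl_dl b a, hg.dl_dl b a, sh_smul_left, sh_smul_right, eps_comm b.isRight,
        Bool.xor_comm b.isRight]
      simp only [smul_add, smul_smul, eps_mul_self, one_smul]
      abel
    exact congrFun key v
  | cons c u ih =>
    intro a b v
    change SuperTR.sh (SuperTR.dl c f) g (u ++ a :: b :: v) +
      SuperTR.sh (SuperTR.tws c.isRight f) (SuperTR.dl c g) (u ++ a :: b :: v) = _ *
      (SuperTR.sh (SuperTR.dl c f) g (u ++ b :: a :: v) +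
      SuperTR.sh (SuperTR.tws c.isRight f) (SuperTR.dl c g) (u ++ b :: a :: v))
    rw [ih (hf.dl c) hg, ih (hf.tws _) (hg.dl c)]
    ring

/-- The index of a letter. -/
def Letter.idx : Letter → ℕ := Sum.elim id id

/-- Functions that involve only letters of index less than `N`. -/
def LettersLT (N : ℕ) (f : List Letter → R) : Prop := ∀ w : List Letter, (∃ a ∈ w, N ≤ Letter.idx a) → f w = 0

lemma LettersLT.mono {N M : ℕ} (h : N ≤ M) {f : List Letter → R} (hf : LettersLT N f) :
    LettersLT M f := fun w ⟨a, ha, h'⟩ => hf w ⟨a, ha, h.trans h'⟩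

lemma LettersLT.dl {N : ℕ} {f : List Letter → R} (hf : LettersLT N f) (a : Letter) :
    LettersLT N (dl a f) :=
  fun _ ⟨b, hb, h⟩ => hf _ ⟨b, List.mem_cons_of_mem _ hb, h⟩

lemma LettersLT.dl_eq_zero {N : ℕ} {f : List Letter → R} (hf : LettersLT N f) {a : Letter}
    (ha : N ≤ a.idx) : SuperTR.dl a f = 0 :=
  funext fun _ => hf _ ⟨a, List.mem_cons_self, ha⟩

lemma LettersLT.add {N : ℕ} {f g : List Letter → R} (hf : LettersLT N f) (hg : LettersLT N g) :
    LettersLT N (f + g) := fun w hw => by simp [hf w hw, hg w hw]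

lemma LettersLT.smul {N : ℕ} {f : List Letter → R} (hf : LettersLT N f) (r : R) :
    LettersLT N (r • f) := fun w hw => by simp [hf w hw]

lemma LettersLT.tw {N : ℕ} {f : List Letter → R} (hf : LettersLT N f) :
    LettersLT N (tw f) := fun w hw => by simp [SuperTR.tw, hf w hw]

lemma LettersLT.tws {N : ℕ} {f : List Letter → R} (hf : LettersLT N f) (b : Bool) :
    LettersLT N (tws b f) := by
  cases b
  · simpa [SuperTR.tws] using hf
  · simpa [SuperTR.tws] using hf.tw

lemma LettersLT.sh {N : ℕ} {f g : List Letter → R} (hf : LettersLT N f) (hg : LettersLT N g) :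
    LettersLT N (sh f g) := by
  intro w
  induction w generalizing f g with
  | nil => simp
  | cons a w ih =>
    intro hw
    change SuperTR.sh (SuperTR.dl a f) g w +
      SuperTR.sh (SuperTR.tws a.isRight f) (SuperTR.dl a g) w = 0
    by_cases ha : N ≤ a.idx
    · rw [hf.dl_eq_zero ha, hg.dl_eq_zero ha, sh_zero_left, sh_zero_right]
      simp
    · have hw' : ∃ b ∈ w, N ≤ b.idx := by
        obtain ⟨b, hb, h⟩ := hw
        rcases List.mem_cons.1 hb with rfl | hb
        · exact absurd h ha
        · exact ⟨b, hb, h⟩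
      rw [ih (hf.dl a) hg hw', ih (hf.tws _) (hg.dl a) hw', add_zero]

variable (R) in
/-- Superfunctions of finitely many variables. -/
def superFun : Submodule R (List Letter → R) where
  carrier := {f | IsSym f ∧ ∃ N, LettersLT N f}
  zero_mem' := ⟨fun u a b v => by simp, 0, fun w _ => rfl⟩
  add_mem' := by
    rintro f g ⟨hf, N, hN⟩ ⟨hg, M, hM⟩
    exact ⟨hf.add hg, max N M, (hN.mono (le_max_left _ _)).add (hM.mono (le_max_right _ _))⟩
  smul_mem' := by
    rintro r f ⟨hf, N, hN⟩
    exact ⟨hf.smul r, N, hN.smul r⟩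

end Words

end

end SuperTR

namespace SuperTR

noncomputable section

open Polynomial

/-! ### Coefficients of the basis forms -/

lemma ofSeq_coeff (f : ℕ → ℂ) (a : ℤ) : (ofSeq f).coeff a = if 0 ≤ a then f a.toNat else 0 := by
  unfold ofSeq
  split_ifs with h
  · lift a to ℕ using h
    rw [HahnSeries.ofPowerSeries_apply_coeff]
    simp
  · rw [HahnSeries.ofPowerSeries_apply]
    refine HahnSeries.embDomain_of_notMem_range ?_
    rintro ⟨n, hn⟩
    simp at hn
    lia

lemma dξNeg_coeff (C : LocalSuperSpectralCurve) (l : ℕ) (a : ℤ) :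
    (dξNeg C l).coeff a = (if a = -(l : ℤ) - 1 then 1 else 0) +
      if 0 ≤ a then C.φ l (a + 1).toNat / l else 0 := by
  unfold dξNeg
  rw [HahnSeries.coeff_add, ofSeq_coeff, HahnSeries.coeff_single]
  congr 1
  · congr
  by_cases h : 0 ≤ a
  · rw [if_pos h, if_pos h, show (a + 1).toNat = a.toNat + 1 by lia]
  · rw [if_neg h, if_neg h]

lemma ηNeg_coeff (C : LocalSuperSpectralCurve) (l : ℕ) (a : ℤ) :
    (ηNeg C l).coeff a = (if a = -(l : ℤ) - 1 then 1 else 0) +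
      if -1 ≤ a then C.ψ l (a + 1).toNat else 0 := by
  unfold ηNeg
  have := HahnSeries.coeff_single_mul_add (r := (1 : ℂ)) (x := ofSeq (C.ψ l)) (a := a + 1) (b := -1)
  rw [show a + 1 + -1 = a by ring] at this
  rw [HahnSeries.coeff_add, this, ofSeq_coeff, HahnSeries.coeff_single, one_mul]
  congr 1
  · congr
  by_cases h : -1 ≤ a
  · rw [if_pos h, if_pos (by lia)]
  · rw [if_neg h, if_neg (by lia)]

lemma w010_coeff (C : LocalSuperSpectralCurve) (a : ℤ) :
    (w010 C).coeff a = if 0 ≤ a then C.τ (a.toNat + 1) else 0 := ofSeq_coeff _ _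

/-- For |z₁| < |z₂| the two-point function is ∑ l z₁^{l-1} dξ_{-l}(z₂): the polarization is the one
read off from ω_{0,2|0}. -/
lemma w020_eq (C : LocalSuperSpectralCurve) (a b : ℤ) :
    w020 C a b = if 0 ≤ a then ((a : ℂ) + 1) * (dξNeg C (a.toNat + 1)).coeff b else 0 := by
  unfold w020
  rw [dξNeg_coeff]
  split_ifs with h1 h2 h3 h4 h5 h6 h7 <;> try lia
  all_goals
    try simp only [add_zero, zero_add, mul_zero, mul_one]
  · have : (a : ℂ) + 1 ≠ 0 := by
      have : (a + 1 : ℤ) ≠ 0 := by lia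
      exact_mod_cast this
    have e : ((a.toNat + 1 : ℕ) : ℂ) = (a : ℂ) + 1 := by
      have : ((a.toNat + 1 : ℕ) : ℤ) = a + 1 := by lia
      exact_mod_cast congrArg (Int.cast : ℤ → ℂ) this
    rw [show (a + 1).toNat = a.toNat + 1 by lia, e]
    field_simp

lemma ψ_zero_right (C : LocalSuperSpectralCurve) (k : ℕ) : C.ψ k 0 = -C.ψ 0 k := by
  have := C.ψ_rel k 0
  rw [C.ψ_zero] at this
  linear_combination this

/-- The fermionic analogue, with an additional half of η₀ ⊗ η₀ from the zero mode. The quadratic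
relation on ψ is what converts the antisymmetrized ψ of ω_{0,0|2} into the ψ of the basis forms. -/
lemma w002_eq (C : LocalSuperSpectralCurve) (a b : ℤ) :
    w002 C a b = (if 0 ≤ a then (ηNeg C (a + 1).toNat).coeff b else 0) +
      1 / 2 * (ηNeg C 0).coeff a * (ηNeg C 0).coeff b := by
  unfold w002 ψPart
  simp only [ηNeg_coeff]
  rcases lt_or_ge a (-1) with ha | ha
  · simp [show ¬ (0 ≤ a) by lia, show ¬ (-1 ≤ a) by lia, show a ≠ -1 by lia]
  rcases lt_or_ge b (-1) with hb | hb
  · simp only [show ¬ (-1 ≤ b) by lia, show b ≠ -1 by lia, and_false, if_false, add_zero,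
      Nat.cast_zero, neg_zero, zero_sub, mul_zero, ha, if_true]
    split_ifs <;> first | rfl | lia
  obtain ⟨p, rfl⟩ : ∃ p : ℕ, a = (p : ℤ) - 1 := ⟨(a + 1).toNat, by lia⟩
  obtain ⟨q, rfl⟩ : ∃ q : ℕ, b = (q : ℤ) - 1 := ⟨(b + 1).toNat, by lia⟩
  have hp : ((p : ℤ) - 1 + 1).toNat = p := by lia
  have hq : ((q : ℤ) - 1 + 1).toNat = q := by lia
  simp only [hp, hq, ha, hb, and_self, if_true, Nat.cast_zero, neg_zero, zero_sub]
  have hpq := C.ψ_rel p q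
  rcases Nat.eq_zero_or_pos p with rfl | hp0
  · rcases Nat.eq_zero_or_pos q with rfl | hq0
    · simp [C.ψ_zero]
    · have h1 : q ≠ 0 := by lia
      simp [C.ψ_zero, h1, ψ_zero_right]
      ring
  · have h1 : p ≠ 0 := by lia
    have h1' : (1 : ℤ) ≤ p := by lia
    rcases Nat.eq_zero_or_pos q with rfl | hq0
    · have h3 : ¬ ((p : ℤ) - 1 + (-1) = -2) := by lia
      simp [C.ψ_zero, h1, ψ_zero_right, h3, show ¬ ((-1 : ℤ) = -(p : ℤ) - 1) by lia]
      rw [if_pos (by lia)]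
      ring
    · have h2 : q ≠ 0 := by lia
      have h3 : ¬ ((p : ℤ) - 1 + ((q : ℤ) - 1) = -2) := by lia
      simp [h1, h2, h3, show ¬ ((q : ℤ) - 1 = -(p : ℤ) - 1) by lia]
      rw [if_pos (by lia)]
      linear_combination (-1 / 2 : ℂ) * hpq

/-- The φ-part is symmetric, so the two expansions differ by a derivative of the delta function: the
commutator of the boson. -/
lemma w020_sub (C : LocalSuperSpectralCurve) (a c : ℤ) :
    w020 C c a - w020 C a c = if a + c = -2 then (c : ℂ) + 1 else 0 := by
  unfold w020
  rw [add_comm c a]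
  by_cases h : a + c = -2
  · have e : (a : ℂ) = -2 - c := by
      have : a = -2 - c := by lia
      rw [this]; push_cast; ring
    rw [if_neg (show ¬ (0 ≤ c ∧ 0 ≤ a) by lia), if_neg (show ¬ (0 ≤ a ∧ 0 ≤ c) by lia)]
    by_cases hc : 0 ≤ c
    · rw [if_pos (by lia), if_neg (by lia), if_pos h]; ring
    · by_cases ha : 0 ≤ a
      · rw [if_neg (by lia), if_pos (by lia), if_pos h, e]; ring
      · have : c = -1 := by lia
        rw [if_neg (by lia), if_neg (by lia), if_pos h, this]; simp
  · rw [if_neg (show ¬ (0 ≤ c ∧ a + c = -2) from fun x => h x.2),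
      if_neg (show ¬ (0 ≤ a ∧ a + c = -2) from fun x => h x.2), if_neg h]
    by_cases h' : 0 ≤ c ∧ 0 ≤ a
    · rw [if_pos h', if_pos h'.symm, C.φ_symm _ _ (by lia) (by lia)]; ring
    · rw [if_neg h', if_neg (fun x => h' x.symm)]; ring

/-- The ψ-part is antisymmetric, so the two expansions add up to a delta function: the
anticommutator of the fermion. -/
lemma w002_add (C : LocalSuperSpectralCurve) (a b : ℤ) :
    w002 C b a + w002 C a b = if a + b = -2 then 1 else 0 := by
  have hP : ∀ p q, ψPart C p q + ψPart C q p = 0 := by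
    intro p q
    unfold ψPart
    rw [mul_comm p q]
    ring
  unfold w002
  rw [add_comm b a]
  have : (if -1 ≤ b ∧ -1 ≤ a then ψPart C (b + 1).toNat (a + 1).toNat else 0) +
      (if -1 ≤ a ∧ -1 ≤ b then ψPart C (a + 1).toNat (b + 1).toNat else 0) = 0 := by
    by_cases h : -1 ≤ a ∧ -1 ≤ b
    · rw [if_pos h, if_pos h.symm]
      exact hP _ _
    · rw [if_neg h, if_neg (fun x => h x.symm), add_zero]
  rw [add_add_add_comm, this, add_zero]
  clear this
  by_cases h : a + b = -2
  · rw [if_pos h]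
    by_cases h1 : a = -1
    · have : b = -1 := by lia
      subst h1 this
      norm_num
    · rw [if_neg (show ¬ (b = -1 ∧ a = -1) by lia), if_neg (show ¬ (a = -1 ∧ b = -1) by lia)]
      by_cases ha : 0 ≤ a
      · rw [if_neg (by lia), if_pos (by lia)]; ring
      · rw [if_pos (by lia), if_neg (by lia)]; ring
  · rw [if_neg h, if_neg (by lia), if_neg (by lia), if_neg (by lia), if_neg (by lia), add_zero]

end

end SuperTR

namespace SuperTR

noncomputable section

/-! ### Operators on superfunctions -/

/-- The ring `ℂ[ħ]`. -/
def Hb : Type := Polynomial ℂ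

namespace Hb

instance : CommRing Hb := inferInstanceAs (CommRing (Polynomial ℂ))

instance : Algebra ℂ Hb := inferInstanceAs (Algebra ℂ (Polynomial ℂ))

/-- The variable `ħ`. -/
def h : Hb := (Polynomial.X : Polynomial ℂ)

/-- The constants. -/
def K : ℂ →+* Hb := algebraMap ℂ Hb

/-- The coefficient of `ħ ^ g`. -/
def coeff (g : ℕ) : Hb →+ ℂ := (Polynomial.lcoeff ℂ g).toAddMonoidHom

lemma coeff_mul (p q : Hb) (g : ℕ) :
    coeff g (p * q) = ∑ i ∈ Finset.HasAntidiagonal.antidiagonal g, coeff i.1 p * coeff i.2 q :=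
  Polynomial.coeff_mul p q g

lemma coeff_h_mul_succ (p : Hb) (g : ℕ) : coeff (g + 1) (h * p) = coeff g p :=
  Polynomial.coeff_X_mul p g

lemma coeff_h_mul_zero (p : Hb) : coeff 0 (h * p) = 0 := by
  exact Polynomial.coeff_X_mul_zero (R := ℂ) p

lemma coeff_K_mul (c : ℂ) (p : Hb) (g : ℕ) : coeff g (K c * p) = c * coeff g p :=
  Polynomial.coeff_C_mul p

lemma coeff_one (g : ℕ) : coeff g 1 = if g = 0 then 1 else 0 :=
  Polynomial.coeff_one

instance : Invertible (2 : Hb) where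
  invOf := K (1 / 2)
  invOf_mul_self := by
    rw [show (2 : Hb) = K 2 from (map_ofNat K 2).symm, ← map_mul]
    norm_num
  mul_invOf_self := by
    rw [show (2 : Hb) = K 2 from (map_ofNat K 2).symm, ← map_mul]
    norm_num

end Hb

open Hb (h K)

/-- Superfunctions over `ℂ[ħ]`. -/
def SF : Type := ↥(superFun Hb)

instance : AddCommGroup SF := inferInstanceAs (AddCommGroup ↥(superFun Hb))

instance : Module Hb SF := inferInstanceAs (Module Hb ↥(superFun Hb))

namespace SF

lemma ext_val {x y : SF} (h : ∀ w, x.1 w = y.1 w) : x = y := Subtype.ext (funext h)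

lemma add_val (x y : SF) : (x + y).1 = x.1 + y.1 := rfl

lemma smul_val (r : Hb) (x : SF) : (r • x).1 = r • x.1 := rfl

lemma zero_val : (0 : SF).1 = 0 := rfl

/-- The derivative in the direction of a letter. -/
def d (a : Letter) : SF →ₗ[Hb] SF where
  toFun x := ⟨dl a x.1, x.2.1.dl a, x.2.2.imp fun _ h => h.dl a⟩
  map_add' _ _ := rfl
  map_smul' _ _ := rfl

/-- The parity automorphism, if `b` is odd. -/
def twist (b : Bool) : SF →ₗ[Hb] SF where
  toFun x := ⟨tws b x.1, x.2.1.tws b, x.2.2.imp fun _ h => h.tws b⟩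
  map_add' x y := Subtype.ext (tws_add b x.1 y.1)
  map_smul' r x := Subtype.ext (tws_smul b r x.1)

/-- The product. -/
def mul : SF →ₗ[Hb] SF →ₗ[Hb] SF :=
  LinearMap.mk₂ Hb (fun x y => ⟨sh x.1 y.1, x.2.1.sh y.2.1, by
      obtain ⟨N, hN⟩ := x.2.2
      obtain ⟨M, hM⟩ := y.2.2
      exact ⟨max N M, (hN.mono (le_max_left _ _)).sh (hM.mono (le_max_right _ _))⟩⟩)
    (fun x x' y => Subtype.ext (sh_add_left x.1 x'.1 y.1))
    (fun r x y => Subtype.ext (sh_smul_left r x.1 y.1))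
    (fun x y y' => Subtype.ext (sh_add_right x.1 y.1 y'.1))
    (fun r x y => Subtype.ext (sh_smul_right r x.1 y.1))

/-- The unit. -/
def unit : SF := ⟨one, by
  refine ⟨fun u a b v => ?_, 0, fun w ⟨a, ha, _⟩ => ?_⟩
  · simp [one]
  · simp [one, List.ne_nil_of_mem ha]⟩

/-- The coordinate functions. -/
def x (a : Letter) : SF := ⟨var a, by
  refine ⟨fun u b c v => ?_, a.idx + 1, fun w ⟨b, hb, h⟩ => ?_⟩
  · have : ∀ b c : Letter, u ++ b :: c :: v ≠ [a] := by
      intro b c h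
      have := congrArg List.length h
      simp at this
      lia
    simp [var, this]
  · refine if_neg fun hw => ?_
    subst hw
    rw [List.mem_singleton.1 hb] at h
    lia⟩

/-- Homogeneous elements of parity `p`. -/
def IsHom (p : Bool) (y : SF) : Prop := HasParity p y.1

lemma d_d (a b : Letter) (y : SF) :
    d a (d b y) = (eps a.isRight b.isRight : Hb) • d b (d a y) :=
  Subtype.ext (y.2.1.dl_dl a b)

lemma d_mul (a : Letter) (y z : SF) :
    d a (mul y z) = mul (d a y) z + mul (twist a.isRight y) (d a z) :=
  Subtype.ext (dl_sh a y.1 z.1)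

lemma d_x (a b : Letter) : d a (x b) = if a = b then unit else 0 := by
  apply Subtype.ext
  refine (dl_var a b).trans ?_
  split_ifs <;> rfl

lemma d_unit (a : Letter) : d a unit = 0 := Subtype.ext (dl_one a)

lemma mul_unit (y : SF) : mul y unit = y := Subtype.ext (sh_one y.1)

lemma unit_mul (y : SF) : mul unit y = y := Subtype.ext (one_sh y.1)

lemma mul_assoc (y z t : SF) : mul (mul y z) t = mul y (mul z t) :=
  Subtype.ext (sh_assoc y.1 z.1 t.1)

lemma IsHom.mul_comm {p q : Bool} {y z : SF} (hy : IsHom p y) (hz : IsHom q z) :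
    mul y z = (eps p q : Hb) • mul z y := by
  apply Subtype.ext
  have h := sh_comm hy z.1
  rw [HasParity.tws hz p, sh_smul_left] at h
  exact h

lemma IsHom.twist {p : Bool} {y : SF} (hy : IsHom p y) (b : Bool) :
    twist b y = (eps b p : Hb) • y := Subtype.ext (HasParity.tws hy b)

lemma isHom_unit : IsHom false unit := hasParity_one

lemma isHom_x (a : Letter) : IsHom a.isRight (x a) := hasParity_var a

lemma IsHom.add {p : Bool} {y z : SF} (hy : IsHom p y) (hz : IsHom p z) : IsHom p (y + z) :=
  HasParity.add hy hz

lemma IsHom.smul {p : Bool} {y : SF} (hy : IsHom p y) (r : Hb) : IsHom p (r • y) :=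
  HasParity.smul hy r

lemma IsHom.zero (p : Bool) : IsHom p 0 := HasParity.zero p

lemma IsHom.sum {ι : Type*} {p : Bool} {y : ι → SF} (s : Finset ι) (h : ∀ i ∈ s, IsHom p (y i)) :
    IsHom p (∑ i ∈ s, y i) :=
  Finset.sum_induction _ _ (fun _ _ => IsHom.add) (IsHom.zero p) h

lemma IsHom.finsum {ι : Type*} {p : Bool} {y : ι → SF} (h : ∀ i, IsHom p (y i)) :
    IsHom p (∑ᶠ i, y i) := by
  by_cases hy : (Function.support y).Finite
  · rw [finsum_eq_sum y hy]
    exact IsHom.sum _ fun i _ => h i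
  · rw [finsum_of_infinite_support hy]
    exact IsHom.zero p

lemma IsHom.d {p : Bool} {y : SF} (hy : IsHom p y) (a : Letter) :
    IsHom (a.isRight ^^ p) (d a y) := HasParity.dl hy a

lemma IsHom.mul {p q : Bool} {y z : SF} (hy : IsHom p y) (hz : IsHom q z) :
    IsHom (p ^^ q) (mul y z) := HasParity.sh hy hz

/-- The letters of index less than `N`. -/
def box (N : ℕ) : Finset Letter := (Finset.range N).disjSum (Finset.range N)

lemma mem_box {N : ℕ} {a : Letter} : a ∈ box N ↔ a.idx < N := by
  cases a <;> simp [box, Letter.idx]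

/-- `y` involves only letters of index less than `N`. -/
def LT (N : ℕ) (y : SF) : Prop := LettersLT N y.1

lemma exists_LT (y : SF) : ∃ N, LT N y := y.2.2

lemma LT.mono {N M : ℕ} {y : SF} (hy : LT N y) (h : N ≤ M) : LT M y := LettersLT.mono h hy

lemma LT.d {N : ℕ} {y : SF} (hy : LT N y) (a : Letter) : LT N (d a y) := LettersLT.dl hy a

lemma LT.d_eq_zero {N : ℕ} {y : SF} (hy : LT N y) {a : Letter} (ha : a ∉ box N) :
    SF.d a y = 0 := Subtype.ext (LettersLT.dl_eq_zero hy (not_lt.1 fun h => ha (mem_box.2 h)))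

lemma LT.mul {N : ℕ} {y z : SF} (hy : LT N y) (hz : LT N z) : LT N (mul y z) :=
  LettersLT.sh hy hz

lemma LT.twist {N : ℕ} {y : SF} (hy : LT N y) (b : Bool) : LT N (twist b y) :=
  LettersLT.tws hy b

lemma LT.add {N : ℕ} {y z : SF} (hy : LT N y) (hz : LT N z) : LT N (y + z) := LettersLT.add hy hz

lemma LT.smul {N : ℕ} {y : SF} (hy : LT N y) (r : Hb) : LT N (r • y) := LettersLT.smul hy r

lemma LT.sum {ι : Type*} {N : ℕ} {y : ι → SF} (s : Finset ι) (h : ∀ i ∈ s, LT N (y i)) :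
    LT N (∑ i ∈ s, y i) :=
  Finset.sum_induction _ _ (fun _ _ => LT.add) (fun _ _ => rfl) h

lemma finite_d (c : Letter → ℂ) (y : SF) :
    (Function.support fun i => (K (c i) • d i : SF →ₗ[Hb] SF) y).Finite := by
  obtain ⟨N, hN⟩ := exists_LT y
  refine (box N).finite_toSet.subset fun i hi => ?_
  by_contra h
  refine hi ?_
  beta_reduce
  rw [LinearMap.smul_apply, hN.d_eq_zero h, smul_zero]

end SF

/-! ### Derivatives in the direction of exponents -/

/-- The coefficient at a bosonic or fermionic exponent of the basis form of a letter. -/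
def cf (C : LocalSuperSpectralCurve) : ℤ ⊕ ℤ → Letter → ℂ
  | .inl a, .inl i => (dξNeg C (i + 1)).coeff a
  | .inr b, .inr k => (ηNeg C k).coeff b
  | _, _ => 0

open SF

/-- The derivative in the direction of the exponent `e`. -/
def Dx (C : LocalSuperSpectralCurve) (e : ℤ ⊕ ℤ) : SF →ₗ[Hb] SF :=
  lfSum (fun i => K (cf C e i) • d i) (finite_d _)

variable (C : LocalSuperSpectralCurve)

lemma Dx_eq {N : ℕ} {y : SF} (hy : LT N y) (e : ℤ ⊕ ℤ) :
    Dx C e y = ∑ i ∈ box N, K (cf C e i) • d i y := by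
  refine finsum_eq_sum_of_support_subset _ fun i hi => ?_
  by_contra h
  refine hi ?_
  beta_reduce
  rw [LinearMap.smul_apply, hy.d_eq_zero h, smul_zero]

lemma cf_eq_zero {e : ℤ ⊕ ℤ} {i : Letter} (h : e.isRight ≠ i.isRight) : cf C e i = 0 := by
  rcases e with e | e <;> rcases i with i | i <;> simp_all [cf]

lemma LT.Dx {N : ℕ} {y : SF} (hy : LT N y) (e : ℤ ⊕ ℤ) : LT N (Dx C e y) := by
  rw [Dx_eq C hy]
  exact LT.sum _ fun i _ => (hy.d i).smul _

lemma Dx_mul (e : ℤ ⊕ ℤ) (y z : SF) :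
    Dx C e (mul y z) = mul (Dx C e y) z + mul (twist e.isRight y) (Dx C e z) := by
  obtain ⟨N, hN⟩ := exists_LT y
  obtain ⟨M, hM⟩ := exists_LT z
  have hy := hN.mono (le_max_left N M)
  have hz := hM.mono (le_max_right N M)
  rw [Dx_eq C (hy.mul hz), Dx_eq C hy, Dx_eq C hz, map_sum, map_sum, LinearMap.sum_apply,
    ← Finset.sum_add_distrib]
  refine Finset.sum_congr rfl fun i _ => ?_
  by_cases h : e.isRight = i.isRight
  · rw [d_mul, smul_add, map_smul, map_smul, LinearMap.smul_apply, h]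
  · simp [cf_eq_zero C h]

lemma Dx_Dx (e f : ℤ ⊕ ℤ) (y : SF) :
    Dx C e (Dx C f y) = (eps e.isRight f.isRight : Hb) • Dx C f (Dx C e y) := by
  obtain ⟨N, hN⟩ := exists_LT y
  have key : ∀ e f : ℤ ⊕ ℤ, Dx C e (Dx C f y) = ∑ i ∈ box N, ∑ j ∈ box N,
      (K (cf C e i) * K (cf C f j)) • d i (d j y) := by
    intro e f
    rw [Dx_eq C (LT.Dx C hN f), Dx_eq C hN f]
    simp only [map_sum, map_smul, Finset.smul_sum, smul_smul]
  rw [key, key, Finset.sum_comm, Finset.smul_sum]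
  refine Finset.sum_congr rfl fun i _ => ?_
  rw [Finset.smul_sum]
  refine Finset.sum_congr rfl fun j _ => ?_
  by_cases h1 : e.isRight = j.isRight
  · by_cases h2 : f.isRight = i.isRight
    · rw [d_d, h1, h2, smul_smul, smul_smul]
      congr 1
      ring
    · simp [cf_eq_zero C h2]
  · simp [cf_eq_zero C h1]

lemma IsHom.Dx {p : Bool} {y : SF} (hy : IsHom p y) (e : ℤ ⊕ ℤ) :
    IsHom (e.isRight ^^ p) (Dx C e y) := by
  refine IsHom.finsum fun i => ?_
  by_cases h : e.isRight = i.isRight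
  · rw [h]
    exact (hy.d i).smul _
  · beta_reduce
    rw [cf_eq_zero C h, map_zero, zero_smul]
    exact IsHom.zero _

lemma Dx_unit (e : ℤ ⊕ ℤ) : Dx C e unit = 0 := by
  have : ∀ i, (K (cf C e i) • d i : SF →ₗ[Hb] SF) unit = 0 := fun i => by
    rw [LinearMap.smul_apply, d_unit, smul_zero]
  change ∑ᶠ i, _ = _
  rw [finsum_congr this, finsum_zero]

lemma Dx_x (e : ℤ ⊕ ℤ) (a : Letter) : Dx C e (x a) = K (cf C e a) • unit := by
  change ∑ᶠ i, _ = _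
  rw [finsum_eq_single _ a fun i hi => by rw [LinearMap.smul_apply, d_x, if_neg hi, smul_zero],
    LinearMap.smul_apply, d_x, if_pos rfl]

lemma d_Dx (a : Letter) (e : ℤ ⊕ ℤ) (y : SF) :
    d a (Dx C e y) = (eps a.isRight e.isRight : Hb) • Dx C e (d a y) := by
  obtain ⟨N, hN⟩ := exists_LT y
  rw [Dx_eq C hN, Dx_eq C (hN.d a), map_sum, Finset.smul_sum]
  refine Finset.sum_congr rfl fun i _ => ?_
  by_cases h : e.isRight = i.isRight
  · rw [map_smul, d_d, h, smul_comm]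
  · simp [cf_eq_zero C h]

/-! ### The fields -/

/-- The part of the fields given by the unstable correlators. -/
def source : ℤ ⊕ ℤ → SF
  | .inl a => (if 0 ≤ a then K ((a : ℂ) + 1) • x (.inl a.toNat) else 0) +
      K ((w010 C).coeff a) • unit
  | .inr b => (if 0 ≤ b then x (.inr (b + 1).toNat) else 0) +
      K (1 / 2 * (ηNeg C 0).coeff b) • x (.inr 0)

/-- The coefficients of the bosonic and fermionic fields. -/
def field (S : SF) (e : ℤ ⊕ ℤ) : SF := Dx C e S + source C e

/-- The field operators. -/
def Op (S : SF) (e : ℤ ⊕ ℤ) : SF →ₗ[Hb] SF := h • Dx C e + mul (field C S e)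

lemma Op_apply (S : SF) (e : ℤ ⊕ ℤ) (y : SF) :
    Op C S e y = h • Dx C e y + mul (field C S e) y := rfl

lemma isHom_source (e : ℤ ⊕ ℤ) : IsHom e.isRight (source C e) := by
  rcases e with a | b
  · refine IsHom.add ?_ (isHom_unit.smul _)
    split_ifs
    · exact (isHom_x (.inl a.toNat)).smul _
    · exact IsHom.zero _
  · refine IsHom.add ?_ ((isHom_x (.inr 0)).smul _)
    split_ifs
    · exact isHom_x (.inr _)
    · exact IsHom.zero _

lemma isHom_field {S : SF} (hS : IsHom false S) (e : ℤ ⊕ ℤ) : IsHom e.isRight (field C S e) := by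
  refine IsHom.add ?_ (isHom_source C e)
  simpa using IsHom.Dx C hS e

/-- The two-point functions, as contractions. -/
def contr : ℤ ⊕ ℤ → ℤ ⊕ ℤ → ℂ
  | .inl a, .inl c => w020 C c a
  | .inr a, .inr b => w002 C b a
  | _, _ => 0

/-- The source is affine in the coordinates, with coefficients taken from `w020_eq` and `w002_eq`.
-/
lemma Dx_source (e f : ℤ ⊕ ℤ) : Dx C e (source C f) = K (contr C e f) • unit := by
  rcases f with c | b
  · have h1 : Dx C e (source C (.inl c)) = K (if 0 ≤ c then ((c : ℂ) + 1) *
        cf C e (.inl c.toNat) else 0) • unit := by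
      rw [source, map_add, map_smul _ _ unit, Dx_unit, smul_zero, add_zero]
      split_ifs
      · rw [map_smul, Dx_x, smul_smul, map_mul]
      · rw [map_zero, map_zero, zero_smul]
    rw [h1]
    rcases e with a | a
    · simp only [contr, w020_eq, cf]
    · simp [contr, cf]
  · have h1 : Dx C e (source C (.inr b)) = K ((if 0 ≤ b then
        cf C e (.inr (b + 1).toNat) else 0) + 1 / 2 * (ηNeg C 0).coeff b * cf C e (.inr 0)) •
        unit := by
      unfold source
      rw [map_add, map_smul, Dx_x, smul_smul, ← map_mul, map_add, add_smul]
      split_ifs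
      · rw [Dx_x]
      · rw [map_zero, map_zero, zero_smul]
    rw [h1]
    rcases e with a | a
    · simp [contr, cf]
    · simp only [contr, w002_eq, cf]

/-- Second derivatives of `S` and products of fields are supersymmetric in `e` and `f`, so the
supercommutator sees only the contractions of the sources. -/
lemma Op_Op {S : SF} (hS : IsHom false S) (e f : ℤ ⊕ ℤ) (y : SF) :
    Op C S e (Op C S f y) = (eps e.isRight f.isRight : Hb) • Op C S f (Op C S e y) +
      (h * (K (contr C e f) -
        eps e.isRight f.isRight * K (contr C f e))) • y := by
  have key : ∀ e f : ℤ ⊕ ℤ, Op C S e (Op C S f y) =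
      (h * h) • Dx C e (Dx C f y) + h • mul (Dx C e (Dx C f S)) y +
      (h * K (contr C e f)) • y +
      ((h * eps e.isRight f.isRight : Hb) • mul (field C S f) (Dx C e y) +
        h • mul (field C S e) (Dx C f y)) + mul (field C S e) (mul (field C S f) y) := by
    intro e f
    have h1 : Dx C e (field C S f) = Dx C e (Dx C f S) + K (contr C e f) • unit := by
      rw [field, map_add, Dx_source]
    simp only [Op_apply, map_add, map_smul, Dx_mul, h1, (isHom_field C hS f).twist,
      LinearMap.add_apply, LinearMap.smul_apply, unit_mul, smul_add, smul_smul]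
    abel
  have h2 : mul (field C S e) (mul (field C S f) y) =
      (eps e.isRight f.isRight : Hb) • mul (field C S f) (mul (field C S e) y) := by
    rw [← SF.mul_assoc, (isHom_field C hS e).mul_comm (isHom_field C hS f), map_smul,
      LinearMap.smul_apply, SF.mul_assoc]
  rw [key e f, key f e, h2, Dx_Dx C e f y, Dx_Dx C e f S, eps_comm f.isRight]
  simp only [smul_add, smul_smul, map_smul, LinearMap.smul_apply, sub_smul, mul_sub]
  have h3 : (eps e.isRight f.isRight : Hb) * eps e.isRight f.isRight = 1 := eps_mul_self _ _
  have h4 : (eps e.isRight f.isRight : Hb) * (h * eps e.isRight f.isRight) = h := by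
    linear_combination h * h3
  rw [h4, mul_comm (eps e.isRight f.isRight : Hb) (h * h),
    mul_comm (eps e.isRight f.isRight : Hb) h,
    mul_left_comm (eps e.isRight f.isRight : Hb) h (K _)]
  abel

/-- Finitely many letters mean finitely many basis forms, hence a bounded pole order. The bound is
not sharp. -/
lemma field_eq_zero_of_LT {N : ℕ} {S : SF} (hS : LT N S) {e : ℤ ⊕ ℤ}
    (he : e.elim id id < -(N : ℤ) - 2) : field C S e = 0 := by
  rw [field, Dx_eq C hS, Finset.sum_eq_zero, zero_add]
  · rcases e with a | a
    all_goals
      simp at he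
      simp only [source]
      rw [if_neg (by lia)]
    · rw [w010_coeff, if_neg (by lia), map_zero, zero_smul, add_zero]
    · rw [ηNeg_coeff, if_neg (by lia), if_neg (by lia)]
      simp
  · intro i hi
    rw [mem_box] at hi
    have : cf C e i = 0 := by
      rcases e with a | a <;> rcases i with i | i <;> simp [Letter.idx] at hi he <;>
        simp only [cf]
      · rw [dξNeg_coeff, if_neg (by lia), if_neg (by lia), add_zero]
      · rw [ηNeg_coeff, if_neg (by lia), if_neg (by lia), add_zero]
    rw [this, map_zero, zero_smul]

lemma Dx_eq_zero_of_LT {N : ℕ} {y : SF} (hy : LT N y) {e : ℤ ⊕ ℤ}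
    (he : e.elim id id < -(N : ℤ) - 2) : Dx C e y = 0 := by
  rw [Dx_eq C hy]
  refine Finset.sum_eq_zero fun i hi => ?_
  rw [mem_box] at hi
  have : cf C e i = 0 := by
    rcases e with a | a <;> rcases i with i | i <;> simp [Letter.idx] at hi he <;>
      simp only [cf]
    · rw [dξNeg_coeff, if_neg (by lia), if_neg (by lia), add_zero]
    · rw [ηNeg_coeff, if_neg (by lia), if_neg (by lia), add_zero]
  rw [this, map_zero, zero_smul]

lemma Op_eq_zero_of_LT {N : ℕ} {S y : SF} (hS : LT N S) (hy : LT N y) {e : ℤ ⊕ ℤ}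
    (he : e.elim id id < -(N : ℤ) - 2) : Op C S e y = 0 := by
  rw [Op_apply, Dx_eq_zero_of_LT C hy he, field_eq_zero_of_LT C hS he]
  simp

/-- The part of the fields that is odd under the involution consists of free fields. -/
lemma oscillators {S : SF} (hS : IsHom false S) :
    Oscillators h (fun i => Op C S (.inl (2 * i))) (fun i => Op C S (.inr (2 * i - 1))) where
  ββ i j y := by
    rw [Op_Op C hS]
    simp only [eps, contr, Sum.isRight_inl, Bool.and_false, Bool.false_eq_true, if_false, one_smul,
      one_mul, ← map_sub, w020_sub]
    congr 1
    by_cases h : i + j = -1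
    · rw [if_pos (by lia), if_pos h]
      congr 2
      simp [map_ofNat K 2]
    · rw [if_neg (by lia), if_neg h]
      simp
  γγ i j y := by
    rw [Op_Op C hS]
    simp only [eps, contr, Sum.isRight_inr, Bool.and_self, if_true, neg_mul, one_mul, sub_neg_eq_add, ← map_add, w002_add]
    congr 1
    · exact neg_one_smul Hb (_ : SF)
    by_cases h : i + j = 0
    · rw [if_pos (by lia), if_pos h]
      simp
    · rw [if_neg (by lia), if_neg h]
      simp
  βγ i j y := by
    rw [Op_Op C hS]
    simp [eps, contr]
  lfβ y := by
    obtain ⟨N, hN⟩ := exists_LT S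
    obtain ⟨M, hM⟩ := exists_LT y
    refine ⟨-(max N M : ℕ) - 2, fun i hi => Op_eq_zero_of_LT C (hN.mono (le_max_left N M))
      (hM.mono (le_max_right N M)) ?_⟩
    simp only [Sum.elim_inl, id]
    lia
  lfγ y := by
    obtain ⟨N, hN⟩ := exists_LT S
    obtain ⟨M, hM⟩ := exists_LT y
    refine ⟨-(max N M : ℕ) - 2, fun i hi => Op_eq_zero_of_LT C (hN.mono (le_max_left N M))
      (hM.mono (le_max_right N M)) ?_⟩
    simp only [Sum.elim_inr, id]
    lia

end

end SuperTR

namespace SuperTR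

noncomputable section

open Hb (h K)
open SF

/-! ### The degree filtration -/

/-- Functions of words all of whose terms `ħ ^ g w` have degree `2 g + |w|` at least `e`. -/
def DegGE (e : ℕ) (f : List Letter → Hb) : Prop :=
  ∀ w g, 2 * g + w.length < e → Hb.coeff g (f w) = 0

lemma DegGE.dl {e : ℕ} {f : List Letter → Hb} (hf : DegGE e f) (a : Letter) :
    DegGE (e - 1) (dl a f) := fun w g hg => hf (a :: w) g (by rw [List.length_cons]; lia)

lemma DegGE.smul {e : ℕ} {f : List Letter → Hb} (hf : DegGE e f) (r : Hb) : DegGE e (r • f) := by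
  intro w g hg
  rw [Pi.smul_apply, smul_eq_mul, Hb.coeff_mul]
  refine Finset.sum_eq_zero fun i hi => ?_
  rw [Finset.HasAntidiagonal.mem_antidiagonal] at hi
  rw [hf w i.2 (by lia), mul_zero]

lemma DegGE.tws {e : ℕ} {f : List Letter → Hb} (hf : DegGE e f) (b : Bool) :
    DegGE e (tws b f) := by
  cases b
  · simpa [SuperTR.tws] using hf
  · intro w g hg
    have := hf.smul ((-1) ^ w.countP Sum.isRight) w g hg
    simpa [SuperTR.tws, tw] using this

lemma DegGE.sh {a b : ℕ} {f g : List Letter → Hb} (hf : DegGE a f) (hg : DegGE b g) :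
    DegGE (a + b) (sh f g) := by
  intro w
  induction w generalizing a b f g with
  | nil =>
    intro k hk
    change Hb.coeff k (f [] * g []) = 0
    rw [Hb.coeff_mul]
    refine Finset.sum_eq_zero fun i hi => ?_
    rw [Finset.HasAntidiagonal.mem_antidiagonal] at hi
    rw [List.length_nil] at hk
    by_cases h1 : 2 * i.1 < a
    · rw [hf [] i.1 (by rw [List.length_nil]; lia), zero_mul]
    · rw [hg [] i.2 (by rw [List.length_nil]; lia), mul_zero]
  | cons c w ih =>
    intro k hk
    rw [List.length_cons] at hk
    change Hb.coeff k (SuperTR.sh (SuperTR.dl c f) g w +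
      SuperTR.sh (SuperTR.tws c.isRight f) (SuperTR.dl c g) w) = 0
    rw [map_add, ih (hf.dl c) hg k (by lia), ih (hf.tws _) (hg.dl c) k (by lia), add_zero]

/-- The degree filtration. -/
def Fil (e : ℕ) : Submodule Hb SF where
  carrier := {y | DegGE e y.1}
  zero_mem' := fun w g _ => map_zero _
  add_mem' := fun {y z} hy hz w g hg => by
    rw [add_val, Pi.add_apply, map_add, hy w g hg, hz w g hg, add_zero]
  smul_mem' := fun r _ hy => DegGE.smul hy r

lemma Fil_mono {e f : ℕ} (hef : e ≤ f) {y : SF} (hy : y ∈ Fil f) : y ∈ Fil e :=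
  fun w g hg => hy w g (hg.trans_le hef)

lemma mem_Fil_zero (y : SF) : y ∈ Fil 0 := fun _ _ hg => absurd hg (Nat.not_lt_zero _)

/-- ħ has degree two; the converse direction permits dividing relations of the algebra by ħ. -/
lemma h_smul_mem_Fil {e : ℕ} {y : SF} : h • y ∈ Fil (e + 2) ↔ y ∈ Fil e := by
  constructor
  · intro hy w g hg
    rw [← Hb.coeff_h_mul_succ]
    exact hy w (g + 1) (by lia)
  · intro hy w g hg
    rw [smul_val, Pi.smul_apply, smul_eq_mul]
    cases g with
    | zero => exact Hb.coeff_h_mul_zero _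
    | succ g =>
      rw [Hb.coeff_h_mul_succ]
      exact hy w g (by lia)

lemma d_mem_Fil {e : ℕ} {y : SF} (hy : y ∈ Fil e) (a : Letter) : d a y ∈ Fil (e - 1) :=
  DegGE.dl hy a

lemma mul_mem_Fil {a b : ℕ} {y z : SF} (hy : y ∈ Fil a) (hz : z ∈ Fil b) :
    mul y z ∈ Fil (a + b) := DegGE.sh hy hz

lemma x_mem_Fil (a : Letter) : x a ∈ Fil 1 := by
  intro w g hg
  have : w = [] := List.length_eq_zero_iff.1 (by lia)
  subst this
  change Hb.coeff g (var a []) = 0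
  rw [var, if_neg (by simp), map_zero]

lemma finsum_mem_submodule {ι : Type*} (p : Submodule Hb SF) {f : ι → SF} (hf : ∀ i, f i ∈ p) :
    ∑ᶠ i, f i ∈ p := by
  by_cases hs : (Function.support f).Finite
  · rw [finsum_eq_sum f hs]
    exact p.sum_mem fun i _ => hf i
  · rw [finsum_of_infinite_support hs]
    exact p.zero_mem

lemma finsum_sub_mem {ι : Type*} (p : Submodule Hb SF) {f g : ι → SF}
    (hf : (Function.support f).Finite) (hg : (Function.support g).Finite)
    (hfg : ∀ i, f i - g i ∈ p) : ∑ᶠ i, f i - ∑ᶠ i, g i ∈ p := by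
  rw [← finsum_sub_distrib hf hg]
  exact finsum_mem_submodule p hfg

variable (C : LocalSuperSpectralCurve)

lemma Dx_mem_Fil {e : ℕ} {y : SF} (hy : y ∈ Fil e) (f : ℤ ⊕ ℤ) : Dx C f y ∈ Fil (e - 1) :=
  finsum_mem_submodule _ fun i => (Fil _).smul_mem _ (d_mem_Fil hy i)

/-- A derivative lowers the degree by one and ħ raises it by two. -/
lemma h_Dx_mem_Fil {e : ℕ} {y : SF} (hy : y ∈ Fil e) (f : ℤ ⊕ ℤ) : h • Dx C f y ∈ Fil (e + 1) := by
  refine Fil_mono ?_ (h_smul_mem_Fil.2 (Dx_mem_Fil C hy f))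
  lia

/-- The constant term of a field. -/
def bg : ℤ ⊕ ℤ → ℂ
  | .inl a => (w010 C).coeff a
  | .inr _ => 0

lemma field_sub_mem {S : SF} (hS : S ∈ Fil 3) (e : ℤ ⊕ ℤ) :
    field C S e - K (bg C e) • unit ∈ Fil 1 := by
  have h1 : Dx C e S ∈ Fil 1 := Fil_mono (by lia) (Dx_mem_Fil C hS e)
  have h2 : source C e - K (bg C e) • unit ∈ Fil 1 := by
    rcases e with a | b
    · simp only [source, bg, add_sub_cancel_right]
      split_ifs
      · exact (Fil 1).smul_mem _ (x_mem_Fil _)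
      · exact (Fil 1).zero_mem
    · simp only [source, bg, map_zero, zero_smul, sub_zero]
      refine (Fil 1).add_mem ?_ ((Fil 1).smul_mem _ (x_mem_Fil _))
      split_ifs
      · exact x_mem_Fil _
      · exact (Fil 1).zero_mem
  rw [field, add_sub_assoc]
  exact (Fil 1).add_mem h1 h2

lemma mul_field_sub_mem {S : SF} (hS : S ∈ Fil 3) (e : ℤ ⊕ ℤ) {k : ℕ} {y : SF} (hy : y ∈ Fil k) :
    mul (field C S e) y - K (bg C e) • y ∈ Fil (k + 1) := by
  have := mul_mem_Fil (field_sub_mem C hS e) hy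
  rw [map_sub, map_smul, LinearMap.sub_apply, LinearMap.smul_apply, unit_mul, add_comm] at this
  exact this

lemma mul_field_sub_mem' {S : SF} (hS : S ∈ Fil 3) (e : ℤ ⊕ ℤ) {k : ℕ} {y : SF} (hy : y ∈ Fil k) :
    mul y (field C S e) - K (bg C e) • y ∈ Fil (k + 1) := by
  have := mul_mem_Fil hy (field_sub_mem C hS e)
  rw [map_sub, map_smul, mul_unit] at this
  exact this

lemma Op_sub_mem {S : SF} (hS : S ∈ Fil 3) (e : ℤ ⊕ ℤ) {k : ℕ} {y : SF} (hy : y ∈ Fil k) :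
    Op C S e y - K (bg C e) • y ∈ Fil (k + 1) := by
  rw [Op_apply, add_sub_assoc]
  exact (Fil _).add_mem (h_Dx_mem_Fil C hy e) (mul_field_sub_mem C hS e hy)

lemma Op_inr_mem {S : SF} (hS : S ∈ Fil 3) (b : ℤ) {k : ℕ} {y : SF} (hy : y ∈ Fil k) :
    Op C S (.inr b) y ∈ Fil (k + 1) := by
  have := Op_sub_mem C hS (.inr b) hy
  simpa [bg] using this

lemma source_inl_neg {a : ℤ} (ha : a < 0) : source C (.inl a) = 0 := by
  rw [source, if_neg (by lia), w010_coeff, if_neg (by lia), map_zero, zero_smul, add_zero]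

lemma source_inr_neg {b : ℤ} (hb : b < -1) : source C (.inr b) = 0 := by
  rw [source, if_neg (by lia), ηNeg_coeff, if_neg (by lia), if_neg (by lia)]
  simp

lemma Op_sub_h_Dx_mem {S : SF} (hS : S ∈ Fil 3) {e : ℤ ⊕ ℤ} (he : source C e = 0) {k : ℕ} {y : SF}
    (hy : y ∈ Fil k) : Op C S e y - h • Dx C e y ∈ Fil (k + 2) := by
  rw [Op_apply, add_sub_cancel_left, field, he, add_zero, add_comm]
  exact mul_mem_Fil (Dx_mem_Fil C hS e) hy

/-- `1` for a regular and `0` for an irregular curve. -/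
def kind : ℕ := if C.τ 1 = 0 then 1 else 0

lemma kind_le_one : kind C ≤ 1 := by
  unfold kind; split_ifs <;> simp

/-- The coefficients of the odd part of `ω_{0,1|0}`. -/
def wt (i : ℤ) : ℂ := (w010 C).coeff (2 * i)

lemma wt_eq_zero {i : ℤ} (hi : i < kind C) : wt C i = 0 := by
  unfold wt kind at *
  rw [w010_coeff]
  split_ifs at hi with h1
  · split_ifs with h2
    · have : i = 0 := by push_cast at hi; lia
      subst this
      simpa using h1
    · rfl
  · rw [if_neg (by push_cast at hi; lia)]

/-- This coefficient is τ₁ for an irregular and τ₃ for a regular curve; here admissibility of the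
curve enters. -/
lemma wt_kind_ne_zero : wt C (kind C) ≠ 0 := by
  unfold wt kind
  rw [w010_coeff]
  rcases C.admissible with h1 | h3
  · simp [h1]
  · by_cases h1 : C.τ 1 = 0
    · simpa [h1] using h3
    · simp [h1]

/-- The leading part of the modes of the supercurrent. -/
def DF (n : ℤ) (y : SF) : SF := ∑ᶠ i : ℤ, K (wt C i) • Dx C (.inr (2 * (n - i) - 1)) y

/-- The leading part of the modes of the stress tensor. -/
def DB (n : ℤ) (y : SF) : SF := ∑ᶠ i : ℤ, K (wt C i) • Dx C (.inl (2 * (n - i))) y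

lemma finite_DF (n : ℤ) (y : SF) :
    (Function.support fun i : ℤ => K (wt C i) • Dx C (.inr (2 * (n - i) - 1)) y).Finite := by
  obtain ⟨N, hN⟩ := exists_LT y
  refine finite_int_support 0 (n + N + 2) (fun i hi => ?_) (fun i hi => ?_)
  · rw [wt_eq_zero C (by lia), map_zero, zero_smul]
  · rw [Dx_eq_zero_of_LT C hN (by simp only [Sum.elim_inr, id]; lia), smul_zero]

lemma finite_DB (n : ℤ) (y : SF) :
    (Function.support fun i : ℤ => K (wt C i) • Dx C (.inl (2 * (n - i))) y).Finite := by
  obtain ⟨N, hN⟩ := exists_LT y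
  refine finite_int_support 0 (n + N + 2) (fun i hi => ?_) (fun i hi => ?_)
  · rw [wt_eq_zero C (by lia), map_zero, zero_smul]
  · rw [Dx_eq_zero_of_LT C hN (by simp only [Sum.elim_inl, id]; lia), smul_zero]

lemma finite_DB' (n : ℤ) (y : SF) :
    (Function.support fun i : ℤ => K (wt C (n - i)) • Dx C (.inl (2 * i)) y).Finite := by
  refine ((finite_DB C n y).preimage (f := fun i => n - i) (by intro x _ y _; simp)).subset ?_
  intro i hi
  simpa using hi

lemma DB_eq (n : ℤ) (y : SF) : DB C n y = ∑ᶠ i : ℤ, K (wt C (n - i)) • Dx C (.inl (2 * i)) y := by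
  rw [DB, ← finsum_comp_equiv (Equiv.subLeft n)]
  refine finsum_congr fun i => ?_
  rw [Equiv.subLeft_apply, sub_sub_cancel]

/-- A boson contributes in degree zero only through ω_{0,1|0}, hence only for i ≥ `kind C` > n. The
accompanying fermion then has exponent below -1, where the source vanishes, and reduces to ħ times a
derivative. -/
lemma G_lead {S : SF} (hp : IsHom false S) (hS : S ∈ Fil 3) {n : ℤ} (hn : n < kind C) {k : ℕ}
    {y : SF} (hy : y ∈ Fil k) :
    (oscillators C hp).G n y - h • DF C n y ∈ Fil (k + 2) := by
  rw [Oscillators.G_apply, DF, smul_finsum' _ (finite_DF C n y)]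
  refine finsum_sub_mem _ ((oscillators C hp).finite_βγ n y)
    (finite_support_smul (fun _ => h) (finite_DF C n y)) fun i => ?_
  have h1 := Op_sub_mem C hS (.inl (2 * i)) (Op_inr_mem C hS (2 * (n - i) - 1) hy)
  have h2 : K (wt C i) • (Op C S (.inr (2 * (n - i) - 1)) y -
      h • Dx C (.inr (2 * (n - i) - 1)) y) ∈ Fil (k + 2) := by
    by_cases hi : i < kind C
    · rw [wt_eq_zero C hi, map_zero, zero_smul]
      exact (Fil _).zero_mem
    · exact (Fil _).smul_mem _ (Op_sub_h_Dx_mem C hS (source_inr_neg C (by lia)) hy)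
  have := (Fil (k + 2)).add_mem h1 h2
  rw [smul_sub, bg] at this
  rw [smul_comm h]
  change _ - K (wt C i) • _ + _ ∈ _ at this
  rwa [sub_add_sub_cancel] at this

/-- Since a + b < `kind C`, the two constants from ω_{0,1|0} cannot both be nonzero, and a field
whose partner has a nonzero constant has no source. -/
lemma Op_Op_lead {S : SF} (hS : S ∈ Fil 3) {a b n : ℤ} (hab : a + b = n) (hn : n < kind C) {k : ℕ}
    {y : SF} (hy : y ∈ Fil k) :
    Op C S (.inl (2 * a)) (Op C S (.inl (2 * b)) y) -
      (h • K (wt C a) • Dx C (.inl (2 * b)) y + h • K (wt C b) • Dx C (.inl (2 * a)) y) ∈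
      Fil (k + 2) := by
  have h1 := Op_sub_mem C hS (.inl (2 * a)) (Op_sub_mem C hS (.inl (2 * b)) hy)
  have h2 : ∀ a b : ℤ, a + b = n → K (wt C b) • (Op C S (.inl (2 * a)) y -
      h • Dx C (.inl (2 * a)) y) ∈ Fil (k + 2) := by
    intro a b hab
    by_cases hb : b < kind C
    · rw [wt_eq_zero C hb, map_zero, zero_smul]
      exact (Fil _).zero_mem
    · exact (Fil _).smul_mem _ (Op_sub_h_Dx_mem C hS (source_inl_neg C (by lia)) hy)
  have h3 : K (wt C a) * K (wt C b) = 0 := by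
    by_cases hb : b < kind C
    · rw [wt_eq_zero C hb, map_zero, mul_zero]
    · rw [wt_eq_zero C (i := a) (by lia), map_zero, zero_mul]
  have := (Fil (k + 2)).add_mem h1 ((Fil (k + 2)).add_mem (h2 a b hab) (h2 b a (by lia)))
  simp only [bg, map_sub, map_smul, smul_sub] at this
  change _ - K (wt C b) • _ - (K (wt C a) • _ - K (wt C a) • K (wt C b) • _) + _ ∈ _ at this
  rw [smul_smul (K (wt C a)), h3, zero_smul] at this
  convert this using 1
  rw [smul_comm h (K (wt C a)), smul_comm h (K (wt C b))]
  abel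

/-- Either boson may supply the constant of ω_{0,1|0}, whence the leading part occurs twice. Each of
two fermions raises the degree, so their bilinear does not contribute. -/
lemma T_lead {S : SF} (hp : IsHom false S) (hS : S ∈ Fil 3) {n : ℤ} (hn : n < kind C) {k : ℕ}
    {y : SF} (hy : y ∈ Fil k) :
    (oscillators C hp).T n y - (h • DB C n y + h • DB C n y) ∈ Fil (k + 2) := by
  have e1 : ∑ᶠ i, Oscillators.nβ (fun i => Op C S (.inl (2 * i))) i (n - i) y -
      (h • DB C n y + h • DB C n y) ∈ Fil (k + 2) := by
    nth_rewrite 2 [DB_eq]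
    rw [DB, smul_finsum' _ (finite_DB C n y), smul_finsum' _ (finite_DB' C n y),
      ← finsum_add_distrib (finite_support_smul (fun _ => h) (finite_DB C n y))
      (finite_support_smul (fun _ => h) (finite_DB' C n y))]
    refine finsum_sub_mem _ ((oscillators C hp).finite_nβ n y)
      (finite_support_add (finite_support_smul (fun _ => h) (finite_DB C n y))
        (finite_support_smul (fun _ => h) (finite_DB' C n y))) fun i => ?_
    unfold Oscillators.nβ
    split_ifs
    · rw [LinearMap.comp_apply]
      exact Op_Op_lead C hS (a := i) (b := n - i) (by ring) hn hy
    · have := Op_Op_lead C hS (a := n - i) (b := i) (by ring) hn hy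
      rw [add_comm (h • K (wt C (n - i)) • _)] at this
      rw [LinearMap.comp_apply]
      exact this
  have e2 : ∑ᶠ i : ℤ, ((2 * i - 1 : ℤ) : Hb) • Oscillators.nγ
      (fun i => Op C S (.inr (2 * i - 1))) i (n + 1 - i) y ∈ Fil (k + 2) := by
    refine finsum_mem_submodule _ fun i => (Fil _).smul_mem _ ?_
    unfold Oscillators.nγ
    split_ifs
    · rw [LinearMap.comp_apply]
      exact Op_inr_mem C hS _ (Op_inr_mem C hS _ hy)
    · rw [LinearMap.neg_apply, LinearMap.comp_apply]
      exact (Fil _).neg_mem (Op_inr_mem C hS _ (Op_inr_mem C hS _ hy))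
  have e3 : (if n = -1 then h • y else 0) ∈ Fil (k + 2) := by
    split_ifs
    · exact h_smul_mem_Fil.2 hy
    · exact (Fil _).zero_mem
  have := (Fil _).add_mem ((Fil _).add_mem e1 e2) e3
  rw [Oscillators.T_apply]
  convert this using 1
  abel

/-! ### Changing the free energy -/

lemma Op_add (S δ : SF) (e : ℤ ⊕ ℤ) (y : SF) :
    Op C (S + δ) e y = Op C S e y + mul (Dx C e δ) y := by
  simp only [Op_apply, field, map_add, LinearMap.add_apply]
  abel

lemma Op_unit (S : SF) (e : ℤ ⊕ ℤ) : Op C S e unit = field C S e := by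
  rw [Op_apply, Dx_unit, smul_zero, zero_add, mul_unit]

/-- First variation in the free energy: in degree k the change `δ` is felt only through one
derivative times the background of the other field; the term quadratic in `δ` has degree at least 2k
≥ k + 1. -/
lemma Op_Op_add {S δ : SF} (hS : S ∈ Fil 3) {k : ℕ} (hk : 1 ≤ k) (hδ : δ ∈ Fil (k + 1))
    (e f : ℤ ⊕ ℤ) :
    Op C (S + δ) e (Op C (S + δ) f unit) - Op C S e (Op C S f unit) -
      (K (bg C e) • Dx C f δ + K (bg C f) • Dx C e δ) ∈ Fil (k + 1) := by
  have he : Dx C e δ ∈ Fil k := Dx_mem_Fil C hδ e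
  have hf : Dx C f δ ∈ Fil k := Dx_mem_Fil C hδ f
  have h1 := Op_sub_mem C hS e hf
  have h2 := mul_field_sub_mem' C hS f he
  have h3 : mul (Dx C e δ) (Dx C f δ) ∈ Fil (k + 1) :=
    Fil_mono (by lia) (mul_mem_Fil he hf)
  have := (Fil _).add_mem ((Fil _).add_mem h1 h2) h3
  rw [Op_add C S δ f, Op_add C S δ e, Op_unit, mul_unit]
  simp only [map_add]
  convert this using 1
  abel

lemma G_add {S δ : SF} (hp : IsHom false S) (hp' : IsHom false (S + δ)) (hS : S ∈ Fil 3) {k : ℕ}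
    (hk : 1 ≤ k) (hδ : δ ∈ Fil (k + 1)) (n : ℤ) :
    (oscillators C hp').G n unit - ((oscillators C hp).G n unit + DF C n δ) ∈ Fil (k + 1) := by
  rw [Oscillators.G_apply, Oscillators.G_apply, DF,
    ← finsum_add_distrib ((oscillators C hp).finite_βγ n unit) (finite_DF C n δ)]
  refine finsum_sub_mem _ ((oscillators C hp').finite_βγ n unit)
    (finite_support_add ((oscillators C hp).finite_βγ n unit) (finite_DF C n δ)) fun i => ?_
  have := Op_Op_add C hS hk hδ (.inl (2 * i)) (.inr (2 * (n - i) - 1))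
  rw [sub_sub] at this
  simpa [bg, wt] using this

lemma T_add {S δ : SF} (hp : IsHom false S) (hp' : IsHom false (S + δ)) (hS : S ∈ Fil 3) {k : ℕ}
    (hk : 1 ≤ k) (hδ : δ ∈ Fil (k + 1)) (n : ℤ) :
    (oscillators C hp').T n unit - ((oscillators C hp).T n unit + (DB C n δ + DB C n δ)) ∈
      Fil (k + 1) := by
  have e1 : ∑ᶠ i, Oscillators.nβ (fun i => Op C (S + δ) (.inl (2 * i))) i (n - i) unit -
      (∑ᶠ i, Oscillators.nβ (fun i => Op C S (.inl (2 * i))) i (n - i) unit +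
        (DB C n δ + DB C n δ)) ∈ Fil (k + 1) := by
    have f1 := (oscillators C hp).finite_nβ n unit
    have f2 := finite_support_add (finite_DB C n δ) (finite_DB' C n δ)
    nth_rewrite 2 [DB_eq]
    rw [DB, ← finsum_add_distrib (finite_DB C n δ) (finite_DB' C n δ), ← finsum_add_distrib f1 f2]
    refine finsum_sub_mem _ ((oscillators C hp').finite_nβ n unit)
      (finite_support_add f1 f2) fun i => ?_
    unfold Oscillators.nβ
    split_ifs
    · have := Op_Op_add C hS hk hδ (.inl (2 * i)) (.inl (2 * (n - i)))
      rw [sub_sub] at this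
      simpa [bg, wt] using this
    · have := Op_Op_add C hS hk hδ (.inl (2 * (n - i))) (.inl (2 * i))
      rw [sub_sub, add_comm (K _ • _)] at this
      simpa [bg, wt] using this
  have e2 : ∑ᶠ i : ℤ, ((2 * i - 1 : ℤ) : Hb) • Oscillators.nγ
      (fun i => Op C (S + δ) (.inr (2 * i - 1))) i (n + 1 - i) unit -
      ∑ᶠ i : ℤ, ((2 * i - 1 : ℤ) : Hb) • Oscillators.nγ
      (fun i => Op C S (.inr (2 * i - 1))) i (n + 1 - i) unit ∈ Fil (k + 1) := by
    refine finsum_sub_mem _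
      (finite_support_smul _ ((oscillators C hp').finite_nγ (n + 1) unit))
      (finite_support_smul _ ((oscillators C hp).finite_nγ (n + 1) unit)) fun i => ?_
    rw [← smul_sub]
    refine (Fil _).smul_mem _ ?_
    unfold Oscillators.nγ
    split_ifs
    · have := Op_Op_add C hS hk hδ (.inr (2 * i - 1)) (.inr (2 * (n + 1 - i) - 1))
      simpa [bg] using this
    · have := (Fil _).neg_mem
        (Op_Op_add C hS hk hδ (.inr (2 * (n + 1 - i) - 1)) (.inr (2 * i - 1)))
      simp only [bg, map_zero, zero_smul, add_zero, sub_zero] at this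
      simp only [LinearMap.neg_apply, LinearMap.comp_apply]
      convert this using 1
      abel
  rw [Oscillators.T_apply, Oscillators.T_apply]
  convert (Fil _).add_mem e1 e2 using 1
  abel

end

end SuperTR

namespace SuperTR

noncomputable section

open Hb (h K)
open SF

variable (C : LocalSuperSpectralCurve)

/-! ### Inverting the leading part -/

lemma Dx_eq_of_cf {e : ℤ ⊕ ℤ} {a : Letter} (ha : ∀ i, cf C e i = if i = a then 1 else 0) (y : SF) :
    Dx C e y = d a y := by
  change ∑ᶠ i, _ = _
  rw [finsum_eq_single _ a fun i hi => by rw [LinearMap.smul_apply, ha, if_neg hi, map_zero,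
    zero_smul], LinearMap.smul_apply, ha, if_pos rfl, map_one, one_smul]

/-- In the principal part each basis form is a single monomial, so such an exponent selects a single
letter. -/
lemma Dx_inl_neg (l : ℕ) (y : SF) : Dx C (.inl (-(l : ℤ) - 2)) y = d (.inl l) y := by
  refine Dx_eq_of_cf C (fun i => ?_) y
  rcases i with i | i
  · rw [cf, dξNeg_coeff, if_neg (show ¬ (0 : ℤ) ≤ _ by lia), add_zero]
    exact if_congr (by rw [Sum.inl.injEq]; push_cast; lia) rfl rfl
  · simp [cf]

lemma Dx_inr_neg (l : ℕ) (y : SF) : Dx C (.inr (-(l : ℤ) - 2)) y = d (.inr (l + 1)) y := by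
  refine Dx_eq_of_cf C (fun i => ?_) y
  rcases i with i | i
  · simp [cf]
  · rw [cf, ηNeg_coeff, if_neg (show ¬ (-1 : ℤ) ≤ _ by lia), add_zero]
    exact if_congr (by rw [Sum.inr.injEq]; lia) rfl rfl

/-- The letters that occur in the leading parts. -/
def gl : ℕ ⊕ ℕ → Letter := Sum.map (fun p => 2 * p) (fun q => 2 * q + 2)

lemma gl_injective : Function.Injective gl :=
  Sum.map_injective.2 ⟨fun a b hab => by simpa using hab, fun a b hab => by simpa using hab⟩

lemma isRight_gl (s : ℕ ⊕ ℕ) : (gl s).isRight = s.isRight := by cases s <;> rfl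

/-- The translation of indices. -/
def sft (i : ℕ) : ℕ ⊕ ℕ → ℕ ⊕ ℕ := Sum.map (· + i) (· + i)

lemma sft_sft (i j : ℕ) (s : ℕ ⊕ ℕ) : sft j (sft i s) = sft (i + j) s := by
  cases s <;> simp [sft, add_assoc]

lemma sft_zero (s : ℕ ⊕ ℕ) : sft 0 s = s := by cases s <;> rfl

lemma isRight_sft (i : ℕ) (s : ℕ ⊕ ℕ) : (sft i s).isRight = s.isRight := by cases s <;> rfl

/-- The mode with a given index. -/
def modeIdx (q : ℕ) : ℤ := (kind C : ℤ) - 1 - q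

lemma modeIdx_lt (q : ℕ) : modeIdx C q < kind C := by unfold modeIdx; lia

lemma exists_modeIdx {n : ℤ} (hn : n < kind C) : ∃ q, n = modeIdx C q :=
  ⟨(kind C - 1 - n).toNat, by unfold modeIdx; lia⟩

/-- The leading parts of the modes. -/
def DL (s : ℕ ⊕ ℕ) (y : SF) : SF :=
  s.elim (fun p => DB C (modeIdx C p) y) (fun q => DF C (modeIdx C q) y)

lemma finsum_int_eq_sum_range {M : Type*} [AddCommMonoid M] {f : ℤ → M} (c : ℤ) (Q : ℕ)
    (h1 : ∀ i < c, f i = 0) (h2 : ∀ i : ℕ, Q ≤ i → f (c + i) = 0) :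
    ∑ᶠ i, f i = ∑ i ∈ Finset.range Q, f (c + i) := by
  have hinj : Function.Injective fun i : ℕ => c + (i : ℤ) := fun i j hij => by simpa using hij
  rw [finsum_eq_sum_of_support_subset f (s := (Finset.range Q).map ⟨_, hinj⟩), Finset.sum_map]
  · rfl
  · intro i hi
    rw [Finset.mem_coe, Finset.mem_map]
    have h3 : c ≤ i := not_lt.1 fun hlt => hi (h1 i hlt)
    refine ⟨(i - c).toNat, Finset.mem_range.2 (not_le.1 fun hle => hi ?_), by simp; lia⟩
    have := h2 _ hle
    rwa [show c + ((i - c).toNat : ℤ) = i by lia] at this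

/-- The leading parts are a Toeplitz system: convolution of the derivatives along `gl` with the
power series of coefficients `wt C (kind C + i)`, whose constant term is nonzero. -/
lemma DL_eq {Q : ℕ} {y : SF} (hy : LT Q y) (s : ℕ ⊕ ℕ) :
    DL C s y = ∑ i ∈ Finset.range Q, K (wt C (kind C + i)) • d (gl (sft i s)) y := by
  have hd : ∀ i : ℕ, Q ≤ i → d (gl (sft i s)) y = 0 := fun i hi => hy.d_eq_zero (by
    rw [mem_box]
    cases s <;> simp [gl, sft, Letter.idx] <;> lia)
  rcases s with p | p
  · have e : ∀ i : ℕ, Dx C (.inl (2 * (modeIdx C p - (kind C + i)))) y =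
        d (gl (sft i (.inl p))) y := fun i => by
      rw [show 2 * (modeIdx C p - (kind C + i)) = -((2 * (p + i) : ℕ) : ℤ) - 2 by
        unfold modeIdx; push_cast; ring, Dx_inl_neg]
      rfl
    rw [DL, Sum.elim_inl, DB, finsum_int_eq_sum_range (kind C : ℤ) Q]
    · exact Finset.sum_congr rfl fun i _ => by rw [e]
    · intro i hi
      rw [wt_eq_zero C hi, map_zero, zero_smul]
    · intro i hi
      rw [e, hd i hi, smul_zero]
  · have e : ∀ i : ℕ, Dx C (.inr (2 * (modeIdx C p - (kind C + i)) - 1)) y =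
        d (gl (sft i (.inr p))) y := fun i => by
      rw [show 2 * (modeIdx C p - (kind C + i)) - 1 = -((2 * (p + i) + 1 : ℕ) : ℤ) - 2 by
        unfold modeIdx; push_cast; ring, Dx_inr_neg]
      rfl
    rw [DL, Sum.elim_inr, DF, finsum_int_eq_sum_range (kind C : ℤ) Q]
    · exact Finset.sum_congr rfl fun i _ => by rw [e]
    · intro i hi
      rw [wt_eq_zero C hi, map_zero, zero_smul]
    · intro i hi
      rw [e, hd i hi, smul_zero]

/-- The coefficients of the inverse of the leading coefficient series. -/
def invWt (j : ℕ) : ℂ := PowerSeries.coeff j (PowerSeries.mk fun i : ℕ => wt C (kind C + i))⁻¹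

lemma sum_antidiagonal_wt (s : ℕ) :
    ∑ p ∈ Finset.HasAntidiagonal.antidiagonal s, wt C (kind C + p.1) * invWt C p.2 =
      if s = 0 then 1 else 0 := by
  have h1 : (PowerSeries.mk fun i : ℕ => wt C (kind C + i)) *
      (PowerSeries.mk fun i : ℕ => wt C (kind C + i))⁻¹ = 1 := by
    refine PowerSeries.mul_inv_cancel _ ?_
    rw [← PowerSeries.coeff_zero_eq_constantCoeff_apply, PowerSeries.coeff_mk]
    simpa using wt_kind_ne_zero C
  have := congrArg (PowerSeries.coeff s) h1
  rw [PowerSeries.coeff_mul, PowerSeries.coeff_one] at this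
  simpa [invWt] using this

/-- Convolution with mutually inverse power series. Truncating both sums at `Q` is harmless because
the sequence vanishes from `Q` on. -/
lemma sum_range_mul_range {M : Type*} [AddCommGroup M] [Module Hb M] (a b : ℕ → ℂ)
    (hab : ∀ s, ∑ p ∈ Finset.HasAntidiagonal.antidiagonal s, a p.1 * b p.2 = if s = 0 then 1 else 0)
    {Q : ℕ} {e : ℕ → M} (he : ∀ q, Q ≤ q → e q = 0) :
    ∑ i ∈ Finset.range Q, K (a i) • ∑ j ∈ Finset.range Q, K (b j) • e (i + j) = e 0 := by
  have h1 : ∀ i ∈ Finset.range Q, K (a i) • ∑ j ∈ Finset.range Q, K (b j) • e (i + j) =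
      ∑ j ∈ Finset.range Q, ∑ s ∈ Finset.range Q, if i + j = s then K (a i * b j) • e s else 0 := by
    intro i _
    rw [Finset.smul_sum]
    refine Finset.sum_congr rfl fun j _ => ?_
    rw [smul_smul, ← map_mul, Finset.sum_ite_eq]
    split_ifs with h2
    · rfl
    · rw [he _ (not_lt.1 fun h3 => h2 (Finset.mem_range.2 h3)), smul_zero]
  rw [Finset.sum_congr rfl h1]
  have h2 : ∀ s ∈ Finset.range Q, (∑ i ∈ Finset.range Q, ∑ j ∈ Finset.range Q,
      if i + j = s then K (a i * b j) • e s else 0) = K (if s = 0 then 1 else 0) • e s := by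
    intro s hs
    rw [← hab, map_sum, Finset.sum_smul, ← Finset.sum_product', ← Finset.sum_filter]
    refine Finset.sum_congr ?_ fun _ _ => rfl
    ext ⟨i, j⟩
    rw [Finset.mem_range] at hs
    simp only [Finset.mem_filter, Finset.mem_product, Finset.mem_range,
      Finset.HasAntidiagonal.mem_antidiagonal]
    lia
  rw [Finset.sum_congr rfl fun i _ => Finset.sum_comm, Finset.sum_comm, Finset.sum_congr rfl h2]
  rcases Nat.eq_zero_or_pos Q with rfl | hQ
  · simp [he 0 le_rfl]
  · rw [Finset.sum_eq_single 0 (fun s _ hs => by rw [if_neg hs, map_zero, zero_smul])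
      (fun h => absurd (Finset.mem_range.2 hQ) h), if_pos rfl, map_one, one_smul]

lemma sum_antidiagonal_invWt (s : ℕ) :
    ∑ p ∈ Finset.HasAntidiagonal.antidiagonal s, invWt C p.1 * wt C (kind C + p.2) =
      if s = 0 then 1 else 0 := by
  rw [← sum_antidiagonal_wt C s, ← Finset.Nat.sum_antidiagonal_swap]
  exact Finset.sum_congr rfl fun p _ => mul_comm _ _

lemma gl_sft_not_mem_box {Q i : ℕ} (hi : Q ≤ i) (s : ℕ ⊕ ℕ) : gl (sft i s) ∉ box Q := by
  rw [mem_box]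
  cases s <;> simp [gl, sft, Letter.idx] <;> lia

/-- The derivatives in terms of the leading parts. -/
lemma d_gl_eq {Q : ℕ} {y : SF} (hy : LT Q y) (s : ℕ ⊕ ℕ) :
    d (gl s) y = ∑ i ∈ Finset.range Q, K (invWt C i) • DL C (sft i s) y := by
  have := sum_range_mul_range (Q := Q) (invWt C) (fun i => wt C (kind C + i))
    (sum_antidiagonal_invWt C)
    (e := fun i => d (gl (sft i s)) y) fun q hq => hy.d_eq_zero (gl_sft_not_mem_box hq s)
  rw [sft_zero] at this
  rw [← this]
  refine Finset.sum_congr rfl fun i _ => ?_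
  rw [DL_eq C hy]
  simp only [sft_sft]

/-! ### The Poincaré lemma -/

open Classical in
/-- The number of letters of a word that occur in the leading parts. -/
def cnt (w : List Letter) : ℕ := w.countP fun a => decide (a ∈ Set.range gl)

lemma cnt_perm {w w' : List Letter} (hw : w.Perm w') : cnt w = cnt w' := hw.countP_eq _

/-- The inverse of the number operator, increased by `c`. -/
def invCntFun (c : ℕ) (f : List Letter → Hb) : List Letter → Hb :=
  fun w => K (1 / (cnt w + c)) * f w

lemma invCntFun_mem (c : ℕ) {f : List Letter → Hb} (hf : f ∈ superFun Hb) :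
    invCntFun c f ∈ superFun Hb := by
  refine ⟨fun u a b v => ?_, ?_⟩
  · rw [invCntFun, invCntFun, hf.1 u a b v,
      cnt_perm (List.Perm.append_left u (List.Perm.swap b a v))]
    ring
  · obtain ⟨N, hN⟩ := hf.2
    exact ⟨N, fun w hw => by rw [invCntFun, hN w hw, mul_zero]⟩

/-- The inverse of the number operator, increased by `c`. -/
def invCnt (c : ℕ) : SF →ₗ[Hb] SF where
  toFun y := ⟨invCntFun c y.1, invCntFun_mem c y.2⟩
  map_add' y z := ext_val fun w => mul_add _ (y.1 w) (z.1 w)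
  map_smul' r y := ext_val fun w => mul_left_comm _ r (y.1 w)

lemma invCnt_val (c : ℕ) (y : SF) (w : List Letter) :
    (invCnt c y).1 w = K (1 / (cnt w + c)) * y.1 w := rfl

lemma invCnt_mem_Fil {c e : ℕ} {y : SF} (hy : y ∈ Fil e) : invCnt c y ∈ Fil e := by
  intro w g hg
  rw [invCnt_val, Hb.coeff_K_mul, hy w g hg, mul_zero]

lemma IsHom.invCnt {p : Bool} {y : SF} (hy : IsHom p y) (c : ℕ) : IsHom p (invCnt c y) := by
  funext w
  have := congrFun hy w
  simp only [tw, Pi.smul_apply, smul_eq_mul, invCnt_val] at this ⊢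
  rw [mul_left_comm, this, mul_left_comm]

/-- The derivative removes one counted letter. The value 1 / 0 = 0 on words without counted letters
is never seen, since `gl s :: w` contains one. -/
lemma d_gl_invCnt (s : ℕ ⊕ ℕ) (y : SF) : d (gl s) (invCnt 0 y) = invCnt 1 (d (gl s) y) := by
  refine ext_val fun w => ?_
  change K (1 / ((cnt (gl s :: w) : ℕ) + (0 : ℕ))) * y.1 (gl s :: w) =
    K (1 / (cnt w + (1 : ℕ))) * y.1 (gl s :: w)
  have : cnt (gl s :: w) = cnt w + 1 := by simp [cnt]
  rw [this]
  norm_num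

lemma d_invCnt_eq_zero {a : Letter} {y : SF} (h0 : d a y = 0) : d a (invCnt 0 y) = 0 := by
  refine ext_val fun w => ?_
  have : y.1 (a :: w) = 0 := congrFun (congrArg Subtype.val h0) w
  change K _ * y.1 (a :: w) = 0
  rw [this, mul_zero]

open Classical in
/-- Euler's identity. -/
lemma sum_x_d {M : ℕ} {y : SF} (hy : LT M y) (w : List Letter) :
    (∑ s ∈ box M, mul (x (gl s)) (d (gl s) y)).1 w = K (cnt w) * y.1 w := by
  induction w generalizing y with
  | nil =>
    simp only [cnt, List.countP_nil, Nat.cast_zero, map_zero, zero_mul]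
    refine Finset.sum_induction _ (fun z : SF => z.1 [] = 0) (fun z t hz ht => ?_) rfl
      fun s _ => ?_
    · rw [add_val, Pi.add_apply, hz, ht, add_zero]
    · change var (gl s) [] * _ = (0 : Hb)
      simp [var]
  | cons b w ih =>
    have h1 : d b (∑ s ∈ box M, mul (x (gl s)) (d (gl s) y)) =
        (∑ s ∈ box M, if b = gl s then d b y else 0) +
          ∑ s ∈ box M, mul (x (gl s)) (d (gl s) (d b y)) := by
      rw [map_sum, ← Finset.sum_add_distrib]
      refine Finset.sum_congr rfl fun s _ => ?_
      rw [d_mul, d_x, (isHom_x (gl s)).twist, d_d b, map_smul, LinearMap.map_smul,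
        LinearMap.smul_apply, smul_smul, eps_mul_self, one_smul]
      split_ifs with hb
      · rw [unit_mul, ← hb]
      · rw [map_zero, LinearMap.zero_apply]
    have h2 : (∑ s ∈ box M, if b = gl s then d b y else 0) =
        if b ∈ Set.range gl then d b y else 0 := by
      split_ifs with hb
      · obtain ⟨s, rfl⟩ := hb
        by_cases hs : s ∈ box M
        · rw [Finset.sum_eq_single s (fun t _ ht => if_neg fun e => ht (gl_injective e.symm))
            (fun h => absurd hs h), if_pos rfl]
        · have : d (gl s) y = 0 := hy.d_eq_zero fun h => hs (by
            rw [mem_box] at h ⊢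
            cases s <;> simp [gl, Letter.idx] at h ⊢ <;> lia)
          rw [this]
          simp
      · exact Finset.sum_eq_zero fun s _ => if_neg fun e => hb ⟨s, e.symm⟩
    change (d b (∑ s ∈ box M, mul (x (gl s)) (d (gl s) y))).1 w = _
    rw [h1, h2, add_val, Pi.add_apply, ih (hy.d b)]
    have e : (d b y).1 w = y.1 (b :: w) := rfl
    by_cases hb : b ∈ Set.range gl
    · have : cnt (b :: w) = cnt w + 1 := by
        unfold cnt
        rw [List.countP_cons_of_pos (by simpa using hb)]
      rw [this, if_pos hb, e]
      push_cast
      rw [map_add, map_one]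
      ring
    · have : cnt (b :: w) = cnt w := by
        unfold cnt
        rw [List.countP_cons_of_neg (by simpa using hb)]
      rw [this, if_neg hb, e, zero_val, Pi.zero_apply, zero_add]

/-- A closed system of derivatives of degree `k` can be integrated. -/
lemma exists_potential {k Q : ℕ} (E : ℕ ⊕ ℕ → SF) (hE : ∀ s, E s ∈ Fil k)
    (hp : ∀ s, IsHom s.isRight (E s)) (h0 : ∀ s, s ∉ box Q → E s = 0)
    (hcl : ∀ s t, d (gl s) (E t) - (eps s.isRight t.isRight : Hb) • d (gl t) (E s) ∈ Fil k)
    (hbad : ∀ a : Letter, Odd a.idx → ∀ s, d a (E s) = 0) :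
    ∃ δ : SF, IsHom false δ ∧ δ ∈ Fil (k + 1) ∧ (∀ a : Letter, Odd a.idx → d a δ = 0) ∧
      ∀ s, d (gl s) δ - E s ∈ Fil (k + 1) := by
  obtain ⟨M, hM⟩ : ∃ M, ∀ s, LT M (E s) := by
    choose N hN using fun s => exists_LT (E s)
    refine ⟨(box Q).sup N, fun s => ?_⟩
    by_cases hs : s ∈ box Q
    · exact (hN s).mono (Finset.le_sup hs)
    · rw [h0 s hs]
      exact fun w _ => rfl
  have hMQ : ∀ s, s ∉ box (max M Q) → E s = 0 := fun s hs => h0 s fun h => hs (by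
    rw [mem_box] at h ⊢
    exact h.trans_le (le_max_right _ _))
  replace hM : ∀ s, LT (max M Q) (E s) := fun s => (hM s).mono (le_max_left _ _)
  generalize max M Q = R at hM hMQ
  -- Contraction with the Euler vector field. Dividing by the number of counted letters gives the
  -- potential; the remaining letters, among them the zero mode, are parameters.
  set z : SF := ∑ s ∈ box R, mul (x (gl s)) (E s) with hz
  have hzF : z ∈ Fil (k + 1) := (Fil _).sum_mem fun s _ => by
    rw [add_comm]
    exact mul_mem_Fil (x_mem_Fil _) (hE s)
  have hd : ∀ a, d a z = (∑ s ∈ box R, if a = gl s then E s else 0) +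
      ∑ s ∈ box R, mul (x (gl s)) ((eps a.isRight s.isRight : Hb) • d a (E s)) := by
    intro a
    rw [hz, map_sum, ← Finset.sum_add_distrib]
    refine Finset.sum_congr rfl fun s _ => ?_
    rw [d_mul, d_x, (isHom_x (gl s)).twist, LinearMap.map_smul, LinearMap.map_smul,
      LinearMap.smul_apply, isRight_gl]
    congr 1
    split_ifs
    · rw [unit_mul]
    · rw [map_zero, LinearMap.zero_apply]
  refine ⟨invCnt 0 z, ?_, invCnt_mem_Fil hzF, fun a ha => d_invCnt_eq_zero ?_, fun t => ?_⟩
  · refine IsHom.invCnt (IsHom.sum _ fun s _ => ?_) 0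
    have := (isHom_x (gl s)).mul (hp s)
    rwa [isRight_gl, Bool.xor_self] at this
  · rw [hd, Finset.sum_eq_zero, Finset.sum_eq_zero, add_zero]
    · intro s _
      rw [hbad a ha, smul_zero, map_zero]
    · intro s _
      refine if_neg fun e => ?_
      subst e
      cases s <;> simp only [gl, Letter.idx, Sum.map_inl, Sum.map_inr, Sum.elim_inl, Sum.elim_inr, id] at ha <;>
        exact absurd ha (by simp [parity_simps])
  · rw [d_gl_invCnt, hd]
    have e1 : (∑ s ∈ box R, if gl t = gl s then E s else 0) = E t := by
      by_cases ht : t ∈ box R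
      · rw [Finset.sum_eq_single t (fun s _ hs => if_neg fun e => hs (gl_injective e.symm))
          (fun h => absurd ht h), if_pos rfl]
      · rw [hMQ t ht]
        refine Finset.sum_eq_zero fun s hs => if_neg fun e => ht ?_
        rwa [gl_injective e]
    -- Closedness exchanges the two indices up to degree k, and the coordinate factor raises the
    -- error to degree k + 1.
    have e2 : ∑ s ∈ box R, mul (x (gl s)) ((eps (gl t).isRight s.isRight : Hb) • d (gl t) (E s)) -
        ∑ s ∈ box R, mul (x (gl s)) (d (gl s) (E t)) ∈ Fil (k + 1) := by
      rw [← Finset.sum_sub_distrib]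
      refine (Fil _).sum_mem fun s _ => ?_
      rw [← map_sub, add_comm]
      refine mul_mem_Fil (x_mem_Fil _) ?_
      have := (Fil k).neg_mem (hcl s t)
      rwa [neg_sub, eps_comm, ← isRight_gl t] at this
    -- By Euler's identity the argument is the counting operator plus one, applied to `E t`.
    have e3 : invCnt 1 (E t + ∑ s ∈ box R, mul (x (gl s)) (d (gl s) (E t))) = E t := by
      refine ext_val fun w => ?_
      rw [invCnt_val, add_val, Pi.add_apply, sum_x_d (hM t)]
      have : ((cnt w : ℂ) + (1 : ℕ)) ≠ 0 := by
        have := Nat.cast_add_one_ne_zero (R := ℂ) (cnt w)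
        simpa using this
      have e4 : K (1 / (cnt w + (1 : ℕ))) * (K (cnt w) + 1) = 1 := by
        rw [← map_one K, ← map_add, ← map_mul]
        congr 1
        field_simp
        simp
      linear_combination (E t).1 w * e4
    rw [e1]
    have := invCnt_mem_Fil (c := 1) e2
    rw [map_sub] at this
    rw [map_add] at e3 ⊢
    convert this using 1
    nth_rewrite 2 [← e3]
    abel

end

end SuperTR

namespace SuperTR

noncomputable section

open Hb (h K)
open SF

variable (C : LocalSuperSpectralCurve)

/-! ### Solving the quadratic constraints degree by degree -/

/-- Bosonic exponents a ≥ 0 couple to the letter of index a, fermionic exponents b ≥ 0 to the one of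
index b + 1, besides the zero mode of index 0. The modes of `oscillators` thus involve only letters
of even index, and independence of odd letters persists through the construction. -/
lemma d_source_eq_zero {a : Letter} (ha : Odd a.idx) {e : ℤ ⊕ ℤ}
    (he : e.elim (fun a => Even a) (fun b => Odd b)) : d a (source C e) = 0 := by
  rcases e with i | b
  · rw [Sum.elim_inl] at he
    rw [source, map_add, LinearMap.map_smul _ _ unit, d_unit, smul_zero, add_zero]
    split_ifs with h1
    · rw [map_smul, d_x, if_neg, smul_zero]
      rintro rfl
      lift i to ℕ using h1
      simp only [Letter.idx, Sum.elim_inl, id, Int.toNat_natCast] at ha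
      exact Nat.not_even_iff_odd.2 ha ((Int.even_coe_nat i).1 he)
    · rw [map_zero]
  · rw [Sum.elim_inr] at he
    have h0 : a ≠ .inr 0 := by
      rintro rfl
      simp [Letter.idx] at ha
    rw [source, map_add, map_smul, d_x, if_neg h0, smul_zero, add_zero]
    split_ifs with h1
    · rw [d_x, if_neg]
      rintro rfl
      lift b to ℕ using h1
      simp only [Letter.idx, Sum.elim_inr, id] at ha
      rw [show ((b : ℤ) + 1).toNat = b + 1 by lia] at ha
      rw [Int.odd_coe_nat] at he
      exact Nat.not_even_iff_odd.2 ha he.add_one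
    · rw [map_zero]

lemma d_Op {a : Letter} (ha : Odd a.idx) {S : SF} (hd : d a S = 0)
    {e : ℤ ⊕ ℤ} (he : e.elim (fun a => Even a) (fun b => Odd b)) {y : SF} (hy : d a y = 0) :
    d a (Op C S e y) = 0 := by
  have hf : d a (field C S e) = 0 := by
    rw [field, map_add, d_source_eq_zero C ha he, d_Dx, hd, map_zero, smul_zero, add_zero]
  rw [Op_apply, map_add, map_smul, d_Dx, hy, d_mul, hf, hy]
  simp

lemma finsum_eq_zero_of_map {ι : Type*} (φ : SF →ₗ[Hb] SF) {f : ι → SF}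
    (hf : (Function.support f).Finite) (h0 : ∀ i, φ (f i) = 0) : φ (∑ᶠ i, f i) = 0 := by
  rw [finsum_eq_sum f hf, map_sum]
  exact Finset.sum_eq_zero fun i _ => h0 i

/-! ### Modes applied to the constant function -/

section Modes

variable {S : SF} (hp : IsHom false S)

lemma d_G_unit {a : Letter} (ha : Odd a.idx) (hd : d a S = 0) (n : ℤ) :
    d a ((oscillators C hp).G n unit) = 0 := by
  rw [Oscillators.G_apply]
  refine finsum_eq_zero_of_map _ ((oscillators C hp).finite_βγ n unit) fun i => ?_
  exact d_Op C ha hd (by simp) (d_Op C ha hd (by simp [parity_simps]) (d_unit a))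

lemma d_T_unit {a : Letter} (ha : Odd a.idx) (hd : d a S = 0) (n : ℤ) :
    d a ((oscillators C hp).T n unit) = 0 := by
  have hβ : ∀ i j : ℤ, d a (Op C S (.inl (2 * i)) (Op C S (.inl (2 * j)) unit)) = 0 := fun i j =>
    d_Op C ha hd (by simp) (d_Op C ha hd (by simp) (d_unit a))
  have hγ : ∀ i j : ℤ, d a (Op C S (.inr (2 * i - 1)) (Op C S (.inr (2 * j - 1)) unit)) = 0 :=
    fun i j => d_Op C ha hd (by simp [parity_simps])
      (d_Op C ha hd (by simp [parity_simps]) (d_unit a))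
  rw [Oscillators.T_apply, map_add, map_add,
    finsum_eq_zero_of_map _ ((oscillators C hp).finite_nβ n unit),
    finsum_eq_zero_of_map _ (finite_support_smul _ ((oscillators C hp).finite_nγ (n + 1) unit))]
  · split_ifs
    · rw [map_smul, d_unit, smul_zero, add_zero, add_zero]
    · rw [map_zero, add_zero, add_zero]
  · intro i
    rw [map_smul]
    unfold Oscillators.nγ
    split_ifs
    · rw [LinearMap.comp_apply, hγ, smul_zero]
    · rw [LinearMap.neg_apply, LinearMap.comp_apply, map_neg, hγ, neg_zero, smul_zero]
  · intro i
    unfold Oscillators.nβ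
    split_ifs
    · rw [LinearMap.comp_apply, hβ]
    · rw [LinearMap.comp_apply, hβ]

include hp in
lemma isHom_Op {q : Bool} {e : ℤ ⊕ ℤ} {y : SF} (hy : IsHom q y) :
    IsHom (e.isRight ^^ q) (Op C S e y) := by
  rw [Op_apply]
  exact ((IsHom.Dx C hy e).smul _).add ((isHom_field C hp e).mul hy)

lemma isHom_G_unit (n : ℤ) : IsHom true ((oscillators C hp).G n unit) := by
  rw [Oscillators.G_apply]
  refine IsHom.finsum fun i => ?_
  simpa using isHom_Op C hp (e := .inl (2 * i))
    (isHom_Op C hp (e := .inr (2 * (n - i) - 1)) isHom_unit)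

lemma isHom_T_unit (n : ℤ) : IsHom false ((oscillators C hp).T n unit) := by
  have hβ : ∀ i j : ℤ, IsHom false (Op C S (.inl (2 * i)) (Op C S (.inl (2 * j)) unit)) :=
    fun i j => by
      simpa using isHom_Op C hp (e := .inl (2 * i))
        (isHom_Op C hp (e := .inl (2 * j)) isHom_unit)
  have hγ : ∀ i j : ℤ, IsHom false (Op C S (.inr (2 * i - 1)) (Op C S (.inr (2 * j - 1)) unit)) :=
    fun i j => by
      simpa using isHom_Op C hp (e := .inr (2 * i - 1))
        (isHom_Op C hp (e := .inr (2 * j - 1)) isHom_unit)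
  rw [Oscillators.T_apply]
  refine ((IsHom.finsum fun i => ?_).add (IsHom.finsum fun i => IsHom.smul ?_ _)).add ?_
  · unfold Oscillators.nβ
    split_ifs
    · rw [LinearMap.comp_apply]; exact hβ _ _
    · rw [LinearMap.comp_apply]; exact hβ _ _
  · unfold Oscillators.nγ
    split_ifs
    · rw [LinearMap.comp_apply]; exact hγ _ _
    · rw [LinearMap.neg_apply, LinearMap.comp_apply, ← neg_one_smul Hb]; exact (hγ _ _).smul _
  · split_ifs
    · exact isHom_unit.smul _
    · exact IsHom.zero _

lemma Op_unit_eq_zero {N : ℕ} (hN : LT N S) {e : ℤ ⊕ ℤ} (he : e.elim id id < -(N : ℤ) - 2) :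
    Op C S e unit = 0 := by
  rw [Op_unit, field_eq_zero_of_LT C hN he]

/-- For such `n` every summand contains a field beyond its pole order, so only finitely many
constraints are nontrivial. -/
lemma G_unit_eq_zero {N : ℕ} (hN : LT N S) {n : ℤ} (hn : n < -(N : ℤ) - 4) :
    (oscillators C hp).G n unit = 0 := by
  rw [Oscillators.G_apply, finsum_congr fun i => ?_, finsum_zero]
  by_cases hi : 2 * i < -(N : ℤ) - 2
  · rw [(oscillators C hp).βγ]
    rw [Op_unit_eq_zero C hN (by simpa using hi), map_zero]
  · rw [Op_unit_eq_zero C hN (e := .inr _) (by simp only [Sum.elim_inr, id]; lia), map_zero]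

lemma T_unit_eq_zero {N : ℕ} (hN : LT N S) {n : ℤ} (hn : n < -(N : ℤ) - 4) :
    (oscillators C hp).T n unit = 0 := by
  rw [Oscillators.T_apply, finsum_congr (g := fun _ => 0) fun i => ?_, finsum_zero,
    finsum_congr (g := fun _ => 0) fun i => ?_, finsum_zero, if_neg (by lia), add_zero, add_zero]
  · unfold Oscillators.nγ
    split_ifs
    · rw [LinearMap.comp_apply]
      beta_reduce
      rw [Op_unit_eq_zero C hN (e := .inr _) (by simp only [Sum.elim_inr, id]; lia), map_zero,
        smul_zero]
    · rw [LinearMap.neg_apply, LinearMap.comp_apply]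
      beta_reduce
      rw [Op_unit_eq_zero C hN (e := .inr _) (by simp only [Sum.elim_inr, id]; lia), map_zero,
        neg_zero, smul_zero]
  · unfold Oscillators.nβ
    split_ifs
    · rw [LinearMap.comp_apply]
      beta_reduce
      rw [Op_unit_eq_zero C hN (e := .inl _) (by simp only [Sum.elim_inl, id]; lia), map_zero]
    · rw [LinearMap.comp_apply]
      beta_reduce
      rw [Op_unit_eq_zero C hN (e := .inl _) (by simp only [Sum.elim_inl, id]; lia), map_zero]

end Modes

/-- `S` solves the constraints up to degree `k`. -/
structure Good (k : ℕ) (S : SF) : Prop where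
  par : IsHom false S
  fil : S ∈ Fil 3
  bad : ∀ a : Letter, Odd a.idx → d a S = 0
  G : ∀ n : ℤ, n < kind C → (oscillators C par).G n unit ∈ Fil k
  T : ∀ n : ℤ, n < kind C → (oscillators C par).T n unit ∈ Fil k

/-- The leading parts are derivatives and annihilate the constant function, so all constraints begin
in degree two. -/
lemma good_zero : Good C 2 0 := by
  have hF : ∀ n, DF C n unit = 0 := fun n => by
    simp only [DF, Dx_unit, smul_zero, finsum_zero]
  have hB : ∀ n, DB C n unit = 0 := fun n => by
    simp only [DB, Dx_unit, smul_zero, finsum_zero]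
  refine ⟨IsHom.zero _, (Fil 3).zero_mem, fun a _ => map_zero _, fun n hn => ?_, fun n hn => ?_⟩
  · simpa [hF] using G_lead C (IsHom.zero false) (Fil 3).zero_mem hn (mem_Fil_zero unit)
  · simpa [hB] using T_lead C (IsHom.zero false) (Fil 3).zero_mem hn (mem_Fil_zero unit)

/-! ### The obstruction and its removal -/

section Step

variable {C} {k : ℕ} {S : SF} (hS : Good C k S)

include hS

/-- The anticommutator h T_{m+n}·1 has degree at least k + 2. Comparing with the leading parts and
cancelling ħ gives closedness in the odd directions. The index m + n stays below `kind C` because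
`kind C` ≤ 1. -/
lemma Good.DF_G {m n : ℤ} (hm : m < kind C) (hn : n < kind C) :
    DF C m ((oscillators C hS.par).G n unit) + DF C n ((oscillators C hS.par).G m unit) ∈
      Fil k := by
  have h1 := G_lead C hS.par hS.fil hm (hS.G n hn)
  have h2 := G_lead C hS.par hS.fil hn (hS.G m hm)
  have hk := kind_le_one C
  have h3 : (oscillators C hS.par).G m ((oscillators C hS.par).G n unit) +
      (oscillators C hS.par).G n ((oscillators C hS.par).G m unit) ∈ Fil (k + 2) := by
    have hT : h • (oscillators C hS.par).T (m + n) unit ∈ Fil (k + 2) :=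
      h_smul_mem_Fil.2 (hS.T _ (by lia))
    by_cases hmn : m + n = -1
    · have h0 : (m = 0 ∧ n = -1) ∨ (m = -1 ∧ n = 0) := by lia
      rcases h0 with ⟨rfl, rfl⟩ | ⟨rfl, rfl⟩
      · rw [add_comm ((oscillators C hS.par).G 0 _), (oscillators C hS.par).G_G_neg_one_zero]
        exact hT
      · rw [(oscillators C hS.par).G_G_neg_one_zero]
        exact hT
    · rw [(oscillators C hS.par).G_G_of_ne hmn]
      exact hT
  rw [← h_smul_mem_Fil, smul_add]
  convert (Fil _).sub_mem h3 ((Fil _).add_mem h1 h2) using 1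
  abel

/-- Mixed closedness, from the commutator of T_m and G_n. -/
lemma Good.DB_G {m n : ℤ} (hm : m < kind C) (hn : n < kind C) :
    DB C m ((oscillators C hS.par).G n unit) + DB C m ((oscillators C hS.par).G n unit) -
      DF C n ((oscillators C hS.par).T m unit) ∈ Fil k := by
  have h1 := T_lead C hS.par hS.fil hm (hS.G n hn)
  have h2 := G_lead C hS.par hS.fil hn (hS.T m hm)
  have hk := kind_le_one C
  have h3 : (oscillators C hS.par).T m ((oscillators C hS.par).G n unit) -
      (oscillators C hS.par).G n ((oscillators C hS.par).T m unit) ∈ Fil (k + 2) := by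
    rw [(oscillators C hS.par).T_G, add_sub_cancel_left]
    -- This is the only pair for which m + n + 1 leaves the range of the constraints, and there the
    -- structure constant 4n - 2m vanishes.
    by_cases hmn : m = 0 ∧ n = 0
    · obtain ⟨rfl, rfl⟩ := hmn
      simp
    · rw [mul_smul]
      exact h_smul_mem_Fil.2 ((Fil _).smul_mem _ (hS.G _ (by lia)))
  rw [← h_smul_mem_Fil, smul_sub, smul_add]
  convert (Fil _).sub_mem h3 ((Fil _).sub_mem h1 h2) using 1
  abel

/-- Closedness in the even directions, from `T_T`; one extra power of ħ is cancelled because that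
relation is known only after multiplication by ħ. -/
lemma Good.DB_T {m n : ℤ} (hm : m < kind C) (hn : n < m) :
    DB C m ((oscillators C hS.par).T n unit) - DB C n ((oscillators C hS.par).T m unit) ∈
      Fil k := by
  have h1 := T_lead C hS.par hS.fil hm (hS.T n (hn.trans hm))
  have h2 := T_lead C hS.par hS.fil (hn.trans hm) (hS.T m hm)
  have hk := kind_le_one C
  have h3 : h • ((oscillators C hS.par).T m ((oscillators C hS.par).T n unit) -
      (oscillators C hS.par).T n ((oscillators C hS.par).T m unit)) ∈ Fil (k + 2 + 2) := by
    rw [smul_sub, (oscillators C hS.par).T_T (by lia) hn, add_sub_cancel_left, _root_.mul_assoc,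
      mul_smul, mul_smul]
    exact h_smul_mem_Fil.2 (h_smul_mem_Fil.2 ((Fil _).smul_mem _ (hS.T _ (by lia))))
  rw [h_smul_mem_Fil] at h3
  rw [← h_smul_mem_Fil]
  -- The half undoes the doubling of the leading part in `T_lead`.
  have h4 := (Fil _).smul_mem (⅟ (2 : Hb)) ((Fil _).sub_mem h3 ((Fil _).sub_mem h1 h2))
  convert h4 using 1
  have h5 : ∀ a : SF, a + a = (2 : Hb) • a := fun a => (two_smul Hb a).symm
  simp only [h5]
  rw [show ∀ a b c e : SF, a - b - (a - (2 : Hb) • h • c - (b - (2 : Hb) • h • e)) =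
    (2 : Hb) • h • (c - e) from fun a b c e => by simp only [smul_sub]; abel,
    smul_smul, invOf_mul_self, one_smul]

/-- The obstruction in the next degree, up to normalization. -/
def obstr (s : ℕ ⊕ ℕ) : SF :=
  s.elim (fun p => K (-1 / 2) • (oscillators C hS.par).T (modeIdx C p) unit)
    (fun q => K (-1) • (oscillators C hS.par).G (modeIdx C q) unit)

lemma obstr_mem (s : ℕ ⊕ ℕ) : obstr hS s ∈ Fil k := by
  rcases s with p | p
  · exact (Fil k).smul_mem _ (hS.T _ (modeIdx_lt C p))
  · exact (Fil k).smul_mem _ (hS.G _ (modeIdx_lt C p))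

lemma isHom_obstr (s : ℕ ⊕ ℕ) : IsHom s.isRight (obstr hS s) := by
  rcases s with p | p
  · exact (isHom_T_unit C hS.par _).smul _
  · exact (isHom_G_unit C hS.par _).smul _

lemma d_obstr {a : Letter} (ha : Odd a.idx) (s : ℕ ⊕ ℕ) : d a (obstr hS s) = 0 := by
  rcases s with p | p
  · rw [obstr, Sum.elim_inl, map_smul, d_T_unit C hS.par ha (hS.bad a ha), smul_zero]
  · rw [obstr, Sum.elim_inr, map_smul, d_G_unit C hS.par ha (hS.bad a ha), smul_zero]

lemma exists_obstr_bound : ∃ Q, (∀ s, s ∉ box Q → obstr hS s = 0) ∧ ∀ s, LT Q (obstr hS s) := by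
  obtain ⟨N, hN⟩ := exists_LT S
  have h0 : ∀ s, s ∉ box (N + 6) → obstr hS s = 0 := fun s hs => by
    have hk := kind_le_one C
    rw [mem_box, not_lt] at hs
    rcases s with p | p <;> simp only [Letter.idx, Sum.elim_inl, Sum.elim_inr, id] at hs
    · rw [obstr, Sum.elim_inl, T_unit_eq_zero C hS.par hN (by unfold modeIdx; lia), smul_zero]
    · rw [obstr, Sum.elim_inr, G_unit_eq_zero C hS.par hN (by unfold modeIdx; lia), smul_zero]
  choose M hM using fun s => exists_LT (obstr hS s)
  refine ⟨max (N + 6) ((box (N + 6)).sup M), fun s hs => h0 s fun h => hs ?_, fun s => ?_⟩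
  · rw [mem_box] at h ⊢
    exact h.trans_le (le_max_left _ _)
  · by_cases hs : s ∈ box (N + 6)
    · exact (hM s).mono ((Finset.le_sup hs).trans (le_max_right _ _))
    · rw [h0 s hs]
      exact fun w _ => rfl

omit hS in
lemma DL_smul (c : Hb) (s : ℕ ⊕ ℕ) (y : SF) : DL C s (c • y) = c • DL C s y := by
  obtain ⟨N, hN⟩ := exists_LT y
  rw [DL_eq C hN, DL_eq C (hN.smul c), Finset.smul_sum]
  exact Finset.sum_congr rfl fun i _ => by rw [map_smul, smul_comm]

/-- The obstruction is a closed super one-form up to degree k, with derivatives taken along the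
leading parts. The normalizations -1/2 and -1 in `obstr` absorb the factor two of the bosonic
leading part. -/
lemma DL_obstr (s t : ℕ ⊕ ℕ) :
    DL C s (obstr hS t) - (eps s.isRight t.isRight : Hb) • DL C t (obstr hS s) ∈ Fil k := by
  have hBF : ∀ p q, DL C (.inl p) (obstr hS (.inr q)) - DL C (.inr q) (obstr hS (.inl p)) ∈
      Fil k := fun p q => by
    have := (Fil k).smul_mem (K (-1 / 2)) (hS.DB_G (modeIdx_lt C p) (modeIdx_lt C q))
    rw [obstr, Sum.elim_inr, DL_smul, obstr, Sum.elim_inl, DL_smul]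
    convert this using 1
    rw [smul_sub, smul_add, ← add_smul, ← map_add]
    norm_num
    rfl
  rcases s with p | p <;> rcases t with q | q <;>
    simp only [eps, Sum.isRight_inl, Sum.isRight_inr, Bool.and_false, Bool.false_and, Bool.and_self,
      Bool.false_eq_true, if_false, if_true, one_smul, neg_smul]
  · rw [obstr, Sum.elim_inl, DL_smul, obstr, Sum.elim_inl, DL_smul, ← smul_sub]
    refine (Fil k).smul_mem _ ?_
    change DB C _ _ - DB C _ _ ∈ _
    rcases lt_trichotomy p q with hpq | rfl | hpq
    · exact hS.DB_T (modeIdx_lt C p) (by unfold modeIdx; lia)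
    · rw [sub_self]
      exact (Fil k).zero_mem
    · rw [← neg_sub]
      exact (Fil k).neg_mem (hS.DB_T (modeIdx_lt C q) (by unfold modeIdx; lia))
  · exact hBF p q
  · rw [← neg_sub]
    exact (Fil k).neg_mem (hBF q p)
  · rw [sub_neg_eq_add, obstr, Sum.elim_inr, DL_smul, obstr, Sum.elim_inr, DL_smul, ← smul_add]
    exact (Fil k).smul_mem _ (hS.DF_G (modeIdx_lt C p) (modeIdx_lt C q))

/-- Solving the constraints in the next degree. -/
lemma Good.exists_succ (hk : 2 ≤ k) :
    ∃ S', S' - S ∈ Fil (k + 1) ∧ Good C (k + 1) S' := by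
  obtain ⟨Q, h0, hQ⟩ := exists_obstr_bound hS
  have hsft : ∀ {i : ℕ} (s : ℕ ⊕ ℕ), Q ≤ i → obstr hS (sft i s) = 0 := fun {i} s hi => h0 _ (by
    rw [mem_box]
    cases s <;> simp [sft, Letter.idx] <;> lia)
  -- The inverse Toeplitz system turns the prescribed leading parts into prescribed derivatives
  -- along `gl`.
  let E : ℕ ⊕ ℕ → SF := fun s => ∑ j ∈ Finset.range Q, K (invWt C j) • obstr hS (sft j s)
  obtain ⟨δ, hδ, hδF, hδb, hδE⟩ := exists_potential (k := k) (Q := Q) E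
    (fun s => (Fil k).sum_mem fun j _ => (Fil k).smul_mem _ (obstr_mem hS _))
    (fun s => IsHom.sum _ fun j _ => by
      have := isHom_obstr hS (sft j s)
      rw [isRight_sft] at this
      exact this.smul _)
    (fun s hs => Finset.sum_eq_zero fun j _ => by
      rw [h0, smul_zero]
      rw [mem_box] at hs ⊢
      cases s <;> simp [sft, Letter.idx] at hs ⊢ <;> lia)
    (fun s t => by
      have e : ∀ s t, d (gl s) (E t) = ∑ j ∈ Finset.range Q, ∑ i ∈ Finset.range Q,
          (K (invWt C j) * K (invWt C i)) • DL C (sft i s) (obstr hS (sft j t)) := by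
        intro s t
        rw [map_sum]
        refine Finset.sum_congr rfl fun j _ => ?_
        rw [map_smul, d_gl_eq C (hQ _), Finset.smul_sum]
        simp only [smul_smul]
      rw [e, e, Finset.sum_comm, Finset.smul_sum, ← Finset.sum_sub_distrib]
      refine (Fil k).sum_mem fun i _ => ?_
      rw [Finset.smul_sum, ← Finset.sum_sub_distrib]
      refine (Fil k).sum_mem fun j _ => ?_
      rw [mul_comm, smul_comm (eps _ _ : Hb), ← smul_sub]
      have := DL_obstr hS (sft i s) (sft j t)
      rw [isRight_sft, isRight_sft] at this
      exact (Fil k).smul_mem _ this)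
    (fun a ha s => by
      rw [map_sum]
      exact Finset.sum_eq_zero fun j _ => by rw [map_smul, d_obstr hS ha, smul_zero])
  -- Applying the Toeplitz system again recovers the obstruction; the common cutoff `max N Q` covers
  -- the letters of `δ` and the support of the obstruction.
  have key : ∀ s, DL C s δ - obstr hS s ∈ Fil (k + 1) := by
    intro s
    obtain ⟨N, hN⟩ := exists_LT δ
    have e1 := sum_range_mul_range (Q := max N Q) (fun i => wt C (kind C + i)) (invWt C)
      (sum_antidiagonal_wt C) (e := fun i => obstr hS (sft i s))
      fun q hq => hsft s ((le_max_right _ _).trans hq)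
    rw [sft_zero] at e1
    rw [← e1, DL_eq C (hN.mono (le_max_left N Q)), ← Finset.sum_sub_distrib]
    refine (Fil _).sum_mem fun i _ => ?_
    rw [← smul_sub]
    refine (Fil _).smul_mem _ ?_
    have e2 : ∑ j ∈ Finset.range (max N Q), K (invWt C j) • obstr hS (sft (i + j) s) =
        E (sft i s) := by
      symm
      refine (Finset.sum_subset (Finset.range_mono (le_max_right N Q)) fun j _ hj => ?_).trans
        (Finset.sum_congr rfl fun j _ => by rw [sft_sft])
      rw [hsft _ (not_lt.1 fun h => hj (Finset.mem_range.2 h)), smul_zero]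
    rw [e2]
    exact hδE _
  have hp' : IsHom false (S + δ) := hS.par.add hδ
  refine ⟨S + δ, by rwa [add_sub_cancel_left], hp', (Fil 3).add_mem hS.fil (Fil_mono (by lia) hδF),
    fun a ha => by rw [map_add, hS.bad a ha, hδb a ha, add_zero], fun n hn => ?_, fun n hn => ?_⟩
  · obtain ⟨q, rfl⟩ := exists_modeIdx C hn
    have h1 := G_add C hS.par hp' hS.fil (by lia) hδF (modeIdx C q)
    have h2 := key (.inr q)
    rw [obstr, Sum.elim_inr, DL, Sum.elim_inr, map_neg, map_one, neg_one_smul, sub_neg_eq_add] at h2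
    convert (Fil _).add_mem h1 h2 using 1
    abel
  · obtain ⟨q, rfl⟩ := exists_modeIdx C hn
    have h1 := T_add C hS.par hp' hS.fil (by lia) hδF (modeIdx C q)
    have h2 := key (.inl q)
    rw [obstr, Sum.elim_inl, DL, Sum.elim_inl] at h2
    have e : ∀ y : SF, K (-1 / 2) • y + K (-1 / 2) • y = -y := fun y => by
      rw [← add_smul, ← map_add]
      norm_num
    convert (Fil _).add_mem h1 ((Fil _).add_mem h2 h2) using 1
    rw [show ∀ t v b y : SF, t - (v + (b + b)) + (b - y + (b - y)) = t - v - (y + y) from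
      fun t v b y => by abel, e]
    abel

end Step

/-- A sequence of approximate solutions. -/
lemma exists_good_seq : ∃ S : ℕ → SF, (∀ k, Good C (k + 2) (S k)) ∧
    ∀ k, S (k + 1) - S k ∈ Fil (k + 3) := by
  choose f hf hf' using fun (k : ℕ) (S : {S : SF // Good C (k + 2) S}) =>
    Good.exists_succ S.2 (by lia)
  let F : (k : ℕ) → {S : SF // Good C (k + 2) S} := fun k =>
    Nat.rec ⟨0, good_zero C⟩ (fun k S => ⟨f k S, hf' k S⟩) k
  exact ⟨fun k => (F k).1, fun k => (F k).2, fun k => hf k (F k)⟩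

end

end SuperTR

namespace SuperTR

noncomputable section

open Hb (h K)
open SF

/-! ### Subtuples -/

/-- The entries of `J` with positions in `S`, as a list. -/
def subList {n : ℕ} (J : Fin n → ℤ) (S : Finset (Fin n)) : List ℤ :=
  ((List.finRange n).filter (· ∈ S)).map J

lemma ofFn_sub {n : ℕ} (J : Fin n → ℤ) (S : Finset (Fin n)) :
    List.ofFn (sub J S) = subList J S := by
  have h1 : S.sort = (List.finRange n).filter (· ∈ S) := by
    refine List.Perm.eq_of_pairwise' (r := (· ≤ ·)) (Finset.pairwise_sort _ _)
      ((List.pairwise_le_finRange n).filter _) ?_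
    refine (List.perm_ext_iff_of_nodup (Finset.sort_nodup _ _)
      ((List.nodup_finRange n).filter _)).2 fun a => ?_
    simp
  rw [subList, ← h1, ← Finset.listMap_orderEmbOfFin_finRange S rfl, List.map_map, List.ofFn_eq_map]
  rfl

/-- Positions that are not the first one. -/
def up {n : ℕ} (S : Finset (Fin n)) : Finset (Fin (n + 1)) := S.map (Fin.succEmb n)

lemma succ_mem_up {n : ℕ} {S : Finset (Fin n)} {i : Fin n} : i.succ ∈ up S ↔ i ∈ S := by
  simp [up]

lemma zero_notMem_up {n : ℕ} {S : Finset (Fin n)} : (0 : Fin (n + 1)) ∉ up S := by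
  simp [up, Fin.succ_ne_zero]

lemma compl_up {n : ℕ} (S : Finset (Fin n)) : (up S)ᶜ = insert 0 (up Sᶜ) := by
  ext i
  refine Fin.cases ?_ (fun i => ?_) i
  · simp [zero_notMem_up]
  · simp [succ_mem_up, Fin.succ_ne_zero]

lemma compl_insert_up {n : ℕ} (S : Finset (Fin n)) : (insert 0 (up S))ᶜ = up Sᶜ := by
  rw [← compl_compl (up Sᶜ), compl_up, compl_compl]

lemma sum_finset_fin_succ {n : ℕ} {M : Type*} [AddCommMonoid M] (f : Finset (Fin (n + 1)) → M) :
    ∑ S, f S = ∑ S : Finset (Fin n), f (insert 0 (up S)) + ∑ S : Finset (Fin n), f (up S) := by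
  have e : (Finset.univ : Finset (Finset (Fin (n + 1)))) =
      (Finset.univ.map (Fin.succEmb n)).powerset ∪
        (Finset.univ.map (Fin.succEmb n)).powerset.image (insert 0) := by
    rw [← Finset.powerset_insert, ← Finset.powerset_univ]
    congr 1
    ext i
    refine Fin.cases ?_ (fun i => ?_) i <;> simp
  have h0 : (0 : Fin (n + 1)) ∉ Finset.univ.map (Fin.succEmb n) := by simp [Fin.succ_ne_zero]
  have hp : (Finset.univ.map (Fin.succEmb n)).powerset =
      (Finset.univ : Finset (Finset (Fin n))).map (Finset.mapEmbedding (Fin.succEmb n)).toEmbedding := by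
    ext S
    simp only [Finset.mem_powerset, Finset.mem_map, Finset.mem_univ, true_and]
    constructor
    · intro hS
      obtain ⟨u, _, hu⟩ := Finset.subset_map_iff.1 hS
      exact ⟨u, hu.symm⟩
    · rintro ⟨u, rfl⟩
      exact Finset.map_subset_map.2 (Finset.subset_univ _)
  have := Finset.sum_powerset_insert h0 f
  rw [← Finset.powerset_insert] at e
  rw [e, this, hp, Finset.sum_map, Finset.sum_map, add_comm]
  rfl

lemma subList_insert {n : ℕ} (J : Fin (n + 1) → ℤ) (S : Finset (Fin n)) :
    subList J (insert 0 (up S)) = J 0 :: subList (Fin.tail J) S := by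
  rw [subList, List.finRange_succ, List.filter_cons_of_pos (by simp), List.map_cons,
    List.filter_map, List.map_map, subList]
  congr 2
  refine List.filter_congr fun i _ => ?_
  simp [succ_mem_up, Fin.succ_ne_zero]

lemma subList_up {n : ℕ} (J : Fin (n + 1) → ℤ) (S : Finset (Fin n)) :
    subList J (up S) = subList (Fin.tail J) S := by
  rw [subList, List.finRange_succ, List.filter_cons_of_neg (by simp [zero_notMem_up]),
    List.filter_map, List.map_map, subList]
  congr 2
  funext i
  simp [succ_mem_up]

lemma length_subList {n : ℕ} (J : Fin n → ℤ) (S : Finset (Fin n)) :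
    (subList J S).length = S.card := by
  rw [← ofFn_sub, List.length_ofFn]

lemma shuffleSign_insert {k : ℕ} (T : Finset (Fin k)) :
    shuffleSign (insert 0 (up T)) = shuffleSign T := by
  unfold shuffleSign
  congr 1
  rw [compl_insert_up]
  symm
  refine Finset.card_bij (fun p _ => (p.1.succ, p.2.succ)) ?_ ?_ ?_
  · rintro ⟨i, j⟩ hij
    simpa [succ_mem_up] using hij
  · rintro ⟨i, j⟩ _ ⟨i', j'⟩ _ hh
    simpa using hh
  · rintro ⟨i, j⟩ hij
    simp only [Finset.mem_filter, Finset.mem_product] at hij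
    obtain ⟨⟨hi, hj⟩, hlt⟩ := hij
    have hj0 : j ≠ 0 := fun e => zero_notMem_up (e ▸ hj)
    have hi0 : i ≠ 0 := fun e => by subst e; exact absurd hlt (Fin.not_lt_zero j)
    obtain ⟨i, rfl⟩ := Fin.exists_succ_eq.2 hi0
    obtain ⟨j, rfl⟩ := Fin.exists_succ_eq.2 hj0
    refine ⟨(i, j), ?_, rfl⟩
    simpa [succ_mem_up, Fin.succ_ne_zero] using And.intro (And.intro hi hj) hlt

/-- Position 0 now lies in the complement and forms an inversion with every element of the first
block. -/
lemma shuffleSign_up {k : ℕ} (T : Finset (Fin k)) :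
    shuffleSign (up T) = (-1) ^ T.card * shuffleSign T := by
  unfold shuffleSign
  rw [← pow_add]
  congr 1
  rw [compl_up, Finset.insert_eq, Finset.product_union, Finset.filter_union,
    Finset.card_union_of_disjoint]
  · congr 1
    · rw [Finset.filter_true_of_mem, Finset.card_product, Finset.card_singleton, mul_one, up,
        Finset.card_map]
      rintro ⟨i, j⟩ hij
      simp only [Finset.mem_product, Finset.mem_singleton] at hij
      rw [hij.2]
      refine Fin.pos_iff_ne_zero.2 fun e => zero_notMem_up (S := T) ?_
      rw [← show i = 0 from e]
      exact hij.1
    · symm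
      refine Finset.card_bij (fun p _ => (p.1.succ, p.2.succ)) ?_ ?_ ?_
      · rintro ⟨i, j⟩ hij
        simpa [succ_mem_up] using hij
      · rintro ⟨i, j⟩ _ ⟨i', j'⟩ _ hh
        simpa using hh
      · rintro ⟨i, j⟩ hij
        simp only [Finset.mem_filter, Finset.mem_product] at hij
        obtain ⟨⟨hi, hj⟩, hlt⟩ := hij
        have hj0 : j ≠ 0 := fun e => zero_notMem_up (e ▸ hj)
        have hi0 : i ≠ 0 := fun e => zero_notMem_up (e ▸ hi)
        obtain ⟨i, rfl⟩ := Fin.exists_succ_eq.2 hi0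
        obtain ⟨j, rfl⟩ := Fin.exists_succ_eq.2 hj0
        refine ⟨(i, j), ?_, rfl⟩
        simpa [succ_mem_up] using And.intro (And.intro hi hj) hlt
  · rw [Finset.disjoint_left]
    rintro ⟨i, j⟩ h1 h2
    simp only [Finset.mem_filter, Finset.mem_product, Finset.mem_singleton] at h1 h2
    exact zero_notMem_up (h1.1.2 ▸ h2.1.2)

/-! ### Iterated derivatives at the origin -/

variable (C : LocalSuperSpectralCurve)

/-- Iterated derivatives in the directions of exponents, from left to right. -/
def Dxs (L : List (ℤ ⊕ ℤ)) (y : SF) : SF := L.foldl (fun y e => Dx C e y) y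

lemma Dxs_cons (e : ℤ ⊕ ℤ) (L : List (ℤ ⊕ ℤ)) (y : SF) : Dxs C (e :: L) y = Dxs C L (Dx C e y) := rfl

lemma Dxs_append (L L' : List (ℤ ⊕ ℤ)) (y : SF) : Dxs C (L ++ L') y = Dxs C L' (Dxs C L y) :=
  List.foldl_append

lemma Dxs_add (L : List (ℤ ⊕ ℤ)) (y z : SF) : Dxs C L (y + z) = Dxs C L y + Dxs C L z := by
  induction L generalizing y z with
  | nil => rfl
  | cons e L ih => rw [Dxs_cons, map_add, ih]; rfl

lemma Dxs_smul (L : List (ℤ ⊕ ℤ)) (r : Hb) (y : SF) : Dxs C L (r • y) = r • Dxs C L y := by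
  induction L generalizing y with
  | nil => rfl
  | cons e L ih => rw [Dxs_cons, map_smul, ih]; rfl

lemma Dxs_zero (L : List (ℤ ⊕ ℤ)) : Dxs C L 0 = 0 := by
  simpa using Dxs_smul C L 0 0

lemma Dxs_mem_Fil (L : List (ℤ ⊕ ℤ)) {e : ℕ} {y : SF} (hy : y ∈ Fil e) :
    Dxs C L y ∈ Fil (e - L.length) := by
  induction L generalizing e y with
  | nil => exact hy
  | cons f L ih =>
    rw [Dxs_cons, List.length_cons, Nat.sub_add_eq, Nat.sub_right_comm]
    exact ih (Dx_mem_Fil C hy f)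

/-- The coefficient of `ħ ^ g` of an iterated derivative at the origin. -/
def EV (g : ℕ) (L : List (ℤ ⊕ ℤ)) : SF →+ ℂ where
  toFun y := Hb.coeff g ((Dxs C L y).1 [])
  map_zero' := by rw [Dxs_zero, zero_val, Pi.zero_apply, map_zero]
  map_add' y z := by rw [Dxs_add, add_val, Pi.add_apply, map_add]

lemma EV_apply (g : ℕ) (L : List (ℤ ⊕ ℤ)) (y : SF) : EV C g L y = Hb.coeff g ((Dxs C L y).1 []) := rfl

lemma EV_cons (g : ℕ) (e : ℤ ⊕ ℤ) (L : List (ℤ ⊕ ℤ)) (y : SF) :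
    EV C g (e :: L) y = EV C g L (Dx C e y) := rfl

lemma EV_K_smul (g : ℕ) (L : List (ℤ ⊕ ℤ)) (c : ℂ) (y : SF) : EV C g L (K c • y) = c * EV C g L y := by
  rw [EV_apply, Dxs_smul, smul_val, Pi.smul_apply, smul_eq_mul, Hb.coeff_K_mul, EV_apply]

lemma EV_intCast_smul (g : ℕ) (L : List (ℤ ⊕ ℤ)) (c : ℤ) (y : SF) :
    EV C g L ((c : Hb) • y) = c * EV C g L y := by
  rw [← EV_K_smul, map_intCast]

lemma EV_h_smul (g : ℕ) (L : List (ℤ ⊕ ℤ)) (y : SF) :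
    EV C g L (h • y) = if g = 0 then 0 else EV C (g - 1) L y := by
  rw [EV_apply, Dxs_smul, smul_val, Pi.smul_apply, smul_eq_mul]
  cases g with
  | zero => rw [Hb.coeff_h_mul_zero, if_pos rfl]
  | succ g => rw [Hb.coeff_h_mul_succ, if_neg (Nat.succ_ne_zero g)]; rfl

lemma EV_eq_zero {g : ℕ} {L : List (ℤ ⊕ ℤ)} {e : ℕ} {y : SF} (hy : y ∈ Fil e)
    (he : 2 * g + L.length < e) : EV C g L y = 0 :=
  Dxs_mem_Fil C L hy [] g (by rw [List.length_nil]; lia)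

lemma EV_unit (g : ℕ) (L : List (ℤ ⊕ ℤ)) : EV C g L unit = if g = 0 ∧ L = [] then 1 else 0 := by
  cases L with
  | nil =>
    change Hb.coeff g (one []) = _
    rw [one, if_pos rfl, Hb.coeff_one]
    simp
  | cons e L => rw [EV_cons, Dx_unit, map_zero, if_neg (by simp)]

lemma Dxs_swap (e f : ℤ ⊕ ℤ) (L : List (ℤ ⊕ ℤ)) (y : SF) :
    Dxs C (e :: f :: L) y = (eps e.isRight f.isRight : Hb) • Dxs C (f :: e :: L) y := by
  rw [Dxs_cons, Dxs_cons, Dx_Dx, Dxs_smul, eps_comm]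
  rfl

lemma Dx_twist (e : ℤ ⊕ ℤ) (b : Bool) (y : SF) :
    Dx C e (twist b y) = (eps e.isRight b : Hb) • twist b (Dx C e y) := by
  obtain ⟨N, hN⟩ := exists_LT y
  rw [Dx_eq C hN, Dx_eq C (hN.twist b), map_sum, Finset.smul_sum]
  refine Finset.sum_congr rfl fun i _ => ?_
  by_cases hi : e.isRight = i.isRight
  · have : d i (twist b y) = (eps i.isRight b : Hb) • twist b (d i y) :=
      Subtype.ext (dl_tws i b y.1)
    rw [this, map_smul, smul_comm, hi]
  · rw [cf_eq_zero C hi]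
    simp

lemma Dxs_inl_mul {n : ℕ} (J : Fin n → ℤ) (y z : SF) :
    Dxs C ((List.ofFn J).map .inl) (mul y z) = ∑ S : Finset (Fin n),
      mul (Dxs C ((subList J S).map .inl) y) (Dxs C ((subList J Sᶜ).map .inl) z) := by
  induction n generalizing y z with
  | zero =>
    rw [Fintype.sum_unique]
    simp [Dxs, subList]
  | succ n ih =>
    rw [List.ofFn_succ, List.map_cons, Dxs_cons, Dx_mul, Dxs_add]
    change Dxs C ((List.ofFn (Fin.tail J)).map _) _ + Dxs C ((List.ofFn (Fin.tail J)).map _) _ = _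
    rw [ih, ih, sum_finset_fin_succ]
    simp only [compl_up, compl_insert_up, subList_insert, subList_up]
    rfl

lemma Dxs_twist_nil (L : List ℤ) (y : SF) :
    (Dxs C (L.map .inr) (twist true y)).1 [] = (-1) ^ L.length * (Dxs C (L.map .inr) y).1 [] := by
  induction L generalizing y with
  | nil =>
    change tw y.1 [] = _
    simp [tw, Dxs]
  | cons b L ih =>
    rw [List.map_cons, Dxs_cons, Dx_twist, Dxs_smul, smul_val, Pi.smul_apply, ih, Dxs_cons]
    simp [eps, pow_succ]

/-- Each odd derivative that falls on the second factor twists the first one; at the origin this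
gives one sign per odd derivative still to act on it, which is `shuffleSign_up`. -/
lemma Dxs_inr_mul {k : ℕ} (J : Fin k → ℤ) (y z : SF) :
    (Dxs C ((List.ofFn J).map .inr) (mul y z)).1 [] = ∑ T : Finset (Fin k), K (shuffleSign T) *
      ((Dxs C ((subList J T).map .inr) y).1 [] * (Dxs C ((subList J Tᶜ).map .inr) z).1 []) := by
  induction k generalizing y z with
  | zero =>
    rw [Fintype.sum_unique]
    rw [shuffleSign, Finset.eq_empty_of_isEmpty (Finset.filter _ _), Finset.card_empty, pow_zero,
      map_one, one_mul]
    rfl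
  | succ n ih =>
    rw [List.ofFn_succ, List.map_cons, Dxs_cons, Dx_mul, Dxs_add, add_val, Pi.add_apply]
    change (Dxs C ((List.ofFn (Fin.tail J)).map _) _).1 [] +
      (Dxs C ((List.ofFn (Fin.tail J)).map _) _).1 [] = _
    rw [ih, ih, sum_finset_fin_succ]
    simp only [compl_up, compl_insert_up, subList_insert, subList_up, shuffleSign_insert,
      shuffleSign_up]
    refine congrArg₂ (· + ·) (Finset.sum_congr rfl fun T _ => by rw [List.map_cons, Dxs_cons])
      (Finset.sum_congr rfl fun T _ => ?_)
    change _ * ((Dxs C _ (twist true y)).1 [] * _) = _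
    rw [Dxs_twist_nil, length_subList, map_mul, map_pow, map_neg, map_one, List.map_cons, Dxs_cons]
    ring

/-- The exponents of bosonic and fermionic variables. -/
def exps {n k : ℕ} (J : Fin n → ℤ) (K : Fin k → ℤ) : List (ℤ ⊕ ℤ) :=
  (List.ofFn J).map .inl ++ (List.ofFn K).map .inr

lemma length_exps {n k : ℕ} (J : Fin n → ℤ) (K : Fin k → ℤ) : (exps J K).length = n + k := by
  simp [exps]

/-- The product rule for iterated derivatives. -/
lemma EV_mul (g : ℕ) {n k : ℕ} (J : Fin n → ℤ) (K : Fin k → ℤ) (y z : SF) :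
    EV C g (exps J K) (mul y z) = ∑ p ∈ Finset.HasAntidiagonal.antidiagonal g,
      ∑ S : Finset (Fin n), ∑ T : Finset (Fin k), shuffleSign T *
        (EV C p.1 (exps (sub J S) (sub K T)) y * EV C p.2 (exps (sub J Sᶜ) (sub K Tᶜ)) z) := by
  have h1 : ∀ s : Finset (Finset (Fin n)), ∀ f : Finset (Fin n) → SF,
      (Dxs C ((List.ofFn K).map .inr) (∑ S ∈ s, f S)).1 [] =
      ∑ S ∈ s, (Dxs C ((List.ofFn K).map .inr) (f S)).1 [] := by
    intro s f
    classical
    induction s using Finset.induction_on with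
    | empty => rw [Finset.sum_empty, Finset.sum_empty, Dxs_zero]; rfl
    | insert a s ha ih =>
      rw [Finset.sum_insert ha, Finset.sum_insert ha, Dxs_add, add_val, Pi.add_apply, ih]
  rw [EV_apply, exps, Dxs_append, Dxs_inl_mul, h1, map_sum, Finset.sum_comm]
  refine Finset.sum_congr rfl fun S _ => ?_
  rw [Dxs_inr_mul, map_sum, Finset.sum_comm]
  refine Finset.sum_congr rfl fun T _ => ?_
  rw [Hb.coeff_K_mul, Hb.coeff_mul, Finset.mul_sum]
  refine Finset.sum_congr rfl fun p _ => ?_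
  rw [EV_apply, EV_apply, exps, exps, ofFn_sub, ofFn_sub, ofFn_sub, ofFn_sub, Dxs_append,
    Dxs_append]

lemma exps_cons {n k : ℕ} (a : ℤ) (J : Fin n → ℤ) (K : Fin k → ℤ) :
    exps (Fin.cons a J) K = .inl a :: exps J K := by
  rw [exps, List.ofFn_cons]
  rfl

/-- The first fermionic derivative moves past the bosonic ones without a sign. -/
lemma EV_exps_cons_right (g : ℕ) {n k : ℕ} (J : Fin n → ℤ) (b : ℤ) (K : Fin k → ℤ) (y : SF) :
    EV C g (exps J (Fin.cons b K)) y = EV C g (exps J K) (Dx C (.inr b) y) := by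
  have : ∀ (L : List ℤ) (y : SF), Dxs C (L.map .inl) (Dx C (.inr b) y) =
      Dx C (.inr b) (Dxs C (L.map .inl) y) := by
    intro L
    induction L with
    | nil => intro y; rfl
    | cons a L ih =>
      intro y
      rw [List.map_cons, Dxs_cons, Dxs_cons, ← ih, Dx_Dx]
      simp [eps]
  rw [EV_apply, EV_apply, exps, exps, List.ofFn_cons, List.map_cons, Dxs_append, Dxs_append,
    Dxs_cons, this]

end

end SuperTR

namespace SuperTR

noncomputable section

open Hb (h K)
open SF

/-! ### Laurent series -/

lemma ser_coeff {f : ℤ → ℂ} {M : ℤ} (hf : ∀ a < M, f a = 0) (a : ℤ) : (ser f).coeff a = f a := by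
  have : BddBelow (Function.support f) := ⟨M, fun a ha => not_lt.1 fun hlt => ha (hf a hlt)⟩
  rw [ser, dif_pos this, HahnSeries.coeff_ofSuppBddBelow]

lemma exists_mem_orderGE (f : LaurentSeries ℂ) : ∃ M, f ∈ orderGE M :=
  ⟨f.order, fun _ ha => HahnSeries.coeff_eq_zero_of_lt_order ha⟩

lemma σB_coeff (f : LaurentSeries ℂ) (a : ℤ) : (σB f).coeff a = (-1) ^ (a + 1) * f.coeff a := by
  obtain ⟨M, hM⟩ := exists_mem_orderGE f
  exact ser_coeff (M := M) (fun a ha => by rw [hM a ha, mul_zero]) a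

lemma σF_coeff (f : LaurentSeries ℂ) (a : ℤ) : (σF f).coeff a = (-1) ^ a * f.coeff a := by
  obtain ⟨M, hM⟩ := exists_mem_orderGE f
  exact ser_coeff (M := M) (fun a ha => by rw [hM a ha, mul_zero]) a

lemma D_coeff (f : LaurentSeries ℂ) (a : ℤ) : (D f).coeff a = (a + 1) * f.coeff (a + 1) := by
  rw [D, LaurentSeries.derivative_apply, LaurentSeries.hasseDeriv_coeff]
  simp

lemma Z_mul_coeff (f : LaurentSeries ℂ) (a : ℤ) : (Z * f).coeff a = f.coeff (a - 1) := by
  have := HahnSeries.coeff_single_mul_add (r := (1 : ℂ)) (x := f) (a := a - 1) (b := 1)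
  rwa [sub_add_cancel, one_mul] at this

lemma Z_mul_D_coeff (f : LaurentSeries ℂ) (a : ℤ) : (Z * D f).coeff a = a * f.coeff a := by
  rw [Z_mul_coeff, D_coeff, sub_add_cancel]
  push_cast
  ring

lemma coeff_mul_eq_sum {f k : LaurentSeries ℂ} {M N : ℤ} (hf : f ∈ orderGE M) (hk : k ∈ orderGE N)
    (c : ℤ) : (f * k).coeff c = ∑ a ∈ Finset.Icc M (c - N), f.coeff a * k.coeff (c - a) := by
  rw [HahnSeries.coeff_mul]
  refine Finset.sum_bij_ne_zero (fun p _ _ => p.1) ?_ ?_ ?_ ?_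
  · rintro ⟨a, b⟩ h1 _
    rw [Finset.mem_antidiagonal] at h1
    obtain ⟨ha, hb, hab⟩ := h1
    rw [Finset.mem_Icc]
    refine ⟨not_lt.1 fun hlt => ha (hf a hlt), ?_⟩
    have : N ≤ b := not_lt.1 fun hlt => hb (hk b hlt)
    simp only at hab ⊢
    lia
  · rintro ⟨a, b⟩ h1 _ ⟨a', b'⟩ h2 _ rfl
    rw [Finset.mem_antidiagonal] at h1 h2
    have e1 := h1.2.2
    have e2 := h2.2.2
    simp only at e1 e2
    rw [Prod.mk.injEq]
    exact ⟨rfl, by lia⟩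
  · intro a _ hne
    refine ⟨(a, c - a), ?_, hne, rfl⟩
    rw [Finset.mem_antidiagonal]
    exact ⟨left_ne_zero_of_mul hne, right_ne_zero_of_mul hne, by simp⟩
  · rintro ⟨a, b⟩ h1 _
    rw [Finset.mem_antidiagonal] at h1
    have e1 := h1.2.2
    simp only at e1 ⊢
    rw [show c - a = b by lia]

/-! ### The correlators of an approximate solution -/

variable (C : LocalSuperSpectralCurve)

/-- The unstable correlators, at a list of exponents. -/
def unst (g : ℕ) : List (ℤ ⊕ ℤ) → ℂ
  | [e] => if g = 0 then bg C e else 0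
  | [e, f] => if g = 0 then contr C f e else 0
  | _ => 0

lemma EV_nil_x (g : ℕ) (a : Letter) : EV C g [] (x a) = 0 := by
  change Hb.coeff g (var a []) = 0
  rw [var, if_neg (by simp), map_zero]

/-- The source is the field whose iterated derivatives at the origin are the unstable correlators.
-/
lemma unst_cons (g : ℕ) (e : ℤ ⊕ ℤ) (L : List (ℤ ⊕ ℤ)) :
    unst C g (e :: L) = EV C g L (source C e) := by
  rcases L with _ | ⟨f, L⟩
  · rw [unst]
    rcases e with a | b
    · rw [source, map_add, EV_K_smul, EV_unit]
      have : EV C g [] (if 0 ≤ a then K ((a : ℂ) + 1) • x (.inl a.toNat) else 0) = 0 := by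
        split_ifs
        · rw [EV_K_smul, EV_nil_x, mul_zero]
        · exact map_zero _
      rw [this]
      simp [bg]
    · rw [source, map_add, EV_K_smul, EV_nil_x]
      have : EV C g [] (if 0 ≤ b then x (.inr (b + 1).toNat) else 0) = 0 := by
        split_ifs
        · rw [EV_nil_x]
        · exact map_zero _
      rw [this]
      simp [bg]
  · rw [EV_cons, Dx_source, EV_K_smul, EV_unit]
    rcases L with _ | ⟨e', L⟩
    · simp [unst]
    · simp [unst]

/-- The correlators of a sequence of approximate solutions. -/
def corr (S : ℕ → SF) : Correlators := fun g n k J K =>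
  EV C g (exps J K) (S (2 * g + n + k)) + unst C g (exps J K)

variable {C} {S : ℕ → SF} (hS' : ∀ k, S (k + 1) - S k ∈ Fil (k + 3))

include hS' in
-- Later corrections have too high a degree to be seen. No limit of the sequence is formed: each
-- correlator is read off from an approximation, and any later one gives the same value.
lemma EV_stable {g D : ℕ} {L : List (ℤ ⊕ ℤ)} (hD : 2 * g + L.length ≤ D) :
    EV C g L (S D) = EV C g L (S (2 * g + L.length)) := by
  induction D, hD using Nat.le_induction with
  | base => rfl
  | succ D hD ih =>
    rw [← ih, ← sub_eq_zero, ← map_sub]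
    exact EV_eq_zero C (hS' D) (by lia)

include hS' in
-- Correlators with a distinguished entry, stable or not, are derivatives of one field; the freedom
-- in `D` allows a single approximation to serve all factors of a product.
lemma corr_cons_left {g n k D : ℕ} (hD : 2 * g + n + k + 1 ≤ D) (a : ℤ) (J : Fin n → ℤ)
    (K : Fin k → ℤ) : corr C S g (n + 1) k (Fin.cons a J) K =
      EV C g (exps J K) (field C (S D) (.inl a)) := by
  have h1 := EV_stable hS' (C := C) (g := g) (D := D) (L := exps (Fin.cons a J) K)
    (by rw [length_exps]; lia)
  rw [length_exps, ← add_assoc] at h1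
  rw [corr, ← h1, exps_cons, EV_cons, unst_cons, ← map_add]
  rfl

include hS' in
lemma corr_cons_right {g n k D : ℕ} (hD : 2 * g + n + k + 1 ≤ D) (b : ℤ) (J : Fin n → ℤ)
    (K : Fin k → ℤ) : corr C S g n (k + 1) J (Fin.cons b K) =
      EV C g (exps J K) (field C (S D) (.inr b)) := by
  have h1 := EV_stable hS' (C := C) (g := g) (D := D) (L := exps J (Fin.cons b K))
    (by rw [length_exps]; lia)
  rw [length_exps, ← add_assoc] at h1
  have h2 : unst C g (exps J (Fin.cons b K)) = EV C g (exps J K) (source C (.inr b)) := by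
    rcases n with _ | n
    · rw [← unst_cons]
      simp [exps]
    · obtain ⟨a, J, rfl⟩ : ∃ a J', J = Fin.cons a J' := ⟨J 0, Fin.tail J, (Fin.cons_self_tail J).symm⟩
      rw [exps_cons, exps_cons, unst_cons, EV_exps_cons_right, Dx_source, EV_cons, Dx_source]
      simp [contr]
  rw [corr, ← h1, EV_exps_cons_right, h2, ← map_add]
  rfl

lemma corr_eq {g n k : ℕ} (hgn : 2 < 2 * g + n + k) (J : Fin n → ℤ) (K : Fin k → ℤ) :
    corr C S g n k J K = EV C g (exps J K) (S (2 * g + n + k)) := by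
  have hl := length_exps J K
  rw [corr, add_eq_left]
  match hL : exps J K with
  | [] => rfl
  | [e] =>
    rw [hL, List.length_singleton] at hl
    exact if_neg (by lia)
  | [e, f] =>
    rw [hL, List.length_cons, List.length_singleton] at hl
    exact if_neg (by lia)
  | _ :: _ :: _ :: _ => rfl

/-! ### Vanishing of the σ-even polar part of the fields -/

section Fields

variable {k : ℕ} {T : SF} (hT : Good C k T)

include hT

lemma Good.Dx_inl_odd {a : ℤ} (ha : Odd a) (ha' : a < 0) : Dx C (.inl a) T = 0 := by
  -- The exponent -1 belongs to no letter: no form dξ_{-l} has a residue.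
  by_cases h1 : a = -1
  · subst h1
    obtain ⟨N, hN⟩ := exists_LT T
    rw [Dx_eq C hN]
    refine Finset.sum_eq_zero fun i _ => ?_
    have : cf C (.inl (-1)) i = 0 := by
      rcases i with i | i
      · rw [cf, dξNeg_coeff, if_neg (by lia), if_neg (by lia), add_zero]
      · rfl
    rw [this, map_zero, zero_smul]
  · obtain ⟨l, rfl⟩ : ∃ l : ℕ, a = -(l : ℤ) - 2 := ⟨(-a - 2).toNat, by lia⟩
    rw [Dx_inl_neg]
    refine hT.bad _ ?_
    rw [Letter.idx, Sum.elim_inl, id, Nat.odd_iff]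
    rw [Int.odd_iff] at ha
    lia

lemma Good.Dx_inr_even {b : ℤ} (hb : Even b) (hb' : b < 0) : Dx C (.inr b) T = 0 := by
  rw [Int.even_iff] at hb
  obtain ⟨l, rfl⟩ : ∃ l : ℕ, b = -(l : ℤ) - 2 := ⟨(-b - 2).toNat, by lia⟩
  rw [Dx_inr_neg]
  refine hT.bad _ ?_
  rw [Letter.idx, Sum.elim_inr, id, Nat.odd_iff]
  lia

lemma Good.field_inl_odd {a : ℤ} (ha : Odd a) (ha' : a < 0) : field C T (.inl a) = 0 := by
  rw [field, hT.Dx_inl_odd ha ha', source_inl_neg C ha', add_zero]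

lemma Good.field_inr_even {b : ℤ} (hb : Even b) (hb' : b < 0) : field C T (.inr b) = 0 := by
  rw [field, hT.Dx_inr_even hb hb', source_inr_neg C (by rw [Int.even_iff] at hb; lia), add_zero]

end Fields

/-- By the product rule `EV_mul`, the sum over all splittings is one iterated derivative of a
product of fields. -/
lemma splitSum_coeff {g n k : ℕ} {J : Fin n → ℤ} {K : Fin k → ℤ}
    {P : (g₁ : ℕ) → {n₁ k₁ : ℕ} → (Fin n₁ → ℤ) → (Fin k₁ → ℤ) →
      (g₂ : ℕ) → {n₂ k₂ : ℕ} → (Fin n₂ → ℤ) → (Fin k₂ → ℤ) → LaurentSeries ℂ} {c : ℤ}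
    (I : Finset ℤ) (r : ℤ → ℂ) (X Y : ℤ → SF)
    (hP : ∀ p ∈ Finset.HasAntidiagonal.antidiagonal g, ∀ (A : Finset (Fin n)) (B : Finset (Fin k)),
      (P p.1 (sub J A) (sub K B) p.2 (sub J Aᶜ) (sub K Bᶜ)).coeff c =
        ∑ a ∈ I, r a * (EV C p.1 (exps (sub J A) (sub K B)) (X a) *
          EV C p.2 (exps (sub J Aᶜ) (sub K Bᶜ)) (Y a))) :
    (splitSum g J K P).coeff c = ∑ a ∈ I, r a * EV C g (exps J K) (mul (X a) (Y a)) := by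
  simp only [EV_mul, Finset.mul_sum]
  rw [splitSum, HahnSeries.coeff_sum, Finset.sum_comm]
  refine Finset.sum_congr rfl fun p hp => ?_
  rw [HahnSeries.coeff_sum, Finset.sum_comm]
  refine Finset.sum_congr rfl fun A _ => ?_
  rw [HahnSeries.coeff_sum, Finset.sum_comm]
  refine Finset.sum_congr rfl fun B _ => ?_
  rw [HahnSeries.coeff_smul, hP p hp, smul_eq_mul, Finset.mul_sum]
  refine Finset.sum_congr rfl fun a _ => ?_
  ring

/-! ### Coefficients of the one-variable series and of their split sums -/

section Coefficients

variable {D N g n k : ℕ} (hN : LT N (S D))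

include hS' hN

lemma bos_corr_coeff (hD : 2 * g + n + k + 1 ≤ D) (J : Fin n → ℤ) (K : Fin k → ℤ) (a : ℤ) :
    (bos (corr C S) g J K).coeff a = EV C g (exps J K) (field C (S D) (.inl a)) := by
  unfold bos
  rw [ser_coeff (M := -(N : ℤ) - 2), corr_cons_left hS' hD]
  intro a ha
  rw [corr_cons_left hS' hD, field_eq_zero_of_LT C hN (by simpa using ha), map_zero]

lemma fer_corr_coeff (hD : 2 * g + n + k + 1 ≤ D) (J : Fin n → ℤ) (K : Fin k → ℤ) (b : ℤ) :
    (fer (corr C S) g J K).coeff b = EV C g (exps J K) (field C (S D) (.inr b)) := by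
  unfold fer
  rw [ser_coeff (M := -(N : ℤ) - 2), corr_cons_right hS' hD]
  intro a ha
  rw [corr_cons_right hS' hD, field_eq_zero_of_LT C hN (by simpa using ha), map_zero]

lemma bos_corr_mem (hD : 2 * g + n + k + 1 ≤ D) (J : Fin n → ℤ) (K : Fin k → ℤ) :
    bos (corr C S) g J K ∈ orderGE (-(N : ℤ) - 2) := fun a ha => by
  rw [bos_corr_coeff hS' hN hD, field_eq_zero_of_LT C hN (by simpa using ha), map_zero]

lemma fer_corr_mem (hD : 2 * g + n + k + 1 ≤ D) (J : Fin n → ℤ) (K : Fin k → ℤ) :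
    fer (corr C S) g J K ∈ orderGE (-(N : ℤ) - 2) := fun a ha => by
  rw [fer_corr_coeff hS' hN hD, field_eq_zero_of_LT C hN (by simpa using ha), map_zero]

end Coefficients

lemma σB_mem {f : LaurentSeries ℂ} {M : ℤ} (hf : f ∈ orderGE M) : σB f ∈ orderGE M :=
  fun a ha => by rw [σB_coeff, hf a ha, mul_zero]

lemma σF_mem {f : LaurentSeries ℂ} {M : ℤ} (hf : f ∈ orderGE M) : σF f ∈ orderGE M :=
  fun a ha => by rw [σF_coeff, hf a ha, mul_zero]

lemma Z_mul_D_mem {f : LaurentSeries ℂ} {M : ℤ} (hf : f ∈ orderGE M) : Z * D f ∈ orderGE M :=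
  fun a ha => by rw [Z_mul_D_coeff, hf a ha, mul_zero]

section Split

variable {D N g n k : ℕ} (hN : LT N (S D)) (hD : 2 * g + n + k + 1 ≤ D) (J : Fin n → ℤ)
  (K : Fin k → ℤ) (c : ℤ)

lemma split_bound {g D n k : ℕ} (hD : 2 * g + n + k + 1 ≤ D) {p : ℕ × ℕ}
    (hp : p ∈ Finset.HasAntidiagonal.antidiagonal g) (A : Finset (Fin n)) (B : Finset (Fin k)) :
    2 * p.1 + A.card + B.card + 1 ≤ D ∧ 2 * p.2 + Aᶜ.card + Bᶜ.card + 1 ≤ D := by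
  rw [Finset.HasAntidiagonal.mem_antidiagonal] at hp
  have h1 := Finset.card_le_univ A
  have h2 := Finset.card_le_univ B
  have h3 := Finset.card_le_univ Aᶜ
  have h4 := Finset.card_le_univ Bᶜ
  rw [Fintype.card_fin] at h1 h2 h3 h4
  constructor <;> lia

include hS' hN hD

lemma splitSum_BF : (splitSum g J K fun g₁ _ _ J₁ K₁ g₂ _ _ J₂ K₂ =>
      bos (corr C S) g₁ J₁ K₁ * σF (fer (corr C S) g₂ J₂ K₂)).coeff c =
    ∑ a ∈ Finset.Icc (-(N : ℤ) - 2) (c - (-(N : ℤ) - 2)), (-1) ^ (c - a) *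
      EV C g (exps J K) (mul (field C (S D) (.inl a)) (field C (S D) (.inr (c - a)))) := by
  refine splitSum_coeff _ _ (fun a => field C (S D) (.inl a)) (fun a => field C (S D) (.inr (c - a)))
    fun p hp A B => ?_
  obtain ⟨h1, h2⟩ := split_bound hD hp A B
  rw [coeff_mul_eq_sum (bos_corr_mem hS' hN h1 _ _) (σF_mem (fer_corr_mem hS' hN h2 _ _))]
  refine Finset.sum_congr rfl fun a _ => ?_
  rw [σF_coeff, bos_corr_coeff hS' hN h1, fer_corr_coeff hS' hN h2]
  ring

lemma splitSum_BF' : (splitSum g J K fun g₁ _ _ J₁ K₁ g₂ _ _ J₂ K₂ =>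
      σB (bos (corr C S) g₁ J₁ K₁) * fer (corr C S) g₂ J₂ K₂).coeff c =
    ∑ a ∈ Finset.Icc (-(N : ℤ) - 2) (c - (-(N : ℤ) - 2)), (-1) ^ (a + 1) *
      EV C g (exps J K) (mul (field C (S D) (.inl a)) (field C (S D) (.inr (c - a)))) := by
  refine splitSum_coeff _ _ (fun a => field C (S D) (.inl a)) (fun a => field C (S D) (.inr (c - a)))
    fun p hp A B => ?_
  obtain ⟨h1, h2⟩ := split_bound hD hp A B
  rw [coeff_mul_eq_sum (σB_mem (bos_corr_mem hS' hN h1 _ _)) (fer_corr_mem hS' hN h2 _ _)]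
  refine Finset.sum_congr rfl fun a _ => ?_
  rw [σB_coeff, bos_corr_coeff hS' hN h1, fer_corr_coeff hS' hN h2]
  ring

lemma splitSum_BB : (splitSum g J K fun g₁ _ _ J₁ K₁ g₂ _ _ J₂ K₂ =>
      bos (corr C S) g₁ J₁ K₁ * σB (bos (corr C S) g₂ J₂ K₂)).coeff c =
    ∑ a ∈ Finset.Icc (-(N : ℤ) - 2) (c - (-(N : ℤ) - 2)), (-1) ^ (c - a + 1) *
      EV C g (exps J K) (mul (field C (S D) (.inl a)) (field C (S D) (.inl (c - a)))) := by
  refine splitSum_coeff _ _ (fun a => field C (S D) (.inl a)) (fun a => field C (S D) (.inl (c - a)))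
    fun p hp A B => ?_
  obtain ⟨h1, h2⟩ := split_bound hD hp A B
  rw [coeff_mul_eq_sum (bos_corr_mem hS' hN h1 _ _) (σB_mem (bos_corr_mem hS' hN h2 _ _))]
  refine Finset.sum_congr rfl fun a _ => ?_
  rw [σB_coeff, bos_corr_coeff hS' hN h1, bos_corr_coeff hS' hN h2]
  ring

lemma splitSum_FF : (splitSum g J K fun g₁ _ _ J₁ K₁ g₂ _ _ J₂ K₂ =>
      Z * (SuperTR.D (fer (corr C S) g₁ J₁ K₁) * σF (fer (corr C S) g₂ J₂ K₂))).coeff c =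
    ∑ a ∈ Finset.Icc (-(N : ℤ) - 2) (c - (-(N : ℤ) - 2)), (a * (-1) ^ (c - a)) *
      EV C g (exps J K) (mul (field C (S D) (.inr a)) (field C (S D) (.inr (c - a)))) := by
  refine splitSum_coeff _ _ (fun a => field C (S D) (.inr a)) (fun a => field C (S D) (.inr (c - a)))
    fun p hp A B => ?_
  obtain ⟨h1, h2⟩ := split_bound hD hp A B
  rw [← _root_.mul_assoc, coeff_mul_eq_sum (Z_mul_D_mem (fer_corr_mem hS' hN h1 _ _))
    (σF_mem (fer_corr_mem hS' hN h2 _ _))]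
  refine Finset.sum_congr rfl fun a _ => ?_
  rw [Z_mul_D_coeff, σF_coeff, fer_corr_coeff hS' hN h1, fer_corr_coeff hS' hN h2]
  ring

lemma splitSum_FF' : (splitSum g J K fun g₁ _ _ J₁ K₁ g₂ _ _ J₂ K₂ =>
      Z * (SuperTR.D (σF (fer (corr C S) g₁ J₁ K₁)) * fer (corr C S) g₂ J₂ K₂)).coeff c =
    ∑ a ∈ Finset.Icc (-(N : ℤ) - 2) (c - (-(N : ℤ) - 2)), (a * (-1) ^ a) *
      EV C g (exps J K) (mul (field C (S D) (.inr a)) (field C (S D) (.inr (c - a)))) := by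
  refine splitSum_coeff _ _ (fun a => field C (S D) (.inr a)) (fun a => field C (S D) (.inr (c - a)))
    fun p hp A B => ?_
  obtain ⟨h1, h2⟩ := split_bound hD hp A B
  rw [← _root_.mul_assoc, coeff_mul_eq_sum (Z_mul_D_mem (σF_mem (fer_corr_mem hS' hN h1 _ _)))
    (fer_corr_mem hS' hN h2 _ _)]
  refine Finset.sum_congr rfl fun a _ => ?_
  rw [Z_mul_D_coeff, σF_coeff, fer_corr_coeff hS' hN h1, fer_corr_coeff hS' hN h2]
  ring

end Split

end

end SuperTR

namespace SuperTR

noncomputable section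

open Hb (h K)
open SF

variable {C : LocalSuperSpectralCurve}

/-! ### The quantities 𝓠 as values of products of field operators -/

lemma finsum_comp_of_injective {f : ℤ → ℂ} {φ : ℤ → ℤ} (hφ : Function.Injective φ)
    (hf : ∀ a, a ∉ Set.range φ → f a = 0) : ∑ᶠ a, f a = ∑ᶠ i, f (φ i) := by
  rw [← finsum_mem_range hφ, ← finsum_mem_univ]
  exact finsum_mem_inter_support_eq' _ _ _ fun a ha =>
    ⟨fun _ => by_contra fun hr => ha (hf a hr), fun _ => trivial⟩

lemma sum_eq_finsum {f : ℤ → ℂ} {I : Finset ℤ} (hf : ∀ a, a ∉ I → f a = 0) :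
    ∑ a ∈ I, f a = ∑ᶠ a, f a :=
  (finsum_eq_sum_of_support_subset f fun a ha => by
    by_contra hI
    exact ha (hf a hI)).symm

/-- For odd `c` the sign changes under a ↦ c - a while `F` does not: the bosonic quadratic quantity
has no odd coefficients. -/
lemma sum_reflect_eq_zero {F : ℤ → ℂ} {c M : ℤ} (hc : Odd c) (hF : ∀ a, F (c - a) = F a) :
    ∑ a ∈ Finset.Icc M (c - M), (-1) ^ (c - a + 1) * F a = 0 := by
  have e : ∑ a ∈ Finset.Icc M (c - M), (-1) ^ (c - a + 1) * F a =
      ∑ a ∈ Finset.Icc M (c - M), -((-1) ^ (c - a + 1) * F a) := by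
    refine Finset.sum_nbij' (fun a => c - a) (fun a => c - a) ?_ ?_ ?_ ?_ ?_
    · intro a ha; rw [Finset.mem_Icc] at ha ⊢; lia
    · intro a ha; rw [Finset.mem_Icc] at ha ⊢; lia
    · intro a _; ring
    · intro a _; ring
    · intro a _
      rw [hF, ← neg_mul]
      congr 1
      rw [Int.odd_iff] at hc
      rcases Int.even_or_odd a with ha | ha
      · rw [Int.even_iff] at ha
        rw [Even.neg_one_zpow (by rw [Int.even_iff]; lia), Odd.neg_one_zpow (by rw [Int.odd_iff]; lia),
          neg_neg]
      · rw [Int.odd_iff] at ha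
        rw [Odd.neg_one_zpow (by rw [Int.odd_iff]; lia), Even.neg_one_zpow (by rw [Int.even_iff]; lia)]
  rw [Finset.sum_neg_distrib] at e
  exact self_eq_neg.1 e

/-- The derivative of a field is supersymmetric in both exponents up to the difference of the two
expansions of the two-point function. -/
lemma Dx_field {T : SF} (e f : ℤ ⊕ ℤ) :
    Dx C e (field C T f) = (eps e.isRight f.isRight : Hb) • Dx C f (field C T e) +
      K (contr C e f - eps e.isRight f.isRight * contr C f e) • unit := by
  rw [field, field, map_add, map_add, Dx_source, Dx_source, Dx_Dx, smul_add, map_sub, map_mul,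
    sub_smul, mul_smul]
  have : K (eps e.isRight f.isRight) = (eps e.isRight f.isRight : Hb) := by
    unfold eps; split_ifs <;> simp
  rw [this]
  abel

lemma Dx_field_of_LT {T : SF} {N : ℕ} (hN : LT N T) {e : ℤ ⊕ ℤ} (f : ℤ ⊕ ℤ)
    (he : e.elim id id < -(N : ℤ) - 2) : Dx C e (field C T f) = K (contr C e f) • unit := by
  rw [field, map_add, Dx_source, Dx_Dx, Dx_eq_zero_of_LT C hN he, map_zero, smul_zero, zero_add]

section Coefficients

variable {S : ℕ → SF} (hS' : ∀ k, S (k + 1) - S k ∈ Fil (k + 3)) {D N g n k : ℕ}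
  (hN : LT N (S D)) (hD : 2 * g + n + k + 1 ≤ D) (J : Fin n → ℤ) (L : Fin k → ℤ) (c : ℤ)

include hS' hN hD

/-- The genus g - 1 term is the part ħ∂ of `Op`, and the splittings are its multiplication part. No
reordering constant arises, as bosons and fermions have no contraction. -/
lemma QFB_corr_coeff : (QFB (corr C S) g J L).coeff c =
    ∑ a ∈ Finset.Icc (-(N : ℤ) - 2) (c - (-(N : ℤ) - 2)), ((-1) ^ (c - a) + (-1) ^ (a + 1)) *
      EV C g (exps J L) (Op C (S D) (.inl a) (field C (S D) (.inr (c - a)))) := by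
  have hDx : ∀ a b : ℤ, Dx C (.inl a) (field C (S D) (.inr b)) =
      Dx C (.inr b) (field C (S D) (.inl a)) := fun a b => by
    rw [Dx_field]
    simp [eps, contr]
  have hgen : (if g = 0 then 0 else
      ser fun c => ∑ᶠ a : ℤ, ((-1 : ℂ) ^ (c - a) + (-1 : ℂ) ^ (a + 1)) *
        corr C S (g - 1) (n + 1) (k + 1) (Fin.cons a J) (Fin.cons (c - a) L) :
        LaurentSeries ℂ).coeff c =
      ∑ a ∈ Finset.Icc (-(N : ℤ) - 2) (c - (-(N : ℤ) - 2)), ((-1) ^ (c - a) + (-1) ^ (a + 1)) *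
        EV C g (exps J L) (h • Dx C (.inl a) (field C (S D) (.inr (c - a)))) := by
    simp only [EV_h_smul]
    split_ifs with hg
    · simp
    have key : ∀ c, (∑ᶠ a : ℤ, ((-1 : ℂ) ^ (c - a) + (-1 : ℂ) ^ (a + 1)) *
        corr C S (g - 1) (n + 1) (k + 1) (Fin.cons a J) (Fin.cons (c - a) L)) =
        ∑ a ∈ Finset.Icc (-(N : ℤ) - 2) (c - (-(N : ℤ) - 2)), ((-1) ^ (c - a) + (-1) ^ (a + 1)) *
        EV C (g - 1) (exps J L) (Dx C (.inl a) (field C (S D) (.inr (c - a)))) := by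
      intro c
      rw [sum_eq_finsum]
      · refine finsum_congr fun a => ?_
        rw [corr_cons_left hS' (D := D) (by lia), EV_exps_cons_right, hDx]
      · intro a ha
        rw [Finset.mem_Icc, not_and_or, not_le, not_le] at ha
        rcases ha with ha | ha
        · rw [Dx_field_of_LT hN _ (by simpa using ha)]
          simp [contr]
        · rw [field_eq_zero_of_LT C hN (by simp only [Sum.elim_inr, id]; lia), map_zero, map_zero,
            mul_zero]
    rw [ser_coeff (M := 2 * (-(N : ℤ) - 2)), key]
    intro c hc
    rw [key, Finset.Icc_eq_empty (by lia), Finset.sum_empty]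
  rw [QFB, HahnSeries.coeff_add, HahnSeries.coeff_add, hgen, splitSum_BF hS' hN hD,
    splitSum_BF' hS' hN hD, ← Finset.sum_add_distrib, ← Finset.sum_add_distrib]
  refine Finset.sum_congr rfl fun a _ => ?_
  rw [Op_apply, map_add]
  ring

variable (hns : EV C g (exps J L) (h • unit) = 0)

omit hS' hN hD in
include hns in
lemma EV_h_K_smul_unit (r : ℂ) : EV C g (exps J L) (h • K r • unit) = 0 := by
  rw [smul_comm, EV_K_smul, hns, mul_zero]

omit hS' hN hD in
include hns in
-- The hypothesis `hns` says that the constant ħ is not seen, which holds except for g = 1 without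
-- further entries; then contractions drop out and the order of the two fields matters only by a
-- sign.
lemma EV_h_Dx_field (T : SF) (e f : ℤ ⊕ ℤ) : EV C g (exps J L) (h • Dx C e (field C T f)) =
    eps e.isRight f.isRight * EV C g (exps J L) (h • Dx C f (field C T e)) := by
  have : (eps e.isRight f.isRight : Hb) = K (eps e.isRight f.isRight) := by
    unfold eps; split_ifs <;> simp
  rw [Dx_field, smul_add, map_add, EV_h_K_smul_unit J L hns, add_zero, this, smul_comm, EV_K_smul]

omit hS' hD in
include hns in
lemma EV_Op_field_eq_zero {e f : ℤ ⊕ ℤ} (hef : e.elim id id < -(N : ℤ) - 2 ∨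
    f.elim id id < -(N : ℤ) - 2) : EV C g (exps J L) (Op C (S D) e (field C (S D) f)) = 0 := by
  rw [Op_apply, map_add]
  rcases hef with he | hf
  · rw [field_eq_zero_of_LT C hN he, Dx_field_of_LT hN f he, EV_h_K_smul_unit J L hns]
    simp
  · rw [field_eq_zero_of_LT C hN hf]
    simp

include hns in
lemma QBB_corr_coeff (hs : ¬ (g = 1 ∧ n = 0 ∧ k = 0)) : (QBB C (corr C S) g J L).coeff c =
    ∑ a ∈ Finset.Icc (-(N : ℤ) - 2) (c - (-(N : ℤ) - 2)), (-1) ^ (c - a + 1) *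
      EV C g (exps J L) (Op C (S D) (.inl a) (field C (S D) (.inl (c - a)))) := by
  have hgen : (if g = 0 then 0 else if g = 1 ∧ n = 0 ∧ k = 0 then w020Diag C else
      ser fun c => ∑ᶠ a : ℤ, (-1 : ℂ) ^ (c - a + 1) *
        corr C S (g - 1) (n + 2) k (Fin.cons a (Fin.cons (c - a) J)) L :
        LaurentSeries ℂ).coeff c =
      ∑ a ∈ Finset.Icc (-(N : ℤ) - 2) (c - (-(N : ℤ) - 2)), (-1) ^ (c - a + 1) *
        EV C g (exps J L) (h • Dx C (.inl a) (field C (S D) (.inl (c - a)))) := by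
    rw [if_neg hs]
    split_ifs with hg
    · simp [EV_h_smul, hg]
    have key : ∀ c, (∑ᶠ a : ℤ, (-1 : ℂ) ^ (c - a + 1) *
        corr C S (g - 1) (n + 2) k (Fin.cons a (Fin.cons (c - a) J)) L) =
        ∑ a ∈ Finset.Icc (-(N : ℤ) - 2) (c - (-(N : ℤ) - 2)), (-1) ^ (c - a + 1) *
        EV C g (exps J L) (h • Dx C (.inl a) (field C (S D) (.inl (c - a)))) := by
      intro c
      rw [sum_eq_finsum]
      · refine finsum_congr fun a => ?_
        rw [corr_cons_left hS' (n := n + 1) (D := D) (by lia), exps_cons, EV_cons,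
          EV_h_Dx_field J L hns, EV_h_smul, if_neg hg]
        simp [eps]
      · intro a ha
        rw [Finset.mem_Icc, not_and_or, not_le, not_le] at ha
        rcases ha with ha | ha
        · rw [Dx_field_of_LT hN _ (by simpa using ha), EV_h_K_smul_unit J L hns, mul_zero]
        · rw [field_eq_zero_of_LT C hN (by simp only [Sum.elim_inl, id]; lia), map_zero, smul_zero,
            map_zero, mul_zero]
    rw [ser_coeff (M := 2 * (-(N : ℤ) - 2)), key]
    intro c hc
    rw [key, Finset.Icc_eq_empty (by lia), Finset.sum_empty]
  rw [QBB, HahnSeries.coeff_add, hgen, splitSum_BB hS' hN hD, ← Finset.sum_add_distrib]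
  refine Finset.sum_congr rfl fun a _ => ?_
  rw [Op_apply, map_add]
  ring

include hns in
lemma QFF_corr_coeff (hs : ¬ (g = 1 ∧ n = 0 ∧ k = 0)) : (QFF C (corr C S) g J L).coeff c =
    ∑ a ∈ Finset.Icc (-(N : ℤ) - 2) (c - (-(N : ℤ) - 2)),
      1 / 2 * (a * ((-1) ^ (c - a) + (-1) ^ a)) *
      EV C g (exps J L) (Op C (S D) (.inr a) (field C (S D) (.inr (c - a)))) := by
  have hgen : (if g = 0 then 0 else if g = 1 ∧ n = 0 ∧ k = 0 then w002Diag C else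
      ser fun c => ∑ᶠ a : ℤ, (a : ℂ) * ((-1 : ℂ) ^ (c - a) + (-1 : ℂ) ^ a) *
        corr C S (g - 1) n (k + 2) J (Fin.cons a (Fin.cons (c - a) L)) :
        LaurentSeries ℂ).coeff c =
      ∑ a ∈ Finset.Icc (-(N : ℤ) - 2) (c - (-(N : ℤ) - 2)),
        -((a : ℂ) * ((-1 : ℂ) ^ (c - a) + (-1 : ℂ) ^ a) *
        EV C g (exps J L) (h • Dx C (.inr a) (field C (S D) (.inr (c - a))))) := by
    rw [if_neg hs]
    split_ifs with hg
    · simp [EV_h_smul, hg]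
    have key : ∀ c, (∑ᶠ a : ℤ, (a : ℂ) * ((-1 : ℂ) ^ (c - a) + (-1 : ℂ) ^ a) *
        corr C S (g - 1) n (k + 2) J (Fin.cons a (Fin.cons (c - a) L))) =
        ∑ a ∈ Finset.Icc (-(N : ℤ) - 2) (c - (-(N : ℤ) - 2)),
        -((a : ℂ) * ((-1 : ℂ) ^ (c - a) + (-1 : ℂ) ^ a) *
        EV C g (exps J L) (h • Dx C (.inr a) (field C (S D) (.inr (c - a))))) := by
      intro c
      rw [sum_eq_finsum]
      · refine finsum_congr fun a => ?_
        rw [corr_cons_right hS' (k := k + 1) (D := D) (by lia), EV_exps_cons_right,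
          EV_h_Dx_field J L hns, EV_h_smul, if_neg hg]
        simp [eps]
      · intro a ha
        rw [Finset.mem_Icc, not_and_or, not_le, not_le] at ha
        rcases ha with ha | ha
        · rw [Dx_field_of_LT hN _ (by simpa using ha), EV_h_K_smul_unit J L hns, mul_zero, neg_zero]
        · rw [field_eq_zero_of_LT C hN (by simp only [Sum.elim_inr, id]; lia), map_zero, smul_zero,
            map_zero, mul_zero, neg_zero]
    rw [ser_coeff (M := 2 * (-(N : ℤ) - 2)), key]
    intro c hc
    rw [key, Finset.Icc_eq_empty (by lia), Finset.sum_empty]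
  rw [QFF, HahnSeries.coeff_add, HahnSeries.coeff_add, HahnSeries.coeff_smul, HahnSeries.coeff_smul,
    HahnSeries.coeff_smul, hgen, splitSum_FF hS' hN hD, splitSum_FF' hS' hN hD, smul_eq_mul,
    smul_eq_mul, smul_eq_mul, Finset.mul_sum, Finset.mul_sum, Finset.mul_sum,
    ← Finset.sum_add_distrib, ← Finset.sum_add_distrib]
  refine Finset.sum_congr rfl fun a _ => ?_
  rw [Op_apply, map_add]
  ring

end Coefficients

end

end SuperTR

namespace SuperTR

noncomputable section

open Hb (h K)
open SF

variable {C : LocalSuperSpectralCurve} {S : ℕ → SF} (hS : ∀ k, Good C (k + 2) (S k))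
  (hS' : ∀ k, S (k + 1) - S k ∈ Fil (k + 3))

/-! ### The loop equations -/

include hS hS'

lemma LB_corr_mem (g : ℕ) {n k : ℕ} (J : Fin n → ℤ) (L : Fin k → ℤ) :
    LB (corr C S) g J L ∈ VBPlus := by
  intro a ha
  obtain ⟨N, hN⟩ := exists_LT (S (2 * g + n + k + 1))
  rw [LB, HahnSeries.coeff_add, σB_coeff, bos_corr_coeff hS' hN le_rfl]
  rcases Int.even_or_odd a with he | ho
  · rw [he.add_one.neg_one_zpow]
    ring
  · rw [(hS _).field_inl_odd ho ha, map_zero, mul_zero, add_zero]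

lemma LF_corr_mem (g : ℕ) {n k : ℕ} (J : Fin n → ℤ) (L : Fin k → ℤ) :
    LF (corr C S) g J L ∈ VFPlus := by
  intro a ha
  obtain ⟨N, hN⟩ := exists_LT (S (2 * g + n + k + 1))
  rw [LF, HahnSeries.coeff_add, σF_coeff, fer_corr_coeff hS' hN le_rfl]
  rcases Int.even_or_odd a with he | ho
  · rw [(hS _).field_inr_even he ha, map_zero, mul_zero, add_zero]
  · rw [ho.neg_one_zpow]
    ring

/-- Even coefficients cancel by signs, and the coefficient at 2m - 1 is -2 times the corresponding
value of G_m·1, which vanishes for m < `kind C`. -/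
lemma QFB_corr_mem (g : ℕ) {n k : ℕ} (J : Fin n → ℤ) (L : Fin k → ℤ) :
    QFB (corr C S) g J L ∈ orderGE (2 * kind C - 1) := by
  intro c hc
  set D := 2 * g + n + k + 1 with hD
  obtain ⟨N, hN⟩ := exists_LT (S D)
  have hk := kind_le_one C
  rw [QFB_corr_coeff hS' hN hD.ge]
  rcases Int.even_or_odd c with he | ho
  · refine Finset.sum_eq_zero fun a _ => ?_
    rw [Int.even_iff] at he
    rcases Int.even_or_odd a with ha | ha
    · rw [ha.add_one.neg_one_zpow, Even.neg_one_zpow (by rw [Int.even_iff] at ha ⊢; lia)]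
      simp
    · rw [ha.add_one.neg_one_zpow, Odd.neg_one_zpow (by rw [Int.odd_iff] at ha ⊢; lia)]
      simp
  · obtain ⟨m, rfl⟩ : ∃ m, c = 2 * m - 1 := by
      obtain ⟨m, rfl⟩ := ho
      exact ⟨m + 1, by ring⟩
    -- For m ≤ 0 one of the two exponents is negative and σ-even, so its field vanishes.
    have hodd : ∀ a : ℤ, Odd a →
        Op C (S D) (.inl a) (field C (S D) (.inr (2 * m - 1 - a))) = 0 := by
      intro a ha
      by_cases ha' : a < 0
      · rw [Op_apply, (hS D).field_inl_odd ha ha', Dx_field, (hS D).field_inl_odd ha ha']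
        simp [contr]
      · rw [(hS D).field_inr_even, map_zero]
        · rw [Int.odd_iff] at ha
          rw [Int.even_iff]
          lia
        · rw [Int.odd_iff] at ha
          lia
    -- The evaluation reads off degree 2g + n + k, below the degree D + 2 where `G m unit` begins.
    have hG : EV C g (exps J L) ((oscillators C (hS D).par).G m unit) = 0 :=
      EV_eq_zero C ((hS D).G m (by lia)) (by rw [length_exps]; lia)
    rw [Oscillators.G_apply, AddMonoidHom.map_finsum _ ((oscillators C (hS D).par).finite_βγ m unit)]
      at hG
    have e : ∀ a ∈ Finset.Icc (-(N : ℤ) - 2) (2 * m - 1 - (-(N : ℤ) - 2)),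
        ((-1 : ℂ) ^ (2 * m - 1 - a) + (-1) ^ (a + 1)) * EV C g (exps J L)
          (Op C (S D) (.inl a) (field C (S D) (.inr (2 * m - 1 - a)))) =
        -2 * EV C g (exps J L) (Op C (S D) (.inl a) (field C (S D) (.inr (2 * m - 1 - a)))) := by
      intro a _
      rcases Int.even_or_odd a with ha | ha
      · rw [ha.add_one.neg_one_zpow, Odd.neg_one_zpow (by
          rw [Int.even_iff] at ha; rw [Int.odd_iff]; lia)]
        norm_num
      · rw [hodd a ha]
        simp
    rw [Finset.sum_congr rfl e, ← Finset.mul_sum, sum_eq_finsum, finsum_comp_of_injective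
      (φ := fun i => 2 * i) (fun i j hij => by simpa using hij)]
    · rw [finsum_congr fun i => ?_, hG, mul_zero]
      rw [Op_unit, show 2 * (m - i) - 1 = 2 * m - 1 - 2 * i by ring]
    · intro a ha
      rw [hodd a ?_, map_zero]
      rw [← Int.not_even_iff_odd]
      rintro ⟨i, rfl⟩
      exact ha ⟨i, by ring⟩
    · intro a ha
      rw [Finset.mem_Icc, not_and_or, not_le, not_le] at ha
      rcases ha with ha | ha
      · rw [Op_apply, field_eq_zero_of_LT C hN (e := .inl a) (by simpa using ha),
          Dx_field_of_LT hN _ (by simpa using ha)]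
        simp [contr]
      · rw [field_eq_zero_of_LT C hN (e := .inr _) (by simp only [Sum.elim_inr, id]; lia), map_zero,
          map_zero]

/-- Outside the special case reordering constants are invisible, so the coefficient at 2m is minus
the corresponding value of T_m·1, and normal ordering may be ignored. -/
lemma Q_corr_coeff_of_not_special {g n k : ℕ} (hs : ¬ (g = 1 ∧ n = 0 ∧ k = 0)) (J : Fin n → ℤ)
    (L : Fin k → ℤ) {c : ℤ} (hc : c < 2 * kind C) :
    (QBB C (corr C S) g J L).coeff c + (QFF C (corr C S) g J L).coeff c = 0 := by
  set D := 2 * g + n + k + 1 with hD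
  obtain ⟨N, hN⟩ := exists_LT (S D)
  have hk := kind_le_one C
  have hns : EV C g (exps J L) (h • unit) = 0 := by
    rw [EV_h_smul, EV_unit]
    split_ifs with h0 h1
    · rfl
    · have := length_exps J L
      rw [h1.2, List.length_nil] at this
      exact absurd ⟨by lia, by lia, by lia⟩ hs
    · rfl
  rw [QBB_corr_coeff hS' hN hD.ge J L c hns hs, QFF_corr_coeff hS' hN hD.ge J L c hns hs]
  rcases Int.even_or_odd c with he | ho
  · obtain ⟨m, rfl⟩ : ∃ m, c = 2 * m := by
      obtain ⟨m, rfl⟩ := he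
      exact ⟨m, by ring⟩
    have hodd : ∀ a : ℤ, Odd a →
        EV C g (exps J L) (Op C (S D) (.inl a) (field C (S D) (.inl (2 * m - a)))) = 0 := by
      intro a ha
      by_cases ha' : a < 0
      · rw [Op_apply, (hS D).field_inl_odd ha ha', Dx_field, (hS D).field_inl_odd ha ha',
          LinearMap.map_zero, LinearMap.map_zero, LinearMap.zero_apply, add_zero, smul_zero,
          zero_add, EV_h_K_smul_unit J L hns]
      · rw [Int.odd_iff] at ha
        rw [(hS D).field_inl_odd (by rw [Int.odd_iff]; lia) (by lia), map_zero, map_zero]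
    have heven : ∀ a : ℤ, Even a → a ≠ 0 →
        EV C g (exps J L) (Op C (S D) (.inr a) (field C (S D) (.inr (2 * m - a)))) = 0 := by
      intro a ha h0
      by_cases ha' : a < 0
      · rw [Op_apply, (hS D).field_inr_even ha ha', Dx_field, (hS D).field_inr_even ha ha',
          LinearMap.map_zero, LinearMap.map_zero, LinearMap.zero_apply, add_zero, smul_zero,
          zero_add, EV_h_K_smul_unit J L hns]
      · rw [Int.even_iff] at ha
        rw [(hS D).field_inr_even (by rw [Int.even_iff]; lia) (by lia), map_zero, map_zero]
    have hT : EV C g (exps J L) ((oscillators C (hS D).par).T m unit) = 0 :=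
      EV_eq_zero C ((hS D).T m (by lia)) (by rw [length_exps]; lia)
    have hOO : ∀ e f : ℤ ⊕ ℤ, EV C g (exps J L) (Op C (S D) e (field C (S D) f)) =
        eps e.isRight f.isRight * EV C g (exps J L) (Op C (S D) f (field C (S D) e)) := by
      intro e f
      have : (eps e.isRight f.isRight : Hb) = K (eps e.isRight f.isRight) := by
        unfold eps; split_ifs <;> simp
      rw [Op_apply, Op_apply, map_add, map_add, EV_h_Dx_field J L hns,
        (isHom_field C (hS D).par e).mul_comm (isHom_field C (hS D).par f), this, EV_K_smul, mul_add]
    rw [Oscillators.T_apply, map_add, map_add,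
      AddMonoidHom.map_finsum _ ((oscillators C (hS D).par).finite_nβ m unit),
      AddMonoidHom.map_finsum _
        (finite_support_smul _ ((oscillators C (hS D).par).finite_nγ (m + 1) unit)),
      show EV C g (exps J L) (if m = -1 then h • unit else 0) = 0 by
        split_ifs
        · exact hns
        · exact map_zero _, add_zero] at hT
    have eB : ∑ a ∈ Finset.Icc (-(N : ℤ) - 2) (2 * m - (-(N : ℤ) - 2)), (-1) ^ (2 * m - a + 1) *
        EV C g (exps J L) (Op C (S D) (.inl a) (field C (S D) (.inl (2 * m - a)))) =
        -∑ᶠ i, EV C g (exps J L)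
          (Oscillators.nβ (fun i => Op C (S D) (.inl (2 * i))) i (m - i) unit) := by
      rw [sum_eq_finsum, finsum_comp_of_injective (φ := fun i => 2 * i)
        (fun i j hij => by simpa using hij), ← finsum_neg_distrib]
      · refine finsum_congr fun i => ?_
        rw [Odd.neg_one_zpow (by rw [Int.odd_iff]; lia), neg_one_mul, neg_inj]
        unfold Oscillators.nβ
        split_ifs
        · rw [LinearMap.comp_apply]
          beta_reduce
          rw [Op_unit, show 2 * (m - i) = 2 * m - 2 * i by ring]
        · rw [LinearMap.comp_apply]
          beta_reduce
          rw [Op_unit, show 2 * (m - i) = 2 * m - 2 * i by ring, hOO]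
          simp [eps]
      · intro a ha
        rw [hodd a ?_, mul_zero]
        rw [← Int.not_even_iff_odd]
        rintro ⟨i, rfl⟩
        exact ha ⟨i, by ring⟩
      · intro a ha
        rw [Finset.mem_Icc, not_and_or, not_le, not_le] at ha
        rw [EV_Op_field_eq_zero hN J L hns (by simp only [Sum.elim_inl, id]; lia), mul_zero]
    have eF : ∑ a ∈ Finset.Icc (-(N : ℤ) - 2) (2 * m - (-(N : ℤ) - 2)),
        1 / 2 * (a * ((-1) ^ (2 * m - a) + (-1) ^ a)) *
        EV C g (exps J L) (Op C (S D) (.inr a) (field C (S D) (.inr (2 * m - a)))) =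
        -∑ᶠ i : ℤ, EV C g (exps J L) (((2 * i - 1 : ℤ) : Hb) •
          Oscillators.nγ (fun i => Op C (S D) (.inr (2 * i - 1))) i (m + 1 - i) unit) := by
      rw [sum_eq_finsum, finsum_comp_of_injective (φ := fun i => 2 * i - 1)
        (fun i j hij => by simpa using hij), ← finsum_neg_distrib]
      · refine finsum_congr fun i => ?_
        rw [Odd.neg_one_zpow (by rw [Int.odd_iff]; lia), Odd.neg_one_zpow (by rw [Int.odd_iff]; lia),
          EV_intCast_smul]
        have : EV C g (exps J L) (Oscillators.nγ (fun i => Op C (S D) (.inr (2 * i - 1))) i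
            (m + 1 - i) unit) = EV C g (exps J L) (Op C (S D) (.inr (2 * i - 1))
              (field C (S D) (.inr (2 * m - (2 * i - 1))))) := by
          unfold Oscillators.nγ
          split_ifs
          · rw [LinearMap.comp_apply]
            beta_reduce
            rw [Op_unit, show 2 * (m + 1 - i) - 1 = 2 * m - (2 * i - 1) by ring]
          · rw [LinearMap.neg_apply, LinearMap.comp_apply]
            beta_reduce
            rw [Op_unit, show 2 * (m + 1 - i) - 1 = 2 * m - (2 * i - 1) by ring, map_neg, hOO]
            simp [eps]
        rw [this]
        ring
      · intro a ha
        have he : Even a := by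
          rw [← Int.not_odd_iff_even]
          rintro ⟨i, rfl⟩
          exact ha ⟨i + 1, by ring⟩
        -- The exponent 0 is even but not negative, so the field need not vanish; the weight a from
        -- 𝒟 removes this term.
        by_cases h0 : a = 0
        · rw [h0]
          simp
        · rw [heven a he h0, mul_zero]
      · intro a ha
        rw [Finset.mem_Icc, not_and_or, not_le, not_le] at ha
        rw [EV_Op_field_eq_zero hN J L hns (by simp only [Sum.elim_inr, id]; lia), mul_zero]
    rw [eB, eF, ← neg_add, hT, neg_zero]
  · rw [sum_reflect_eq_zero ho, zero_add]
    · refine Finset.sum_eq_zero fun a _ => ?_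
      rw [Int.odd_iff] at ho
      rcases Int.even_or_odd a with ha | ha
      · rw [ha.neg_one_zpow, Odd.neg_one_zpow (by rw [Int.even_iff] at ha; rw [Int.odd_iff]; lia)]
        simp
      · rw [ha.neg_one_zpow, Even.neg_one_zpow (by rw [Int.odd_iff] at ha; rw [Int.even_iff]; lia)]
        simp
    · intro a
      rw [sub_sub_cancel, Op_apply, Op_apply, map_add, map_add, EV_h_Dx_field J L hns,
        (isHom_field C (hS D).par (.inl _)).mul_comm (isHom_field C (hS D).par (.inl _))]
      simp [eps]

end

end SuperTR

namespace SuperTR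

noncomputable section

open Hb (h K)
open SF

variable {C : LocalSuperSpectralCurve}

/-! ### The loop equation in genus one -/

lemma w020Diag_coeff (C : LocalSuperSpectralCurve) (c : ℤ) :
    (w020Diag C).coeff c = (if c = -2 then -1 / 4 else 0) + if 0 ≤ c then
      ∑ p ∈ Finset.HasAntidiagonal.antidiagonal c.toNat,
        (-1 : ℂ) ^ (p.2 + 1) * C.φ (p.1 + 1) (p.2 + 1) else 0 := by
  rw [w020Diag, HahnSeries.coeff_add, ofSeq_coeff, HahnSeries.coeff_single]
  congr

lemma w002Diag_coeff (C : LocalSuperSpectralCurve) (c : ℤ) :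
    (w002Diag C).coeff c = (if c = -2 then 1 / 2 else 0) + if -2 ≤ c then
      ∑ p ∈ Finset.HasAntidiagonal.antidiagonal (c + 2).toNat, ((p.1 : ℂ) - 1) *
        ((-1 : ℂ) ^ (p.2 + 1) + (-1 : ℂ) ^ (p.1 + 1)) * ψPart C p.1 p.2 else 0 := by
  have := HahnSeries.coeff_single_mul_add (r := (1 : ℂ)) (x := ofSeq fun c =>
    ∑ p ∈ Finset.HasAntidiagonal.antidiagonal c, ((p.1 : ℂ) - 1) *
        ((-1 : ℂ) ^ (p.2 + 1) + (-1 : ℂ) ^ (p.1 + 1)) * ψPart C p.1 p.2) (a := c + 2) (b := -2)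
  rw [show c + 2 + -2 = c by ring] at this
  rw [w002Diag, HahnSeries.coeff_add, this, ofSeq_coeff, HahnSeries.coeff_single, one_mul]
  congr 1
  · congr
  · exact if_congr (by lia) rfl rfl

lemma ψPart_swap (C : LocalSuperSpectralCurve) (p q : ℕ) : ψPart C q p = -ψPart C p q := by
  unfold ψPart
  rw [mul_comm p q]
  ring

lemma Diag_coeff_odd {c : ℤ} (hc : Odd c) (hc' : c < 2) :
    (w020Diag C).coeff c = 0 ∧ (w002Diag C).coeff c = 0 := by
  rw [Int.odd_iff] at hc
  constructor
  · rw [w020Diag_coeff, if_neg (by lia), zero_add]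
    split_ifs with h0
    · have : c = 1 := by lia
      subst this
      rw [show (1 : ℤ).toNat = 1 from rfl, Finset.Nat.antidiagonal_succ]
      simp [C.φ_symm 2 1 (by lia) (by lia)]
    · rfl
  · rw [w002Diag_coeff, if_neg (by lia), zero_add]
    split_ifs with h0
    · refine Finset.sum_eq_zero fun p hp => ?_
      rw [Finset.HasAntidiagonal.mem_antidiagonal] at hp
      rcases Nat.even_or_odd p.1 with h1 | h1
      · have h2 : Odd p.2 := by rw [Nat.even_iff] at h1; rw [Nat.odd_iff]; lia
        rw [h1.add_one.neg_one_pow, h2.add_one.neg_one_pow]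
        ring
      · have h2 : Even p.2 := by rw [Nat.odd_iff] at h1; rw [Nat.even_iff]; lia
        rw [h1.add_one.neg_one_pow, h2.add_one.neg_one_pow]
        ring
    · rfl

variable {S : ℕ → SF} (hS : ∀ k, Good C (k + 2) (S k)) (hS' : ∀ k, S (k + 1) - S k ∈ Fil (k + 3))

/-- Second derivatives of the free energy vanish at the origin in genus zero, so only the
contraction is left. -/
lemma EV_one_nil_h_Dx {T : SF} (hT : T ∈ Fil 3) (e f : ℤ ⊕ ℤ) :
    EV C 1 [] (h • Dx C e (field C T f)) = contr C e f := by
  rw [EV_h_smul, if_neg one_ne_zero, field, map_add, map_add, Dx_source, EV_K_smul, EV_unit,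
    EV_eq_zero C (Dx_mem_Fil C (Dx_mem_Fil C hT f) e) (by simp)]
  simp

include hS hS'

/-- Here the two-point functions themselves appear on the diagonal, through their closed forms
`w020Diag` and `w002Diag`. The products of fields are treated as before, and the diagonal terms must
equal minus the constants produced by normal ordering in T_m·1. -/
lemma Q_corr_coeff_special (J L : Fin 0 → ℤ) {c : ℤ} (hc : c < 2 * kind C) :
    (QBB C (corr C S) 1 J L).coeff c + (QFF C (corr C S) 1 J L).coeff c = 0 := by
  set D := 2 * 1 + 0 + 0 + 1 with hD
  obtain ⟨N, hN⟩ := exists_LT (S D)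
  have hk := kind_le_one C
  have hnil : exps J L = [] := rfl
  rw [QBB, QFF, HahnSeries.coeff_add, HahnSeries.coeff_add, HahnSeries.coeff_add,
    HahnSeries.coeff_smul, HahnSeries.coeff_smul, HahnSeries.coeff_smul, splitSum_BB hS' hN hD.ge,
    splitSum_FF hS' hN hD.ge, splitSum_FF' hS' hN hD.ge, if_neg one_ne_zero, if_pos ⟨rfl, rfl, rfl⟩,
    if_neg one_ne_zero, if_pos ⟨rfl, rfl, rfl⟩, hnil, smul_eq_mul, smul_eq_mul, smul_eq_mul]
  rcases Int.even_or_odd c with he | ho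
  swap
  · rw [sum_reflect_eq_zero ho, (Diag_coeff_odd ho (by lia)).1, (Diag_coeff_odd ho (by lia)).2]
    · simp only [mul_zero, zero_add]
      rw [← mul_add, ← Finset.sum_add_distrib, Finset.sum_eq_zero, mul_zero]
      intro a _
      rw [Int.odd_iff] at ho
      rcases Int.even_or_odd a with ha | ha
      · rw [ha.neg_one_zpow, Odd.neg_one_zpow (by rw [Int.even_iff] at ha; rw [Int.odd_iff]; lia)]
        ring
      · rw [ha.neg_one_zpow, Even.neg_one_zpow (by rw [Int.odd_iff] at ha; rw [Int.even_iff]; lia)]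
        ring
    · intro a
      rw [sub_sub_cancel,
        (isHom_field C (hS D).par (.inl _)).mul_comm (isHom_field C (hS D).par (.inl _))]
      simp [eps]
  obtain ⟨m, rfl⟩ : ∃ m, c = 2 * m := by
    obtain ⟨m, rfl⟩ := he
    exact ⟨m, by ring⟩
  have hT : EV C 1 [] ((oscillators C (hS D).par).T m unit) = 0 :=
    EV_eq_zero C ((hS D).T m (by lia)) (by simp [hD])
  rw [Oscillators.T_apply, map_add, map_add,
    AddMonoidHom.map_finsum _ ((oscillators C (hS D).par).finite_nβ m unit),
    AddMonoidHom.map_finsum _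
      (finite_support_smul _ ((oscillators C (hS D).par).finite_nγ (m + 1) unit))] at hT
  have hOp : ∀ e f : ℤ ⊕ ℤ, EV C 1 [] (Op C (S D) e (Op C (S D) f unit)) =
      EV C 1 [] (mul (field C (S D) e) (field C (S D) f)) + contr C e f := fun e f => by
    rw [Op_unit, Op_apply, map_add, EV_one_nil_h_Dx (hS D).fil, add_comm]
  have hcomm : ∀ e f : ℤ ⊕ ℤ, EV C 1 [] (mul (field C (S D) e) (field C (S D) f)) =
      eps e.isRight f.isRight * EV C 1 [] (mul (field C (S D) f) (field C (S D) e)) := by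
    intro e f
    have : (eps e.isRight f.isRight : Hb) = K (eps e.isRight f.isRight) := by
      unfold eps; split_ifs <;> simp
    rw [(isHom_field C (hS D).par e).mul_comm (isHom_field C (hS D).par f), this, EV_K_smul]
  have hB0 : ∀ a b : ℤ, a < 0 → contr C (.inl b) (.inl a) = 0 := fun a b ha => by
    rw [contr, w020_eq, if_neg (by lia)]
  have hF0 : ∀ a b : ℤ, a < -1 → contr C (.inr b) (.inr a) = 0 := fun a b ha => by
    rw [contr, w002, if_neg (by lia), if_neg (by lia), if_neg (by lia), add_zero]
  -- For m ≤ 0 the normally ordered contraction survives only when both exponents are 0, where it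
  -- equals φ₁₁.
  have eβ : ∀ i : ℤ, EV C 1 [] (Oscillators.nβ (fun i => Op C (S D) (.inl (2 * i))) i (m - i) unit) =
      EV C 1 [] (mul (field C (S D) (.inl (2 * i))) (field C (S D) (.inl (2 * m - 2 * i)))) +
        if i = 0 then (if m = 0 then C.φ 1 1 else 0) else 0 := by
    intro i
    rw [show 2 * m - 2 * i = 2 * (m - i) by ring]
    unfold Oscillators.nβ
    split_ifs with h1 h2 h3 h2 h3
    · rw [LinearMap.comp_apply, hOp, h2, h3]
      simp [contr, w020]
    · rw [LinearMap.comp_apply, hOp, hB0 _ _ (by lia)]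
    · rw [LinearMap.comp_apply, hOp, hB0 _ _ (by lia)]
    · lia
    · rw [LinearMap.comp_apply, hOp, hB0 _ _ (by lia), hcomm]
      simp [eps]
    · rw [LinearMap.comp_apply, hOp, hB0 _ _ (by lia), hcomm]
      simp [eps]
  -- The zero-mode contraction 1/2 enters with weight -1 at m = -1; at m = 0 the exponent pairs (±1,
  -- ∓1) contribute ψ-terms.
  have eγ : ∀ i : ℤ, EV C 1 [] (((2 * i - 1 : ℤ) : Hb) •
        Oscillators.nγ (fun i => Op C (S D) (.inr (2 * i - 1))) i (m + 1 - i) unit) =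
      ((2 * i - 1 : ℤ) : ℂ) * EV C 1 [] (mul (field C (S D) (.inr (2 * i - 1)))
        (field C (S D) (.inr (2 * m - (2 * i - 1))))) +
        if m = -1 ∧ i = 0 then -1 / 2 else if m = 0 ∧ (i = 0 ∨ i = 1) then ψPart C 0 2 else 0 := by
    intro i
    rw [EV_intCast_smul, show 2 * m - (2 * i - 1) = 2 * (m + 1 - i) - 1 by ring]
    have e1 : EV C 1 [] (Oscillators.nγ (fun i => Op C (S D) (.inr (2 * i - 1))) i (m + 1 - i) unit) =
        EV C 1 [] (mul (field C (S D) (.inr (2 * i - 1)))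
          (field C (S D) (.inr (2 * (m + 1 - i) - 1)))) +
        if m + 1 - i ≤ i then contr C (.inr (2 * i - 1)) (.inr (2 * (m + 1 - i) - 1)) else
          -contr C (.inr (2 * (m + 1 - i) - 1)) (.inr (2 * i - 1)) := by
      unfold Oscillators.nγ
      split_ifs
      · rw [LinearMap.comp_apply, hOp]
      · rw [LinearMap.neg_apply, LinearMap.comp_apply, map_neg, hOp, hcomm]
        simp [eps]
        ring
    have hψ : ψPart C 0 0 = 0 := by simp [ψPart]
    rw [e1, mul_add]
    congr 1
    by_cases h1 : m = -1 ∧ i = 0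
    · obtain ⟨rfl, rfl⟩ := h1
      simp [contr, w002, hψ]
      norm_num
    rw [if_neg h1]
    by_cases h2 : m = 0 ∧ (i = 0 ∨ i = 1)
    · rw [if_pos h2]
      obtain ⟨rfl, rfl | rfl⟩ := h2
      · simp [contr, w002]
      · simp [contr, w002]
    · rw [if_neg h2]
      split_ifs
      · rw [hF0 _ _ (by lia), mul_zero]
      · rw [hF0 _ _ (by lia), neg_zero, mul_zero]
  have hoddB : ∀ a : ℤ, Odd a →
      mul (field C (S D) (.inl a)) (field C (S D) (.inl (2 * m - a))) = 0 := by
    intro a ha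
    by_cases ha' : a < 0
    · rw [(hS D).field_inl_odd ha ha', map_zero, LinearMap.zero_apply]
    · rw [Int.odd_iff] at ha
      rw [(hS D).field_inl_odd (a := 2 * m - a) (by rw [Int.odd_iff]; lia) (by lia), map_zero]
  have hevenF : ∀ a : ℤ, Even a → a ≠ 0 →
      mul (field C (S D) (.inr a)) (field C (S D) (.inr (2 * m - a))) = 0 := by
    intro a ha h0
    by_cases ha' : a < 0
    · rw [(hS D).field_inr_even ha ha', map_zero, LinearMap.zero_apply]
    · rw [Int.even_iff] at ha
      rw [(hS D).field_inr_even (b := 2 * m - a) (by rw [Int.even_iff]; lia) (by lia), map_zero]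
  have hout : ∀ (e f : ℤ ⊕ ℤ), (e.elim id id < -(N : ℤ) - 2 ∨ f.elim id id < -(N : ℤ) - 2) →
      mul (field C (S D) e) (field C (S D) f) = 0 := by
    rintro e f (he | hf)
    · rw [field_eq_zero_of_LT C hN he, map_zero, LinearMap.zero_apply]
    · rw [field_eq_zero_of_LT C hN hf, map_zero]
  have fβ : (Function.support fun i : ℤ => EV C 1 [] (mul (field C (S D) (.inl (2 * i)))
      (field C (S D) (.inl (2 * m - 2 * i))))).Finite := by
    refine finite_int_support (-(N : ℤ) - 2) (m + N + 2) (fun i hi => ?_) fun i hi => ?_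
    · rw [hout _ _ (by simp only [Sum.elim_inl, id]; lia), map_zero]
    · rw [hout _ _ (by simp only [Sum.elim_inl, id]; lia), map_zero]
  have fγ : (Function.support fun i : ℤ => ((2 * i - 1 : ℤ) : ℂ) * EV C 1 []
      (mul (field C (S D) (.inr (2 * i - 1)))
        (field C (S D) (.inr (2 * m - (2 * i - 1)))))).Finite := by
    refine finite_int_support (-(N : ℤ) - 2) (m + N + 4) (fun i hi => ?_) fun i hi => ?_
    · rw [hout _ _ (by simp only [Sum.elim_inr, id]; lia), map_zero, mul_zero]
    · rw [hout _ _ (by simp only [Sum.elim_inr, id]; lia), map_zero, mul_zero]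
  rw [finsum_congr eβ, finsum_congr eγ, finsum_add_distrib fβ, finsum_add_distrib fγ] at hT
  · have s1 : (∑ᶠ i : ℤ, if i = 0 then (if m = 0 then C.φ 1 1 else 0) else 0) =
        if m = 0 then C.φ 1 1 else 0 := by
      rw [finsum_eq_single _ (0 : ℤ) fun i hi => if_neg hi, if_pos rfl]
    have s2 : (∑ᶠ i : ℤ, if m = -1 ∧ i = 0 then (-1 / 2 : ℂ) else
        if m = 0 ∧ (i = 0 ∨ i = 1) then ψPart C 0 2 else 0) =
        if m = -1 then -1 / 2 else if m = 0 then 2 * ψPart C 0 2 else 0 := by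
      rw [finsum_eq_sum_of_support_subset (s := {0, 1}), Finset.sum_pair (by simp)]
      · by_cases h1 : m = -1
        · simp [h1]
        · by_cases h2 : m = 0
          · simp [h2]
            ring
          · simp [h1, h2]
      · intro i hi
        rw [Finset.mem_coe, Finset.mem_insert, Finset.mem_singleton]
        by_contra hi'
        exact hi (by beta_reduce; rw [if_neg (by lia), if_neg (by lia)])
    have s3 : EV C 1 [] (if m = -1 then h • unit else 0) = if m = -1 then 1 else 0 := by
      split_ifs
      · rw [EV_h_smul, EV_unit]
        simp
      · exact map_zero _
    have eB : ∑ a ∈ Finset.Icc (-(N : ℤ) - 2) (2 * m - (-(N : ℤ) - 2)), (-1) ^ (2 * m - a + 1) *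
        EV C 1 [] (mul (field C (S D) (.inl a)) (field C (S D) (.inl (2 * m - a)))) =
        -∑ᶠ i : ℤ, EV C 1 []
          (mul (field C (S D) (.inl (2 * i))) (field C (S D) (.inl (2 * m - 2 * i)))) := by
      rw [sum_eq_finsum, finsum_comp_of_injective (φ := fun i => 2 * i)
        (fun i j hij => by simpa using hij), ← finsum_neg_distrib]
      · refine finsum_congr fun i => ?_
        rw [Odd.neg_one_zpow (by rw [Int.odd_iff]; lia), neg_one_mul]
      · intro a ha
        rw [hoddB a ?_, map_zero, mul_zero]
        rw [← Int.not_even_iff_odd]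
        rintro ⟨i, rfl⟩
        exact ha ⟨i, by ring⟩
      · intro a ha
        rw [Finset.mem_Icc, not_and_or, not_le, not_le] at ha
        rw [hout _ _ (by simp only [Sum.elim_inl, id]; lia), map_zero, mul_zero]
    have eF : 1 / 2 * ∑ a ∈ Finset.Icc (-(N : ℤ) - 2) (2 * m - (-(N : ℤ) - 2)),
        (a * (-1) ^ (2 * m - a)) *
        EV C 1 [] (mul (field C (S D) (.inr a)) (field C (S D) (.inr (2 * m - a)))) +
        1 / 2 * ∑ a ∈ Finset.Icc (-(N : ℤ) - 2) (2 * m - (-(N : ℤ) - 2)), (a * (-1) ^ a) *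
        EV C 1 [] (mul (field C (S D) (.inr a)) (field C (S D) (.inr (2 * m - a)))) =
        -∑ᶠ i : ℤ, ((2 * i - 1 : ℤ) : ℂ) * EV C 1 [] (mul (field C (S D) (.inr (2 * i - 1)))
          (field C (S D) (.inr (2 * m - (2 * i - 1))))) := by
      rw [← mul_add, ← Finset.sum_add_distrib, Finset.mul_sum, sum_eq_finsum,
        finsum_comp_of_injective (φ := fun i => 2 * i - 1)
        (fun i j hij => by simpa using hij), ← finsum_neg_distrib]
      · refine finsum_congr fun i => ?_
        rw [Odd.neg_one_zpow (by rw [Int.odd_iff]; lia), Odd.neg_one_zpow (by rw [Int.odd_iff]; lia)]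
        ring
      · intro a ha
        have he : Even a := by
          rw [← Int.not_odd_iff_even]
          rintro ⟨i, rfl⟩
          exact ha ⟨i + 1, by ring⟩
        by_cases h0 : a = 0
        · rw [h0]
          simp
        · rw [hevenF a he h0, map_zero]
          ring
      · intro a ha
        rw [Finset.mem_Icc, not_and_or, not_le, not_le] at ha
        rw [hout _ _ (by simp only [Sum.elim_inr, id]; lia), map_zero]
        ring
    -- At m = -1 this reads -1/4 - 1/4 = -(-1/2 + 1): the double poles on the diagonal match the
    -- constant ħ in `T (-1)`.
    have hdiag : (w020Diag C).coeff (2 * m) + -1 / 2 * (w002Diag C).coeff (2 * m) =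
        -((if m = 0 then C.φ 1 1 else 0) +
          (if m = -1 then -1 / 2 else if m = 0 then 2 * ψPart C 0 2 else 0) +
          (if m = -1 then 1 else 0)) := by
      rw [w020Diag_coeff, w002Diag_coeff]
      by_cases h0 : m = 0
      · subst h0
        have : Finset.HasAntidiagonal.antidiagonal 2 = {(0, 2), (1, 1), (2, 0)} := rfl
        simp [this, ψPart_swap C 0 2]
        norm_num
        ring
      by_cases h1 : m = -1
      · subst h1
        simp [ψPart]
        norm_num
      · rw [if_neg (by lia), if_neg (by lia), if_neg (by lia), if_neg (by lia), if_neg h0, if_neg h1,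
          if_neg h0, if_neg h1]
        ring
    rw [s1, s2, s3] at hT
    rw [eB]
    linear_combination hdiag + eF - hT
  · refine (Set.toFinite ({0, 1} : Set ℤ)).subset fun i hi => ?_
    rw [Set.mem_insert_iff, Set.mem_singleton_iff]
    by_contra hi'
    exact hi (by beta_reduce; rw [if_neg (by lia), if_neg (by lia)])
  · refine (Set.finite_singleton (0 : ℤ)).subset fun i hi => ?_
    by_contra hi'
    exact hi (if_neg hi')

lemma Q_corr_mem (g : ℕ) {n k : ℕ} (J : Fin n → ℤ) (L : Fin k → ℤ) :
    QBB C (corr C S) g J L + QFF C (corr C S) g J L ∈ orderGE (2 * kind C) := by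
  intro c hc
  rw [HahnSeries.coeff_add]
  by_cases hs : g = 1 ∧ n = 0 ∧ k = 0
  · obtain ⟨rfl, rfl, rfl⟩ := hs
    exact Q_corr_coeff_special hS hS' J L hc
  · exact Q_corr_coeff_of_not_special hS hS' hs J L hc

lemma loopEquations_corr : LoopEquations C (corr C S) where
  linB g n m J L := LB_corr_mem hS hS' g J L
  linF g n m J L := LF_corr_mem hS hS' g J L
  quadB g n m J L := by
    have := Q_corr_mem hS hS' g J L
    unfold kind at this
    split_ifs at this ⊢ <;> simpa using this
  quadF g n m J L := by
    have := QFB_corr_mem hS hS' g J L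
    unfold kind at this
    split_ifs at this ⊢ <;> simpa using this

end

end SuperTR

namespace SuperTR

noncomputable section

open Hb (h K)
open SF

/-! ### Polarization and symmetry -/

section Polarized

variable (C : LocalSuperSpectralCurve)

lemma polarized_cons_left {n k : ℕ} {f : LaurentSeries ℂ} (hf : f ∈ VBMinus C) {w : MultiDiff n k}
    (hw : w ∈ polarized C n k) :
    (fun a b => f.coeff (a 0) * w (Fin.tail a) b : MultiDiff (n + 1) k) ∈ polarized C (n + 1) k := by
  induction hw using Submodule.span_induction with
  | mem w hw =>
    obtain ⟨F, H, hF, hH, rfl⟩ := hw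
    refine Submodule.subset_span ⟨Fin.cons f F, H, Fin.cases hf hF, hH, ?_⟩
    funext a b
    simp only [Fin.prod_univ_succ, Fin.cons_zero, Fin.cons_succ]
    rw [_root_.mul_assoc]
    rfl
  | zero =>
    simp only [Pi.zero_apply, mul_zero]
    exact (polarized C (n + 1) k).zero_mem
  | add u v _ _ hu hv =>
    simp only [Pi.add_apply, mul_add]
    exact (polarized C (n + 1) k).add_mem hu hv
  | smul c u _ hu =>
    simp only [Pi.smul_apply, smul_eq_mul, mul_left_comm]
    exact (polarized C (n + 1) k).smul_mem c hu

lemma polarized_cons_right {n k : ℕ} {f : LaurentSeries ℂ} (hf : f ∈ VFZeroMinus C)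
    {w : MultiDiff n k} (hw : w ∈ polarized C n k) :
    (fun a b => f.coeff (b 0) * w a (Fin.tail b) : MultiDiff n (k + 1)) ∈ polarized C n (k + 1) := by
  induction hw using Submodule.span_induction with
  | mem w hw =>
    obtain ⟨F, H, hF, hH, rfl⟩ := hw
    refine Submodule.subset_span ⟨F, Fin.cons f H, hF, Fin.cases hf hH, ?_⟩
    funext a b
    simp only [Fin.prod_univ_succ, Fin.cons_zero, Fin.cons_succ]
    rw [mul_left_comm]
    rfl
  | zero =>
    simp only [Pi.zero_apply, mul_zero]
    exact (polarized C n (k + 1)).zero_mem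
  | add u v _ _ hu hv =>
    simp only [Pi.add_apply, mul_add]
    exact (polarized C n (k + 1)).add_mem hu hv
  | smul c u _ hu =>
    simp only [Pi.smul_apply, smul_eq_mul, mul_left_comm]
    exact (polarized C n (k + 1)).smul_mem c hu

lemma EV_sum_cf {N : ℕ} {y : SF} (hN : LT N y) (g : ℕ) (L : List (ℤ ⊕ ℤ)) (e : ℤ ⊕ ℤ) :
    EV C g L (Dx C e y) = ∑ i ∈ box N, cf C e i * EV C g L (d i y) := by
  rw [Dx_eq C hN, map_sum]
  exact Finset.sum_congr rfl fun i _ => EV_K_smul C g L _ _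

/-- Each derivative along an exponent is a finite sum over letters of a basis-form coefficient times
a derivative along the letter, so variables split off one at a time. -/
lemma EV_mem_polarized (g n k : ℕ) (y : SF) :
    (fun J K => EV C g (exps J K) y : MultiDiff n k) ∈ polarized C n k := by
  induction n generalizing y with
  | zero =>
    induction k generalizing y with
    | zero =>
      have : (fun J K => EV C g (exps J K) y : MultiDiff 0 0) = EV C g [] y • fun _ _ => 1 := by
        funext J K
        simp [exps]
      rw [this]
      refine Submodule.smul_mem _ _ (Submodule.subset_span ⟨Fin.elim0, Fin.elim0, fun i => i.elim0,
        fun i => i.elim0, ?_⟩)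
      simp
    | succ k ih =>
      obtain ⟨N, hN⟩ := exists_LT y
      have : (fun J K => EV C g (exps J K) y : MultiDiff 0 (k + 1)) = ∑ i ∈ box N,
          fun J K => cf C (.inr (K 0)) i * EV C g (exps J (Fin.tail K)) (d i y) := by
        funext J K
        simp only [Finset.sum_apply]
        rw [← EV_sum_cf C hN, ← EV_exps_cons_right, Fin.cons_self_tail]
      rw [this]
      refine Submodule.sum_mem _ fun i _ => ?_
      rcases i with i | i
      · simp only [cf, zero_mul]
        exact (polarized C 0 (k + 1)).zero_mem
      · exact polarized_cons_right C (Submodule.subset_span ⟨i, rfl⟩) (ih (d (.inr i) y))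
  | succ n ih =>
    obtain ⟨N, hN⟩ := exists_LT y
    have : (fun J K => EV C g (exps J K) y : MultiDiff (n + 1) k) = ∑ i ∈ box N,
        fun J K => cf C (.inl (J 0)) i * EV C g (exps (Fin.tail J) K) (d i y) := by
      funext J K
      simp only [Finset.sum_apply]
      rw [← EV_sum_cf C hN, ← EV_cons, ← exps_cons, Fin.cons_self_tail]
    rw [this]
    refine Submodule.sum_mem _ fun i _ => ?_
    rcases i with i | i
    · exact polarized_cons_left C (Submodule.subset_span ⟨i + 1, by lia, rfl⟩) (ih (d (.inl i) y))
    · simp only [cf, zero_mul]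
      exact (polarized C (n + 1) k).zero_mem

lemma Dxs_perm_inl {l l' : List ℤ} (hl : l.Perm l') (y : SF) :
    Dxs C (l.map .inl) y = Dxs C (l'.map .inl) y := by
  induction hl generalizing y with
  | nil => rfl
  | cons a _ ih => exact ih _
  | swap a b l =>
    rw [List.map_cons, List.map_cons, List.map_cons, List.map_cons, Dxs_swap]
    simp [eps]
  | trans _ _ h1 h2 => exact (h1 y).trans (h2 y)

lemma EV_comp_perm_left (g : ℕ) {n k : ℕ} (J : Fin n → ℤ) (L : Fin k → ℤ) (s : Equiv.Perm (Fin n))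
    (y : SF) : EV C g (exps (J ∘ s) L) y = EV C g (exps J L) y := by
  rw [EV_apply, EV_apply, exps, exps, Dxs_append, Dxs_append,
    Dxs_perm_inl C (Equiv.Perm.ofFn_comp_perm s J)]

/-- Adjacent transpositions suffice for general permutations; stripping off leading derivatives
reduces to a swap of the first two. -/
lemma EV_comp_swap (g : ℕ) {n k : ℕ} (J : Fin n → ℤ) (L : Fin (k + 1) → ℤ) (i : Fin k) (y : SF) :
    EV C g (exps J (L ∘ Equiv.swap i.castSucc i.succ)) y = -EV C g (exps J L) y := by
  induction k generalizing y with
  | zero => exact i.elim0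
  | succ k ih =>
    refine Fin.cases ?_ (fun i => ?_) i
    · have e1 : L ∘ Equiv.swap (Fin.castSucc 0) (Fin.succ 0) =
          Fin.cons (L 1) (Fin.cons (L 0) (Fin.tail (Fin.tail L))) := by
        funext j
        refine Fin.cases ?_ (Fin.cases ?_ fun j => ?_) j
        · simp
        · simp
        · have : Equiv.swap (0 : Fin (k + 2)) 1 j.succ.succ = j.succ.succ :=
            Equiv.swap_apply_of_ne_of_ne (Fin.succ_ne_zero _) (by
              rw [← Fin.succ_zero_eq_one]
              exact fun e => Fin.succ_ne_zero _ (Fin.succ_injective _ e))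
          simp [this, Fin.tail]
      have e2 : L = Fin.cons (L 0) (Fin.cons (L 1) (Fin.tail (Fin.tail L))) := by
        funext j
        refine Fin.cases ?_ (Fin.cases ?_ fun j => ?_) j <;> simp [Fin.tail]
      rw [e1]
      nth_rewrite 4 [e2]
      rw [EV_exps_cons_right, EV_exps_cons_right, EV_exps_cons_right, EV_exps_cons_right, Dx_Dx,
        ← map_neg]
      simp [eps]
    · have e1 : L ∘ Equiv.swap i.succ.castSucc i.succ.succ =
          Fin.cons (L 0) (Fin.tail L ∘ Equiv.swap i.castSucc i.succ) := by
        funext j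
        refine Fin.cases ?_ (fun j => ?_) j
        · have : Equiv.swap i.succ.castSucc i.succ.succ 0 = 0 :=
            Equiv.swap_apply_of_ne_of_ne (fun e => Fin.succ_ne_zero _ (by
              rw [Fin.castSucc_succ] at e; exact e.symm)) (Fin.succ_ne_zero _).symm
          rw [Function.comp_apply, this, Fin.cons_zero]
        · have : Equiv.swap i.succ.castSucc i.succ.succ j.succ =
              (Equiv.swap i.castSucc i.succ j).succ := by
            rw [Fin.castSucc_succ]
            exact (Function.Injective.map_swap (Fin.succ_injective _) _ _ _).symm
          rw [Function.comp_apply, this, Fin.cons_succ]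
          rfl
      rw [e1, EV_exps_cons_right, ih, ← EV_exps_cons_right, Fin.cons_self_tail]

lemma EV_comp_perm_right (g : ℕ) {n k : ℕ} (J : Fin n → ℤ) (L : Fin k → ℤ)
    (s : Equiv.Perm (Fin k)) (y : SF) :
    EV C g (exps J (L ∘ s)) y = ((Equiv.Perm.sign s : ℤ) : ℂ) * EV C g (exps J L) y := by
  rcases k with _ | k
  · rw [Subsingleton.elim s 1]
    simp
  have hs : s ∈ Submonoid.closure (Set.range fun i : Fin k => Equiv.swap i.castSucc i.succ) := by
    rw [Equiv.Perm.mclosure_swap_castSucc_succ]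
    trivial
  induction hs using Submonoid.closure_induction generalizing L with
  | mem s hs =>
    obtain ⟨i, rfl⟩ := hs
    rw [EV_comp_swap, Equiv.Perm.sign_swap (Fin.castSucc_lt_succ).ne]
    simp
  | one => simp
  | mul s t _ _ h1 h2 =>
    have : L ∘ (s * t : Equiv.Perm _) = (L ∘ s) ∘ t := rfl
    rw [this, h2, h1, map_mul]
    push_cast
    ring

lemma EV_eq_zero_of_odd (g : ℕ) (L : List (ℤ ⊕ ℤ)) {p : Bool} {y : SF} (hy : IsHom p y)
    (hL : Odd (L.countP Sum.isRight + p.toNat)) : EV C g L y = 0 := by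
  induction L generalizing p y with
  | nil =>
    have hp : p = true := by
      cases p
      · simp at hL
      · rfl
    subst hp
    have h1 := congrFun hy []
    simp only [tw, List.countP_nil, pow_zero, one_mul, eps, Bool.and_self, if_true, Pi.smul_apply,
      neg_smul, one_smul] at h1
    change Hb.coeff g (y.1 []) = 0
    have h2 := congrArg (Hb.coeff g) h1
    rw [map_neg] at h2
    exact self_eq_neg.1 h2
  | cons e L ih =>
    rw [EV_cons]
    refine ih (IsHom.Dx C hy e) ?_
    rw [List.countP_cons] at hL
    rw [Nat.odd_iff] at hL ⊢
    rcases e with e | e <;> cases p <;> simp at hL ⊢ <;> lia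

end Polarized

variable {C : LocalSuperSpectralCurve} {S : ℕ → SF} (hS : ∀ k, Good C (k + 2) (S k))
  (hS' : ∀ k, S (k + 1) - S k ∈ Fil (k + 3))

include hS hS' in
lemma hasUnstableData_corr : HasUnstableData C (corr C S) where
  one a b := by
    rw [corr, EV_eq_zero C (hS _).fil (by rw [length_exps]; lia), zero_add]
    simp [exps, unst, bg]
  two a b := by
    rw [corr, EV_eq_zero C (hS _).fil (by rw [length_exps]; lia), zero_add]
    simp [exps, unst, contr, List.ofFn_succ]
  ferm a b := by
    rw [corr, EV_eq_zero C (hS _).fil (by rw [length_exps]; lia), zero_add]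
    simp [exps, unst, contr, List.ofFn_succ]
  odd g n k hk := by
    funext J L
    rcases k with _ | k
    · simp at hk
    rw [← Fin.cons_self_tail L, corr_cons_right hS' le_rfl,
      EV_eq_zero_of_odd C g _ (isHom_field C (hS _).par (.inr _))]
    · rfl
    · have e1 : ((List.ofFn J).map (Sum.inl : ℤ → ℤ ⊕ ℤ)).countP Sum.isRight = 0 := by
        rw [List.countP_eq_zero]
        simp
      have e2 : ((List.ofFn (Fin.tail L)).map (Sum.inr : ℤ → ℤ ⊕ ℤ)).countP Sum.isRight = k := by
        rw [List.countP_eq_length.2 (by simp)]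
        simp
      rw [exps, List.countP_append, e1, e2]
      simpa using hk

lemma respectsPolarization_corr : RespectsPolarization C (corr C S) where
  mem g n m hg := by
    have := EV_mem_polarized C g n (2 * m) (S (2 * g + n + 2 * m))
    convert this using 1
    funext J L
    exact corr_eq hg J L
  symm g n m hg s J L := by
    rw [corr_eq hg, corr_eq hg, EV_comp_perm_left]
  antisymm g n m hg s J L := by
    rw [corr_eq hg, corr_eq hg, EV_comp_perm_right]

/-- Every local super spectral curve has a polarized solution of the super loop equations. -/
theorem exists_isPolarizedSolution (C : LocalSuperSpectralCurve) :
    ∃ ω, IsPolarizedSolution C ω := by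
  obtain ⟨S, hS, hS'⟩ := exists_good_seq C
  exact ⟨corr C S, hasUnstableData_corr hS hS', respectsPolarization_corr,
    loopEquations_corr hS hS'⟩

end

end SuperTR

namespace SuperTR

noncomputable section

/-! ### Orders and residues -/

lemma mul_mem_orderGE {f k : LaurentSeries ℂ} {M N : ℤ} (hf : f ∈ orderGE M) (hk : k ∈ orderGE N) :
    f * k ∈ orderGE (M + N) := fun c hc => by
  rw [coeff_mul_eq_sum hf hk, Finset.Icc_eq_empty (by lia), Finset.sum_empty]

lemma orderGE_mono {f : LaurentSeries ℂ} {M N : ℤ} (hMN : N ≤ M) (hf : f ∈ orderGE M) :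
    f ∈ orderGE N := fun a ha => hf a (ha.trans_le hMN)

lemma Z_mem_orderGE : Z ∈ orderGE 1 := fun _ ha => HahnSeries.coeff_single_of_ne ha.ne

lemma res_eq_zero {f : LaurentSeries ℂ} (hf : f ∈ orderGE 0) : res f = 0 := hf (-1) (by lia)

lemma res_add (f k : LaurentSeries ℂ) : res (f + k) = res f + res k := HahnSeries.coeff_add

lemma res_sub (f k : LaurentSeries ℂ) : res (f - k) = res f - res k := HahnSeries.coeff_sub

lemma res_smul (c : ℂ) (f : LaurentSeries ℂ) : res (c • f) = c * res f := by
  rw [res, HahnSeries.coeff_smul]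
  rfl

lemma smul_mul_series (c : ℂ) (f k : LaurentSeries ℂ) : c • f * k = c • (f * k) := by
  rw [← HahnSeries.C_mul_eq_smul, ← HahnSeries.C_mul_eq_smul, mul_assoc]

lemma mul_smul_series (c : ℂ) (f k : LaurentSeries ℂ) : f * c • k = c • (f * k) := by
  rw [mul_comm, smul_mul_series, mul_comm]

variable (C : LocalSuperSpectralCurve)

lemma kernelDenom_coeff (a : ℤ) :
    (kernelDenom C).coeff a = (1 - (-1) ^ (a + 1)) * (w010 C).coeff a := by
  rw [kernelDenom, HahnSeries.coeff_sub, σB_coeff]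
  ring

lemma kernelDenom_coeff_ne_zero : (kernelDenom C).coeff (2 * kind C) ≠ 0 := by
  have := wt_kind_ne_zero C
  rw [wt] at this
  rw [kernelDenom_coeff, Odd.neg_one_zpow (by rw [Int.odd_iff]; lia)]
  exact mul_ne_zero (by norm_num) this

lemma kernelDenom_ne_zero : kernelDenom C ≠ 0 := fun h0 =>
  kernelDenom_coeff_ne_zero C (by rw [h0, HahnSeries.coeff_zero])

/-- The denominator is twice the σ-odd part of ω_{0,1|0} and has a nonzero coefficient at 2 · `kind
C`; this pole is what the orders in the quadratic loop equations compensate. -/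
lemma inv_kernelDenom_mem : (kernelDenom C)⁻¹ ∈ orderGE (-(2 * kind C)) := by
  have h0 := kernelDenom_ne_zero C
  have h1 : (kernelDenom C).order ≤ 2 * kind C :=
    HahnSeries.order_le_of_coeff_ne_zero (kernelDenom_coeff_ne_zero C)
  have h2 := HahnSeries.order_mul h0 (inv_ne_zero h0)
  rw [mul_inv_cancel₀ h0, HahnSeries.order_one] at h2
  intro a ha
  exact HahnSeries.coeff_eq_zero_of_lt_order (by lia)

lemma w010_mem : w010 C ∈ orderGE 0 := fun a ha => by rw [w010_coeff, if_neg (by lia)]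

lemma w010_add_σB_mem : w010 C + σB (w010 C) ∈ orderGE 1 := by
  intro a ha
  rw [HahnSeries.coeff_add, σB_coeff]
  by_cases h0 : a < 0
  · rw [w010_mem C a h0, mul_zero, add_zero]
  · have : a = 0 := by lia
    subst this
    simp

lemma add_σB_mem {f : LaurentSeries ℂ} (hf : f + σB f ∈ orderGE 0) : f + σB f ∈ orderGE 1 := by
  intro a ha
  by_cases h0 : a < 0
  · exact hf a h0
  · have : a = 0 := by lia
    subst this
    rw [HahnSeries.coeff_add, σB_coeff]
    simp

/-- The numerator of the bosonic kernel. -/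
def numB (b : ℤ) : LaurentSeries ℂ := ser fun a => w020 C (a - 1) b / a

/-- The numerator of the fermionic kernel. -/
def numF (b : ℤ) : LaurentSeries ℂ :=
  ser fun a => w002 C a b - 1 / 2 * (ηNeg C 0).coeff a * (ηNeg C 0).coeff b

lemma numB_coeff (b a : ℤ) :
    (numB C b).coeff a = if 1 ≤ a then (dξNeg C a.toNat).coeff b else 0 := by
  have e : ∀ a : ℤ, w020 C (a - 1) b / a = if 1 ≤ a then (dξNeg C a.toNat).coeff b else 0 := by
    intro a
    rw [w020_eq]
    by_cases ha : 1 ≤ a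
    · rw [if_pos (by lia), if_pos ha, show (a - 1).toNat + 1 = a.toNat by lia]
      have : (a : ℂ) ≠ 0 := by
        have : a ≠ 0 := by lia
        exact_mod_cast this
      push_cast
      field_simp
      ring
    · rw [if_neg (by lia), if_neg ha, zero_div]
  rw [numB, ser_coeff (M := 1), e]
  intro a ha
  rw [e, if_neg (by lia)]

lemma numF_coeff (b a : ℤ) :
    (numF C b).coeff a = if 0 ≤ a then (ηNeg C (a + 1).toNat).coeff b else 0 := by
  rw [numF, ser_coeff (M := 0)]
  · rw [w002_eq, add_sub_cancel_right]
  · intro a ha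
    rw [w002_eq, add_sub_cancel_right, if_neg (by lia)]

lemma numB_mem (b : ℤ) : numB C b ∈ orderGE 1 := fun a ha => by
  rw [numB_coeff, if_neg (by lia)]

lemma numF_mem (b : ℤ) : numF C b ∈ orderGE 0 := fun a ha => by
  rw [numF_coeff, if_neg (by lia)]

lemma KBB_eq (b : ℤ) : KBB C b = numB C b * (kernelDenom C)⁻¹ := div_eq_mul_inv _ _

lemma KBF_eq (b : ℤ) : KBF C b = numF C b * (kernelDenom C)⁻¹ := div_eq_mul_inv _ _

/-- The numerator is ∑ z^l dξ_{-l}(z₀) over l ≥ 1, and the residue against dξ_{-l} picks out its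
l-th term: elements of V^{B-} are determined by their principal parts. -/
lemma res_numB_mul {f : LaurentSeries ℂ} (hf : f ∈ VBMinus C) (b : ℤ) :
    res (numB C b * f) = f.coeff b := by
  induction hf using Submodule.span_induction with
  | mem f hf =>
    obtain ⟨l, hl, rfl⟩ := hf
    have hd : dξNeg C l ∈ orderGE (-(l : ℤ) - 1) := fun a ha => by
      rw [dξNeg_coeff, if_neg (by lia), if_neg (by lia), add_zero]
    rw [res, coeff_mul_eq_sum (numB_mem C b) hd, Finset.sum_eq_single (l : ℤ)]
    · rw [numB_coeff, if_pos (by lia), Int.toNat_natCast, dξNeg_coeff C l (-1 - l),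
        if_pos (by ring), if_neg (by lia), add_zero, mul_one]
    · intro a ha hne
      rw [Finset.mem_Icc] at ha
      rw [dξNeg_coeff C l (-1 - a), if_neg (by lia), if_neg (by lia), add_zero, mul_zero]
    · intro hl'
      exact absurd (Finset.mem_Icc.2 ⟨by lia, by lia⟩) hl'
  | zero => rw [mul_zero]; rfl
  | add u v _ _ hu hv => rw [mul_add, res_add, hu, hv, HahnSeries.coeff_add]
  | smul c u _ hu => rw [mul_smul_series, res_smul, hu, HahnSeries.coeff_smul, smul_eq_mul]

/-- The pairing with `η₀`. -/
def pair0 (f : LaurentSeries ℂ) : ℂ := res (Z * (f * ηNeg C 0))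

lemma pair0_add (f k : LaurentSeries ℂ) : pair0 C (f + k) = pair0 C f + pair0 C k := by
  rw [pair0, add_mul, mul_add, res_add]
  rfl

lemma pair0_smul (c : ℂ) (f : LaurentSeries ℂ) : pair0 C (c • f) = c * pair0 C f := by
  rw [pair0, smul_mul_series, mul_smul_series, res_smul]
  rfl

lemma ηNeg_mem (l : ℕ) : ηNeg C l ∈ orderGE (-(l : ℤ) - 1) := fun a ha => by
  rw [ηNeg_coeff, if_neg (by lia), if_neg (by lia), add_zero]

lemma res_Z_mul (f : LaurentSeries ℂ) : res (Z * f) = f.coeff (-2) := Z_mul_coeff f (-1)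

/-- For l > 0 the two remaining terms are ψ_{0l} and ψ_{l0}, which cancel by the relation on ψ. -/
lemma pair0_ηNeg (l : ℕ) : pair0 C (ηNeg C l) = if l = 0 then 1 else 0 := by
  rw [pair0, res_Z_mul, coeff_mul_eq_sum (ηNeg_mem C l) (ηNeg_mem C 0)]
  have hz : ∀ a ∈ Finset.Icc (-(l : ℤ) - 1) (-2 - (-((0 : ℕ) : ℤ) - 1)), a ≠ -(l : ℤ) - 1 →
      a ≠ -1 → (ηNeg C l).coeff a * (ηNeg C 0).coeff (-2 - a) = 0 := by
    intro a ha h1 h2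
    rw [Finset.mem_Icc] at ha
    rw [ηNeg_coeff, if_neg h1, if_neg (by push_cast at ha; lia), add_zero, zero_mul]
  by_cases hl : l = 0
  · subst hl
    rw [Finset.sum_eq_single (-1 : ℤ)]
    · rw [ηNeg_coeff, ηNeg_coeff]
      simp [C.ψ_zero]
    · intro a ha hne
      exact hz a ha (by simpa using hne) hne
    · intro h
      exact absurd (Finset.mem_Icc.2 ⟨by simp, by simp⟩) h
  · rw [if_neg hl, ← Finset.sum_subset (s₁ := {-(l : ℤ) - 1, -1}), Finset.sum_pair (by lia)]
    · rw [ηNeg_coeff, ηNeg_coeff, ηNeg_coeff, ηNeg_coeff, if_pos rfl, if_neg (by lia),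
        if_neg (by push_cast; lia), if_pos (by lia), if_neg (by lia), if_pos (by lia),
        if_pos (by simp), if_pos (by lia), show (-2 - (-(l : ℤ) - 1) + 1).toNat = l by lia,
        show ((-1 : ℤ) + 1).toNat = 0 from rfl, show (-2 - (-1 : ℤ) + 1).toNat = 0 from rfl, C.ψ_zero,
        ψ_zero_right]
      ring
    · intro a ha
      rw [Finset.mem_insert, Finset.mem_singleton] at ha
      rw [Finset.mem_Icc]
      push_cast
      lia
    · intro a ha ha'
      rw [Finset.mem_insert, Finset.mem_singleton, not_or] at ha'
      exact hz a ha ha'.1 ha'.2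

/-- The numerator contains η_{-l} only for l ≥ 1, so the residue projects away the η₀-component. -/
lemma res_numF_mul {f : LaurentSeries ℂ} (hf : f ∈ VFZeroMinus C) (b : ℤ) :
    res (Z * (numF C b * f)) = f.coeff b - pair0 C f * (ηNeg C 0).coeff b := by
  induction hf using Submodule.span_induction with
  | mem f hf =>
    obtain ⟨l, rfl⟩ := hf
    rw [pair0_ηNeg, res_Z_mul, coeff_mul_eq_sum (numF_mem C b) (ηNeg_mem C l)]
    have hz : ∀ a ∈ Finset.Icc (0 : ℤ) (-2 - (-(l : ℤ) - 1)), a ≠ (l : ℤ) - 1 →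
        (numF C b).coeff a * (ηNeg C l).coeff (-2 - a) = 0 := by
      intro a ha hne
      rw [Finset.mem_Icc] at ha
      rw [ηNeg_coeff C l, if_neg (by lia), if_neg (by lia), add_zero, mul_zero]
    rcases Nat.eq_zero_or_pos l with rfl | hl
    · rw [if_pos rfl, one_mul, sub_self, Finset.sum_eq_zero]
      intro a ha
      refine hz a ha ?_
      rw [Finset.mem_Icc] at ha
      lia
    · rw [if_neg (by lia), zero_mul, sub_zero, Finset.sum_eq_single ((l : ℤ) - 1) hz]
      · rw [numF_coeff, if_pos (by lia), show ((l : ℤ) - 1 + 1).toNat = l by lia,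
          ηNeg_coeff C l (-2 - _), if_pos (by ring), if_neg (by lia), add_zero, mul_one]
      · intro h
        exact absurd (Finset.mem_Icc.2 ⟨by lia, by lia⟩) h
  | zero =>
    have : pair0 C 0 = 0 := by rw [pair0, zero_mul, mul_zero]; rfl
    rw [mul_zero, mul_zero, this, zero_mul, sub_zero]
    rfl
  | add u v _ _ hu hv =>
    rw [mul_add, mul_add, res_add, hu, hv, HahnSeries.coeff_add, pair0_add]
    ring
  | smul c u _ hu =>
    rw [mul_smul_series, mul_smul_series, res_smul, hu, HahnSeries.coeff_smul, smul_eq_mul, pair0_smul]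
    ring

/-! ### Slices of polarized multidifferentials -/

variable {C}

lemma exists_slice_left {n k : ℕ} {w : MultiDiff (n + 1) k} (hw : w ∈ polarized C (n + 1) k)
    (J : Fin n → ℤ) (K : Fin k → ℤ) :
    ∃ f ∈ VBMinus C, ∀ a, f.coeff a = w (Fin.cons a J) K := by
  induction hw using Submodule.span_induction with
  | mem w hw =>
    obtain ⟨F, H, hF, _, rfl⟩ := hw
    refine ⟨((∏ i, (F (Fin.succ i)).coeff (J i)) * ∏ j, (H j).coeff (K j)) • F 0,
      Submodule.smul_mem _ _ (hF 0), fun a => ?_⟩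
    beta_reduce
    rw [HahnSeries.coeff_smul, Fin.prod_univ_succ (fun i => (F i).coeff _), smul_eq_mul]
    simp only [Fin.cons_zero, Fin.cons_succ]
    ring
  | zero => exact ⟨0, Submodule.zero_mem _, fun a => rfl⟩
  | add u v _ _ hu hv =>
    obtain ⟨f, hf, hfu⟩ := hu
    obtain ⟨k, hk, hkv⟩ := hv
    exact ⟨f + k, Submodule.add_mem _ hf hk, fun a => by rw [HahnSeries.coeff_add, hfu, hkv]; rfl⟩
  | smul c u _ hu =>
    obtain ⟨f, hf, hfu⟩ := hu
    exact ⟨c • f, Submodule.smul_mem _ _ hf, fun a => by rw [HahnSeries.coeff_smul, hfu]; rfl⟩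

/-- Two fermionic entries are kept open as a finite sum of pure tensors, because the fermionic
recursion pairs either of them with η₀. -/
lemma exists_slice_right {n k : ℕ} {w : MultiDiff n (k + 2)} (hw : w ∈ polarized C n (k + 2))
    (J : Fin n → ℤ) (K : Fin k → ℤ) :
    ∃ l : List (LaurentSeries ℂ × LaurentSeries ℂ),
      (∀ p ∈ l, p.1 ∈ VFZeroMinus C ∧ p.2 ∈ VFZeroMinus C) ∧
      ∀ b₁ b₂, w J (Fin.cons b₁ (Fin.cons b₂ K)) =
        (l.map fun p => p.1.coeff b₁ * p.2.coeff b₂).sum := by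
  induction hw using Submodule.span_induction with
  | mem w hw =>
    obtain ⟨F, H, _, hH, rfl⟩ := hw
    refine ⟨[(((∏ i, (F i).coeff (J i)) * ∏ j, (H (Fin.succ (Fin.succ j))).coeff (K j)) • H 0,
      H (Fin.succ 0))],
      fun p hp => ?_, fun b₁ b₂ => ?_⟩
    · rw [List.mem_singleton] at hp
      rw [hp]
      exact ⟨Submodule.smul_mem _ _ (hH 0), hH _⟩
    · beta_reduce
      rw [List.map_singleton, List.sum_singleton, HahnSeries.coeff_smul,
        Fin.prod_univ_succ (fun j => (H j).coeff _), Fin.prod_univ_succ, smul_eq_mul]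
      simp only [Fin.cons_zero, Fin.cons_succ]
      ring
  | zero => exact ⟨[], by simp, fun _ _ => rfl⟩
  | add u v _ _ hu hv =>
    obtain ⟨l, hl, hlu⟩ := hu
    obtain ⟨l', hl', hlv⟩ := hv
    refine ⟨l ++ l', fun p hp => (List.mem_append.1 hp).elim (hl p) (hl' p), fun b₁ b₂ => ?_⟩
    rw [List.map_append, List.sum_append, ← hlu, ← hlv]
    rfl
  | smul c u _ hu =>
    obtain ⟨l, hl, hlu⟩ := hu
    refine ⟨l.map fun p => (c • p.1, p.2), fun p hp => ?_, fun b₁ b₂ => ?_⟩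
    · obtain ⟨q, hq, rfl⟩ := List.mem_map.1 hp
      exact ⟨Submodule.smul_mem _ _ (hl q hq).1, (hl q hq).2⟩
    · rw [Pi.smul_apply, Pi.smul_apply, hlu, smul_eq_mul, ← List.sum_map_mul_left, List.map_map]
      congr 1
      refine List.map_congr_left fun p _ => ?_
      simp only [Function.comp_apply, HahnSeries.coeff_smul, smul_eq_mul]
      ring

/-! ### Leaving out `ω_{0,1|0}` -/

lemma ofFn_sub_univ {n : ℕ} (J : Fin n → ℤ) : List.ofFn (sub J Finset.univ) = List.ofFn J := by
  rw [ofFn_sub, subList, List.filter_eq_self.2 (by simp), List.ofFn_eq_map]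

lemma bos_congr (ω : Correlators) (g : ℕ) {n n' k k' : ℕ} {J : Fin n → ℤ} {J' : Fin n' → ℤ}
    {K : Fin k → ℤ} {K' : Fin k' → ℤ} (hJ : List.ofFn J = List.ofFn J')
    (hK : List.ofFn K = List.ofFn K') : bos ω g J K = bos ω g J' K' := by
  have h1 := List.ofFn_inj'.1 hJ
  have h2 := List.ofFn_inj'.1 hK
  cases h1
  cases h2
  rfl

lemma fer_congr (ω : Correlators) (g : ℕ) {n n' k k' : ℕ} {J : Fin n → ℤ} {J' : Fin n' → ℤ}
    {K : Fin k → ℤ} {K' : Fin k' → ℤ} (hJ : List.ofFn J = List.ofFn J')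
    (hK : List.ofFn K = List.ofFn K') : fer ω g J K = fer ω g J' K' := by
  have h1 := List.ofFn_inj'.1 hJ
  have h2 := List.ofFn_inj'.1 hK
  cases h1
  cases h2
  rfl

lemma splitSum_add (g : ℕ) {n k : ℕ} (J : Fin n → ℤ) (K : Fin k → ℤ)
    (P P' : (g₁ : ℕ) → {n₁ k₁ : ℕ} → (Fin n₁ → ℤ) → (Fin k₁ → ℤ) →
      (g₂ : ℕ) → {n₂ k₂ : ℕ} → (Fin n₂ → ℤ) → (Fin k₂ → ℤ) → LaurentSeries ℂ) :
    splitSum g J K (fun g₁ _ _ J₁ K₁ g₂ _ _ J₂ K₂ => P g₁ J₁ K₁ g₂ J₂ K₂ + P' g₁ J₁ K₁ g₂ J₂ K₂) =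
      splitSum g J K P + splitSum g J K P' := by
  simp only [splitSum, smul_add, Finset.sum_add_distrib]

lemma shuffleSign_empty (k : ℕ) : shuffleSign (∅ : Finset (Fin k)) = 1 := by
  simp [shuffleSign]

lemma shuffleSign_univ (k : ℕ) : shuffleSign (Finset.univ : Finset (Fin k)) = 1 := by
  simp [shuffleSign]

lemma splitSum_left (g : ℕ) {n k : ℕ} (J : Fin n → ℤ) (K : Fin k → ℤ)
    {P : (g₁ : ℕ) → {n₁ k₁ : ℕ} → (Fin n₁ → ℤ) → (Fin k₁ → ℤ) →
      (g₂ : ℕ) → {n₂ k₂ : ℕ} → (Fin n₂ → ℤ) → (Fin k₂ → ℤ) → LaurentSeries ℂ}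
    (hP : ∀ g₁ n₁ k₁ J₁ K₁ g₂ n₂ k₂ J₂ K₂, ¬ (g₁ = 0 ∧ n₁ = 0 ∧ k₁ = 0) →
      @P g₁ n₁ k₁ J₁ K₁ g₂ n₂ k₂ J₂ K₂ = 0) :
    splitSum g J K P = P 0 (sub J ∅) (sub K ∅) g (sub J ∅ᶜ) (sub K ∅ᶜ) := by
  rw [splitSum, Finset.sum_eq_single (0, g), Finset.sum_eq_single ∅, Finset.sum_eq_single ∅,
    shuffleSign_empty, one_smul]
  · intro T _ hT
    rw [hP _ _ _ _ _ _ _ _ _ _ (by simpa using hT), smul_zero]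
  · simp
  · intro A _ hA
    refine Finset.sum_eq_zero fun T _ => ?_
    rw [hP _ _ _ _ _ _ _ _ _ _ (by simp [hA]), smul_zero]
  · simp
  · rintro ⟨p, q⟩ hp hne
    rw [Finset.HasAntidiagonal.mem_antidiagonal] at hp
    have : p ≠ 0 := fun h => hne (by simp only at hp; rw [h, zero_add] at hp; rw [h, hp])
    refine Finset.sum_eq_zero fun A _ => Finset.sum_eq_zero fun T _ => ?_
    rw [hP _ _ _ _ _ _ _ _ _ _ (by simp [this]), smul_zero]
  · intro h
    exact absurd (Finset.HasAntidiagonal.mem_antidiagonal.2 (zero_add g)) h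

lemma splitSum_right (g : ℕ) {n k : ℕ} (J : Fin n → ℤ) (K : Fin k → ℤ)
    {P : (g₁ : ℕ) → {n₁ k₁ : ℕ} → (Fin n₁ → ℤ) → (Fin k₁ → ℤ) →
      (g₂ : ℕ) → {n₂ k₂ : ℕ} → (Fin n₂ → ℤ) → (Fin k₂ → ℤ) → LaurentSeries ℂ}
    (hP : ∀ g₁ n₁ k₁ J₁ K₁ g₂ n₂ k₂ J₂ K₂, ¬ (g₂ = 0 ∧ n₂ = 0 ∧ k₂ = 0) →
      @P g₁ n₁ k₁ J₁ K₁ g₂ n₂ k₂ J₂ K₂ = 0) :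
    splitSum g J K P = P g (sub J Finset.univ) (sub K Finset.univ) 0 (sub J Finset.univᶜ)
      (sub K Finset.univᶜ) := by
  rw [splitSum, Finset.sum_eq_single (g, 0), Finset.sum_eq_single Finset.univ,
    Finset.sum_eq_single Finset.univ, shuffleSign_univ, one_smul]
  · intro T _ hT
    rw [hP _ _ _ _ _ _ _ _ _ _ (by simpa using hT), smul_zero]
  · simp
  · intro A _ hA
    refine Finset.sum_eq_zero fun T _ => ?_
    rw [hP _ _ _ _ _ _ _ _ _ _ (by simp [hA]), smul_zero]
  · simp
  · rintro ⟨p, q⟩ hp hne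
    rw [Finset.HasAntidiagonal.mem_antidiagonal] at hp
    have : q ≠ 0 := fun h => hne (by simp only at hp; rw [h, add_zero] at hp; rw [h, hp])
    refine Finset.sum_eq_zero fun A _ => Finset.sum_eq_zero fun T _ => ?_
    rw [hP _ _ _ _ _ _ _ _ _ _ (by simp [this]), smul_zero]
  · intro h
    exact absurd (Finset.HasAntidiagonal.mem_antidiagonal.2 (add_zero g)) h

variable (C) in
/-- The contribution of `ω_{0,1|0}` to the bosonic series. -/
def bosOne (g n k : ℕ) : LaurentSeries ℂ := if g = 0 ∧ n = 0 ∧ k = 0 then w010 C else 0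

section DropOne

variable {ω : Correlators} (hu : HasUnstableData C ω)

lemma ser_zero : ser (fun _ => 0) = 0 := by
  ext a
  rw [ser_coeff (M := 0) fun _ _ => rfl, HahnSeries.coeff_zero]

lemma fer_dropOne (ω : Correlators) (g : ℕ) {n k : ℕ} (J : Fin n → ℤ) (K : Fin k → ℤ) :
    fer (dropOne ω) g J K = fer ω g J K := by
  unfold fer dropOne
  simp

include hu in
lemma bos_eq_bosOne {g n k : ℕ} (h0 : g = 0 ∧ n = 0 ∧ k = 0) (J : Fin n → ℤ) (K : Fin k → ℤ) :
    bos ω g J K = w010 C := by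
  obtain ⟨rfl, rfl, rfl⟩ := h0
  ext a
  unfold bos
  rw [ser_coeff (M := 0)]
  · rw [hu.one]
    rfl
  · intro a ha
    rw [hu.one]
    exact w010_mem C a ha

lemma bos_dropOne_zero (ω : Correlators) {g n k : ℕ} (h0 : g = 0 ∧ n = 0 ∧ k = 0) (J : Fin n → ℤ)
    (K : Fin k → ℤ) : bos (dropOne ω) g J K = 0 := by
  obtain ⟨rfl, rfl, rfl⟩ := h0
  exact ser_zero

lemma bos_dropOne_of_ne (ω : Correlators) {g n k : ℕ} (h0 : ¬ (g = 0 ∧ n = 0 ∧ k = 0))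
    (J : Fin n → ℤ) (K : Fin k → ℤ) : bos (dropOne ω) g J K = bos ω g J K := by
  unfold bos dropOne
  rw [if_neg (by simpa using h0)]

include hu in
lemma bos_eq (g : ℕ) {n k : ℕ} (J : Fin n → ℤ) (K : Fin k → ℤ) :
    bos ω g J K = bosOne C g n k + bos (dropOne ω) g J K := by
  by_cases h0 : g = 0 ∧ n = 0 ∧ k = 0
  · rw [bos_eq_bosOne hu h0, bos_dropOne_zero ω h0, bosOne, if_pos h0, add_zero]
  · rw [bos_dropOne_of_ne ω h0, bosOne, if_neg h0, zero_add]

lemma σB_add (f k : LaurentSeries ℂ) : σB (f + k) = σB f + σB k := by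
  ext a
  rw [σB_coeff, HahnSeries.coeff_add, HahnSeries.coeff_add, σB_coeff, σB_coeff, mul_add]

lemma σB_zero : σB 0 = 0 := by
  ext a
  rw [σB_coeff, HahnSeries.coeff_zero, mul_zero]

lemma QFF_dropOne (C : LocalSuperSpectralCurve) (ω : Correlators) (g : ℕ) {n k : ℕ} (J : Fin n → ℤ)
    (K : Fin k → ℤ) : QFF C (dropOne ω) g J K = QFF C ω g J K := by
  have : ∀ g n k, dropOne ω g n (k + 2) = ω g n (k + 2) := fun g n k => by simp [dropOne]
  simp only [QFF, fer_dropOne, this]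

include hu in
-- In a splitting, ω_{0,1|0} appears only when one factor takes genus 0 and no further entries, so
-- exactly the two extreme splittings contribute.
lemma QBB_eq_dropOne (g : ℕ) {n k : ℕ} (h0 : ¬ (g = 0 ∧ n = 0 ∧ k = 0)) (J : Fin n → ℤ)
    (K : Fin k → ℤ) : QBB C ω g J K = QBB C (dropOne ω) g J K +
      (w010 C * σB (bos ω g J K) + bos ω g J K * σB (w010 C)) := by
  have h1 : ∀ g n k, dropOne ω g (n + 2) k = ω g (n + 2) k := fun g n k => by simp [dropOne]
  have h2 : (splitSum g J K fun g₁ _ _ J₁ K₁ g₂ _ _ J₂ K₂ => bos ω g₁ J₁ K₁ * σB (bos ω g₂ J₂ K₂)) =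
      splitSum g J K (fun g₁ _ _ J₁ K₁ g₂ _ _ J₂ K₂ =>
        bos (dropOne ω) g₁ J₁ K₁ * σB (bos (dropOne ω) g₂ J₂ K₂)) +
      (splitSum g J K (fun g₁ n₁ k₁ _ _ g₂ _ _ J₂ K₂ => bosOne C g₁ n₁ k₁ * σB (bos ω g₂ J₂ K₂)) +
      splitSum g J K (fun g₁ _ _ J₁ K₁ g₂ n₂ k₂ _ _ =>
        bos (dropOne ω) g₁ J₁ K₁ * σB (bosOne C g₂ n₂ k₂))) := by
    rw [← splitSum_add, ← splitSum_add]
    congr 1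
    funext g₁ n₁ k₁ J₁ K₁ g₂ n₂ k₂ J₂ K₂
    rw [bos_eq hu g₁ J₁ K₁, bos_eq hu g₂ J₂ K₂, σB_add]
    ring
  have hb : bosOne C 0 (∅ : Finset (Fin n)).card (∅ : Finset (Fin k)).card = w010 C :=
    if_pos (by simp)
  have hb' : bosOne C 0 (Finset.univᶜ : Finset (Fin n)).card (Finset.univᶜ : Finset (Fin k)).card =
      w010 C := if_pos (by simp)
  rw [QBB, QBB, h2, splitSum_left g J K (P := fun g₁ n₁ k₁ _ _ g₂ _ _ J₂ K₂ =>
      bosOne C g₁ n₁ k₁ * σB (bos ω g₂ J₂ K₂))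
      (fun g₁ n₁ k₁ J₁ K₁ g₂ n₂ k₂ J₂ K₂ hne => by rw [bosOne, if_neg hne, zero_mul]),
    splitSum_right g J K (P := fun g₁ _ _ J₁ K₁ g₂ n₂ k₂ _ _ =>
      bos (dropOne ω) g₁ J₁ K₁ * σB (bosOne C g₂ n₂ k₂))
      (fun g₁ n₁ k₁ J₁ K₁ g₂ n₂ k₂ J₂ K₂ hne => by rw [bosOne, if_neg hne, σB_zero, mul_zero]),
    bos_congr ω g (J := sub J ∅ᶜ) (K := sub K ∅ᶜ) (J' := J) (K' := K)
      (by rw [Finset.compl_empty, ofFn_sub_univ])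
      (by rw [Finset.compl_empty, ofFn_sub_univ]),
    bos_congr (dropOne ω) g (ofFn_sub_univ J) (ofFn_sub_univ K), bos_dropOne_of_ne ω h0, hb, hb']
  simp only [h1]
  ring

include hu in
lemma QFB_eq_dropOne (g : ℕ) {n k : ℕ} (J : Fin n → ℤ)
    (K : Fin k → ℤ) : QFB ω g J K = QFB (dropOne ω) g J K +
      (w010 C * σF (fer ω g J K) + σB (w010 C) * fer ω g J K) := by
  have h1 : ∀ g n k, dropOne ω g n (k + 1) = ω g n (k + 1) := fun g n k => by simp [dropOne]
  have h2 : (splitSum g J K fun g₁ _ _ J₁ K₁ g₂ _ _ J₂ K₂ => bos ω g₁ J₁ K₁ * σF (fer ω g₂ J₂ K₂)) =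
      splitSum g J K (fun g₁ _ _ J₁ K₁ g₂ _ _ J₂ K₂ =>
        bos (dropOne ω) g₁ J₁ K₁ * σF (fer ω g₂ J₂ K₂)) +
      splitSum g J K (fun g₁ n₁ k₁ _ _ g₂ _ _ J₂ K₂ =>
        bosOne C g₁ n₁ k₁ * σF (fer ω g₂ J₂ K₂)) := by
    rw [← splitSum_add]
    congr 1
    funext g₁ n₁ k₁ J₁ K₁ g₂ n₂ k₂ J₂ K₂
    rw [bos_eq hu g₁ J₁ K₁]
    ring
  have h3 : (splitSum g J K fun g₁ _ _ J₁ K₁ g₂ _ _ J₂ K₂ => σB (bos ω g₁ J₁ K₁) * fer ω g₂ J₂ K₂) =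
      splitSum g J K (fun g₁ _ _ J₁ K₁ g₂ _ _ J₂ K₂ =>
        σB (bos (dropOne ω) g₁ J₁ K₁) * fer ω g₂ J₂ K₂) +
      splitSum g J K (fun g₁ n₁ k₁ _ _ g₂ _ _ J₂ K₂ =>
        σB (bosOne C g₁ n₁ k₁) * fer ω g₂ J₂ K₂) := by
    rw [← splitSum_add]
    congr 1
    funext g₁ n₁ k₁ J₁ K₁ g₂ n₂ k₂ J₂ K₂
    rw [bos_eq hu g₁ J₁ K₁, σB_add]
    ring
  have hb : bosOne C 0 (∅ : Finset (Fin n)).card (∅ : Finset (Fin k)).card = w010 C :=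
    if_pos (by simp)
  simp only [QFB, fer_dropOne, h1]
  rw [h2, h3, splitSum_left g J K (P := fun g₁ n₁ k₁ _ _ g₂ _ _ J₂ K₂ =>
      bosOne C g₁ n₁ k₁ * σF (fer ω g₂ J₂ K₂))
      (fun g₁ n₁ k₁ J₁ K₁ g₂ n₂ k₂ J₂ K₂ hne => by rw [bosOne, if_neg hne, zero_mul]),
    splitSum_left g J K (P := fun g₁ n₁ k₁ _ _ g₂ _ _ J₂ K₂ =>
      σB (bosOne C g₁ n₁ k₁) * fer ω g₂ J₂ K₂)
      (fun g₁ n₁ k₁ J₁ K₁ g₂ n₂ k₂ J₂ K₂ hne => by rw [bosOne, if_neg hne, σB_zero, zero_mul]),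
    fer_congr ω g (J := sub J ∅ᶜ) (K := sub K ∅ᶜ) (J' := J) (K' := K)
      (by rw [Finset.compl_empty, ofFn_sub_univ])
      (by rw [Finset.compl_empty, ofFn_sub_univ]), hb]
  ring

end DropOne

end

end SuperTR

namespace SuperTR

noncomputable section

/-! ### From the loop equations to the recursion -/

lemma ser_eq {F : ℤ → ℂ} {f : LaurentSeries ℂ} (hF : ∀ a, f.coeff a = F a) : ser F = f := by
  obtain ⟨M, hM⟩ := exists_mem_orderGE f
  ext a
  rw [ser_coeff (M := M) (fun a ha => by rw [← hF]; exact hM a ha), hF]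

variable {C : LocalSuperSpectralCurve}

/-- Up to holomorphic terms, the kernel times the 𝓠̃-part is the numerator times f, and
`res_numB_mul` applies. -/
lemma res_KBB_mul {f Q Q' : LaurentSeries ℂ} (hf : f ∈ VBMinus C) (hs : f + σB f ∈ orderGE 0)
    (hQ : Q ∈ orderGE (2 * kind C)) (he : Q = Q' + (w010 C * σB f + f * σB (w010 C))) (b : ℤ) :
    res (KBB C b * Q') = f.coeff b := by
  have hd : (w010 C - σB (w010 C)) * (kernelDenom C)⁻¹ = 1 :=
    mul_inv_cancel₀ (kernelDenom_ne_zero C)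
  have hs' := add_σB_mem hs
  -- Write w = ω_{0,1|0}. Then 2(w·σf + f·σw) = (w + σw)(f + σf) - (w - σw)(f - σf), where w - σw is
  -- the kernel denominator and f - σf = 2f - (f + σf).
  have e : KBB C b * Q' + KBB C b * Q' =
      numB C b * ((kernelDenom C)⁻¹ * (Q + Q - (w010 C + σB (w010 C)) * (f + σB f))) +
        (numB C b * f + numB C b * f) - numB C b * (f + σB f) := by
    rw [KBB_eq, he]
    linear_combination numB C b * (f - σB f) * hd
  have h1 : res (numB C b * ((kernelDenom C)⁻¹ *
      (Q + Q - (w010 C + σB (w010 C)) * (f + σB f)))) = 0 := by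
    refine res_eq_zero (orderGE_mono (M := 1 + (-(2 * kind C) + 2 * kind C)) (by lia)
      (mul_mem_orderGE (numB_mem C b) (mul_mem_orderGE (inv_kernelDenom_mem C) ?_)))
    refine Submodule.sub_mem _ (Submodule.add_mem _ hQ hQ) (orderGE_mono (M := 1 + 1) ?_
      (mul_mem_orderGE (w010_add_σB_mem C) hs'))
    have := kind_le_one C
    lia
  have h2 : res (numB C b * (f + σB f)) = 0 :=
    res_eq_zero (orderGE_mono (by lia) (mul_mem_orderGE (numB_mem C b) hs'))
  have h3 := congrArg res e
  rw [res_sub, res_add, res_add, res_add, h1, h2, res_numB_mul C hf] at h3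
  linear_combination h3 / 2

lemma res_KBF_mul {f Q Q' : LaurentSeries ℂ} (hf : f ∈ VFZeroMinus C) (hs : f + σF f ∈ orderGE 0)
    (hQ : Q ∈ orderGE (2 * kind C - 1)) (he : Q = Q' + (w010 C * σF f + σB (w010 C) * f)) (b : ℤ) :
    res (Z * (KBF C b * Q')) = f.coeff b - pair0 C f * (ηNeg C 0).coeff b := by
  have hd : (w010 C - σB (w010 C)) * (kernelDenom C)⁻¹ = 1 :=
    mul_inv_cancel₀ (kernelDenom_ne_zero C)
  have e : Z * (KBF C b * Q') + Z * (KBF C b * Q') =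
      Z * (numF C b * ((kernelDenom C)⁻¹ * (Q + Q - (w010 C + σB (w010 C)) * (f + σF f)))) +
        (Z * (numF C b * f) + Z * (numF C b * f)) - Z * (numF C b * (f + σF f)) := by
    rw [KBF_eq, he]
    linear_combination Z * numF C b * (f - σF f) * hd
  have h1 : res (Z * (numF C b * ((kernelDenom C)⁻¹ *
      (Q + Q - (w010 C + σB (w010 C)) * (f + σF f))))) = 0 := by
    refine res_eq_zero (orderGE_mono (M := 1 + (0 + (-(2 * kind C) + (2 * kind C - 1)))) (by lia)
      (mul_mem_orderGE Z_mem_orderGE (mul_mem_orderGE (numF_mem C b)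
        (mul_mem_orderGE (inv_kernelDenom_mem C) ?_))))
    refine Submodule.sub_mem _ (Submodule.add_mem _ hQ hQ) (orderGE_mono (M := 1 + 0) ?_
      (mul_mem_orderGE (w010_add_σB_mem C) hs))
    have := kind_le_one C
    lia
  have h2 : res (Z * (numF C b * (f + σF f))) = 0 :=
    res_eq_zero (orderGE_mono (by lia) (mul_mem_orderGE Z_mem_orderGE
      (mul_mem_orderGE (numF_mem C b) hs)))
  have h3 := congrArg res e
  rw [res_sub, res_add, res_add, res_add, h1, h2, res_numF_mul C hf] at h3
  linear_combination h3 / 2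

lemma sum_coeff_mul_mem (l : List (LaurentSeries ℂ × LaurentSeries ℂ))
    (hl : ∀ p ∈ l, p.1 ∈ VFZeroMinus C ∧ p.2 ∈ VFZeroMinus C) (c : ℤ) :
    ∃ f ∈ VFZeroMinus C, (∀ b, f.coeff b = (l.map fun p => p.1.coeff b * p.2.coeff c).sum) ∧
      pair0 C f = (l.map fun p => pair0 C p.1 * p.2.coeff c).sum := by
  induction l with
  | nil => exact ⟨0, Submodule.zero_mem _, fun _ => rfl, by rw [pair0, zero_mul, mul_zero]; rfl⟩
  | cons p l ih =>
    obtain ⟨f, hf, hc, hp⟩ := ih fun q hq => hl q (List.mem_cons_of_mem _ hq)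
    refine ⟨p.2.coeff c • p.1 + f, Submodule.add_mem _ (Submodule.smul_mem _ _
      (hl p List.mem_cons_self).1) hf, fun b => ?_, ?_⟩
    · rw [HahnSeries.coeff_add, HahnSeries.coeff_smul, hc, List.map_cons, List.sum_cons,
        smul_eq_mul, mul_comm]
    · rw [pair0_add, pair0_smul, hp, List.map_cons, List.sum_cons, mul_comm]

lemma exists_pair0_eq (l : List (LaurentSeries ℂ × LaurentSeries ℂ)) :
    ∃ u : LaurentSeries ℂ, (∀ c, u.coeff c = (l.map fun p => pair0 C p.1 * p.2.coeff c).sum) ∧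
      pair0 C u = (l.map fun p => pair0 C p.1 * pair0 C p.2).sum := by
  induction l with
  | nil => exact ⟨0, fun _ => rfl, by rw [pair0, zero_mul, mul_zero]; rfl⟩
  | cons p l ih =>
    obtain ⟨u, hc, hp⟩ := ih
    refine ⟨pair0 C p.1 • p.2 + u, fun c => ?_, ?_⟩
    · rw [HahnSeries.coeff_add, HahnSeries.coeff_smul, hc, List.map_cons, List.sum_cons,
        smul_eq_mul]
    · rw [pair0_add, pair0_smul, hp, List.map_cons, List.sum_cons]

/-- Contracting both entries of an antisymmetric element of `V^{F0,-} ⊗ V^{F0,-}` with `η₀`. -/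
lemma sum_pair0_mul_eq_zero (l : List (LaurentSeries ℂ × LaurentSeries ℂ))
    (hl : ∀ p ∈ l, p.1 ∈ VFZeroMinus C ∧ p.2 ∈ VFZeroMinus C)
    (ha : ∀ b c, (l.map fun p => p.1.coeff b * p.2.coeff c).sum =
      -(l.map fun p => p.1.coeff c * p.2.coeff b).sum) :
    (l.map fun p => pair0 C p.1 * pair0 C p.2).sum = 0 := by
  obtain ⟨u, hu, hpu⟩ := exists_pair0_eq (C := C) l
  obtain ⟨v, hv, hpv⟩ := exists_pair0_eq (C := C) (l.map Prod.swap)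
  have hl' : ∀ p ∈ l.map Prod.swap, p.1 ∈ VFZeroMinus C ∧ p.2 ∈ VFZeroMinus C := fun p hp => by
    obtain ⟨q, hq, rfl⟩ := List.mem_map.1 hp
    exact ⟨(hl q hq).2, (hl q hq).1⟩
  -- The series `u` and `v` are the contractions of the first and of the second entry with η₀;
  -- contracting u = -v once more makes the double contraction its own negative.
  have e : u = (-1 : ℂ) • v := by
    ext c
    obtain ⟨f, _, hf, hpf⟩ := sum_coeff_mul_mem l hl c
    obtain ⟨k, _, hk, hpk⟩ := sum_coeff_mul_mem (l.map Prod.swap) hl' c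
    have : f = (-1 : ℂ) • k := by
      ext b
      rw [hf, HahnSeries.coeff_smul, hk, ha, List.map_map, smul_eq_mul, neg_one_mul]
      congr 3
      funext p
      exact mul_comm _ _
    rw [hu, ← hpf, this, pair0_smul, hpk, HahnSeries.coeff_smul, hv, smul_eq_mul]
  have h1 := congrArg (pair0 C) e
  rw [pair0_smul, hpu, hpv, List.map_map] at h1
  have h2 : (l.map ((fun p => pair0 C p.1 * pair0 C p.2) ∘ Prod.swap)).sum =
      (l.map fun p => pair0 C p.1 * pair0 C p.2).sum := by
    congr 2
    funext p
    exact mul_comm _ _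
  rw [h2] at h1
  linear_combination h1 / 2

lemma two_mul_kind : (if C.τ 1 = 0 then (2 : ℤ) else 0) = 2 * kind C := by
  unfold kind
  split_ifs <;> simp

lemma two_mul_kind_sub_one : (if C.τ 1 = 0 then (1 : ℤ) else -1) = 2 * kind C - 1 := by
  unfold kind
  split_ifs <;> simp

lemma cons_cons_comp_swap {k : ℕ} (b c : ℤ) (K : Fin k → ℤ) :
    (Fin.cons c (Fin.cons b K) : Fin (k + 2) → ℤ) ∘ Equiv.swap 0 1 = Fin.cons b (Fin.cons c K) := by
  funext i
  refine Fin.cases ?_ (fun i => Fin.cases ?_ (fun i => ?_) i) i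
  · simp
  · simp
  · rw [Function.comp_apply, Equiv.swap_apply_of_ne_of_ne (Fin.succ_ne_zero _)
      (by rw [← Fin.succ_zero_eq_one]; exact fun h => Fin.succ_ne_zero _ (Fin.succ_injective _ h))]
    rfl

/-! ### The recursion for a polarized solution -/

section

variable {ω : Correlators} (hω : IsPolarizedSolution C ω)

include hω

lemma IsPolarizedSolution.bosonic {g n m : ℕ} (hs : 2 < 2 * g + (n + 1) + 2 * m) (b : ℤ)
    (J : Fin n → ℤ) (K : Fin (2 * m) → ℤ) :
    ω g (n + 1) (2 * m) (Fin.cons b J) K =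
      res (KBB C b * (QBB C (dropOne ω) g J K + QFF C (dropOne ω) g J K)) := by
  obtain ⟨f, hf, hc⟩ := exists_slice_left (hω.polarization.mem g (n + 1) m hs) J K
  have hb : bos ω g J K = f := ser_eq hc
  rw [← hc]
  have hl := hω.loop.linB g n m J K
  rw [LB, hb] at hl
  have hQ := hω.loop.quadB g n m J K
  rw [two_mul_kind] at hQ
  refine (res_KBB_mul hf hl hQ ?_ b).symm
  rw [QBB_eq_dropOne hω.unstable g (by lia), QFF_dropOne, hb]
  ring

/-- The hatted form is ω without the η₀-component of its first entry. By antisymmetry, contracting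
the second entry with η₀ gives the missing component up to sign, and the double contraction
vanishes. -/
lemma IsPolarizedSolution.fermionic {g n m : ℕ} (hs : 2 < 2 * g + n + (2 * m + 2)) (b₁ b₂ : ℤ)
    (J : Fin n → ℤ) (K : Fin (2 * m) → ℤ) :
    ω g n (2 * m + 2) J (Fin.cons b₁ (Fin.cons b₂ K)) =
      wHat C ω g J b₁ b₂ K -
        (ηNeg C 0).coeff b₁ * res (Z * ((ser fun c => wHat C ω g J b₂ c K) * ηNeg C 0)) := by
  obtain ⟨l, hl, hc⟩ := exists_slice_right (hω.polarization.mem g n (m + 1) hs) J K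
  change ∀ b₁ b₂, ω g n (2 * m + 2) J _ = _ at hc
  have ha : ∀ b c, (l.map fun p => p.1.coeff b * p.2.coeff c).sum =
      -(l.map fun p => p.1.coeff c * p.2.coeff b).sum := fun b c => by
    rw [← hc, ← hc]
    have := hω.polarization.antisymm g n (m + 1) hs
      (Equiv.swap (0 : Fin (2 * m + 2)) 1) J (Fin.cons c (Fin.cons b K) : Fin (2 * m + 2) → ℤ)
    rw [Equiv.Perm.sign_swap (by simp), cons_cons_comp_swap] at this
    refine this.trans ?_
    rw [Units.val_neg, Units.val_one, Int.cast_neg, Int.cast_one, neg_one_mul]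
    rfl
  obtain ⟨u, hu, hpu⟩ := exists_pair0_eq (C := C) l
  rw [sum_pair0_mul_eq_zero l hl ha] at hpu
  have hw : ∀ b c, wHat C ω g J b c K =
      (l.map fun p => p.1.coeff b * p.2.coeff c).sum - u.coeff c * (ηNeg C 0).coeff b := by
    intro b c
    obtain ⟨f, hf, hfc, hpf⟩ := sum_coeff_mul_mem l hl c
    have hfer : fer ω g J (Fin.cons c K) = f := ser_eq fun a => (hfc a).trans (hc a c).symm
    have hlin := hω.loop.linF g n m J (Fin.cons c K)
    rw [LF, hfer] at hlin
    have hQ := hω.loop.quadF g n m J (Fin.cons c K)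
    rw [two_mul_kind_sub_one] at hQ
    rw [wHat, hu, ← hpf, ← hfc]
    refine res_KBF_mul hf hlin hQ ?_ b
    rw [QFB_eq_dropOne hω.unstable, hfer]
  obtain ⟨f, hf, hfc, hpf⟩ := sum_coeff_mul_mem l hl b₂
  have hser : (ser fun c => wHat C ω g J b₂ c K) =
      (-1 : ℂ) • f + (-(ηNeg C 0).coeff b₂) • u := ser_eq fun c => by
    rw [hw, ha, HahnSeries.coeff_add, HahnSeries.coeff_smul, HahnSeries.coeff_smul, hfc, smul_eq_mul,
      smul_eq_mul]
    ring
  -- Here `u` is the contraction of the first entry of ω with η₀; the term in which `u` itself is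
  -- paired with η₀ drops out by `hpu`.
  have hp : res (Z * ((ser fun c => wHat C ω g J b₂ c K) * ηNeg C 0)) = -u.coeff b₂ := by
    rw [hser]
    change pair0 C _ = _
    rw [pair0_add, pair0_smul, pair0_smul, hpu, hpf, hu]
    ring
  rw [hp, hw, hc]
  ring

lemma IsPolarizedSolution.topologicalRecursion : TopologicalRecursion C ω :=
  ⟨fun _ _ _ hs => hω.bosonic hs, fun _ _ _ hs => hω.fermionic hs⟩

end

end

end SuperTR

namespace SuperTR

noncomputable section

/-! ### The recursion determines the correlators -/

lemma splitSum_congr (g : ℕ) {n k : ℕ} (J : Fin n → ℤ) (K : Fin k → ℤ)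
    {P P' : (g₁ : ℕ) → {n₁ k₁ : ℕ} → (Fin n₁ → ℤ) → (Fin k₁ → ℤ) →
      (g₂ : ℕ) → {n₂ k₂ : ℕ} → (Fin n₂ → ℤ) → (Fin k₂ → ℤ) → LaurentSeries ℂ}
    (hP : ∀ g₁ n₁ k₁ J₁ K₁ g₂ n₂ k₂ J₂ K₂, g₁ + g₂ = g → n₁ + n₂ = n → k₁ + k₂ = k →
      @P g₁ n₁ k₁ J₁ K₁ g₂ n₂ k₂ J₂ K₂ = @P' g₁ n₁ k₁ J₁ K₁ g₂ n₂ k₂ J₂ K₂) :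
    splitSum g J K P = splitSum g J K P' := by
  refine Finset.sum_congr rfl fun p hp => Finset.sum_congr rfl fun A _ =>
    Finset.sum_congr rfl fun T _ => ?_
  rw [Finset.HasAntidiagonal.mem_antidiagonal] at hp
  have h1 := Finset.card_add_card_compl A
  have h2 := Finset.card_add_card_compl T
  rw [Fintype.card_fin] at h1 h2
  rw [hP _ _ _ _ _ _ _ _ _ _ hp h1 h2]

lemma σF_zero : σF 0 = 0 := by
  ext a
  rw [σF_coeff, HahnSeries.coeff_zero, mul_zero]

lemma D_zero : D 0 = 0 := by
  ext a
  rw [D_coeff, HahnSeries.coeff_zero, HahnSeries.coeff_zero, mul_zero]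

/-- The two families agree below the Euler characteristic `N`. -/
def AgreeBelow (ω ω' : Correlators) (N : ℕ) : Prop :=
  ∀ g n k, n + k ≠ 0 → 2 * g + n + k < N → ω g n k = ω' g n k

section

variable {C : LocalSuperSpectralCurve} {ω ω' : Correlators} {N : ℕ}

lemma AgreeBelow.bos (h : AgreeBelow ω ω' N) {g n k : ℕ} (hN : 2 * g + (n + 1) + k < N)
    (J : Fin n → ℤ) (K : Fin k → ℤ) : bos (dropOne ω) g J K = bos (dropOne ω') g J K := by
  unfold SuperTR.bos dropOne
  rw [h g (n + 1) k (by lia) hN]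

lemma AgreeBelow.fer (h : AgreeBelow ω ω' N) {g n k : ℕ} (hN : 2 * g + n + (k + 1) < N)
    (J : Fin n → ℤ) (K : Fin k → ℤ) : fer ω g J K = fer ω' g J K := by
  unfold SuperTR.fer
  rw [h g n (k + 1) (by lia) hN]

lemma HasUnstableData.fer_eq_zero (hu : HasUnstableData C ω) {g n k : ℕ}
    (h0 : g = 0 ∧ n = 0 ∧ k = 0) (J : Fin n → ℤ) (K : Fin k → ℤ) : fer ω g J K = 0 := by
  obtain ⟨rfl, rfl, rfl⟩ := h0
  unfold fer
  rw [hu.odd 0 0 (0 + 1) (by simp)]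
  exact ser_zero

/-- Passing to genus g - 1 costs two and adds one entry. In a splitting both factors are smaller
unless one is the omitted ω_{0,1|0}; for fermions the exceptional factor vanishes by oddness. -/
lemma AgreeBelow.QBB (h : AgreeBelow ω ω' N) {g n k : ℕ} (hN : 2 * g + (n + 1) + k = N)
    (J : Fin n → ℤ) (K : Fin k → ℤ) : QBB C (dropOne ω) g J K = QBB C (dropOne ω') g J K := by
  unfold SuperTR.QBB
  refine congrArg₂ (· + ·) ?_ ?_
  · by_cases hg : g = 0
    · rw [if_pos hg, if_pos hg]
    · unfold dropOne
      rw [h (g - 1) (n + 2) k (by lia) (by lia)]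
  · refine splitSum_congr g J K fun g₁ n₁ k₁ J₁ K₁ g₂ n₂ k₂ J₂ K₂ h1 h2 h3 => ?_
    by_cases hz : g₁ = 0 ∧ n₁ = 0 ∧ k₁ = 0
    · rw [bos_dropOne_zero ω hz, bos_dropOne_zero ω' hz, zero_mul, zero_mul]
    by_cases hz' : g₂ = 0 ∧ n₂ = 0 ∧ k₂ = 0
    · rw [bos_dropOne_zero ω hz', bos_dropOne_zero ω' hz', σB_zero, mul_zero, mul_zero]
    rw [h.bos (by lia), h.bos (by lia)]

lemma AgreeBelow.QFF (h : AgreeBelow ω ω' N) (hu : HasUnstableData C ω) (hu' : HasUnstableData C ω')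
    {g n k : ℕ} (hN : 2 * g + (n + 1) + k = N) (J : Fin n → ℤ) (K : Fin k → ℤ) :
    QFF C ω g J K = QFF C ω' g J K := by
  unfold SuperTR.QFF
  refine congrArg₂ (· + ·) (congrArg₂ (· + ·) (congrArg ((-1 / 2 : ℂ) • ·) ?_)
    (congrArg ((1 / 2 : ℂ) • ·) ?_)) (congrArg ((1 / 2 : ℂ) • ·) ?_)
  · by_cases hg : g = 0
    · rw [if_pos hg, if_pos hg]
    · rw [h (g - 1) n (k + 2) (by lia) (by lia)]
  · refine splitSum_congr g J K fun g₁ n₁ k₁ J₁ K₁ g₂ n₂ k₂ J₂ K₂ h1 h2 h3 => ?_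
    by_cases hz : g₁ = 0 ∧ n₁ = 0 ∧ k₁ = 0
    · rw [hu.fer_eq_zero hz, hu'.fer_eq_zero hz, D_zero, zero_mul, zero_mul]
    by_cases hz' : g₂ = 0 ∧ n₂ = 0 ∧ k₂ = 0
    · rw [hu.fer_eq_zero hz', hu'.fer_eq_zero hz', σF_zero]
      simp only [mul_zero]
    rw [h.fer (by lia), h.fer (by lia)]
  · refine splitSum_congr g J K fun g₁ n₁ k₁ J₁ K₁ g₂ n₂ k₂ J₂ K₂ h1 h2 h3 => ?_
    by_cases hz : g₁ = 0 ∧ n₁ = 0 ∧ k₁ = 0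
    · rw [hu.fer_eq_zero hz, hu'.fer_eq_zero hz, σF_zero, D_zero, zero_mul, zero_mul]
    by_cases hz' : g₂ = 0 ∧ n₂ = 0 ∧ k₂ = 0
    · rw [hu.fer_eq_zero hz', hu'.fer_eq_zero hz']
      simp only [mul_zero]
    rw [h.fer (by lia), h.fer (by lia)]

lemma AgreeBelow.QFB (h : AgreeBelow ω ω' N) (hu : HasUnstableData C ω) (hu' : HasUnstableData C ω')
    {g n k : ℕ} (hN : 2 * g + n + (k + 1) = N) (J : Fin n → ℤ) (K : Fin k → ℤ) :
    QFB (dropOne ω) g J K = QFB (dropOne ω') g J K := by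
  unfold SuperTR.QFB
  simp only [fer_dropOne]
  refine congrArg₂ (· + ·) (congrArg₂ (· + ·) ?_ ?_) ?_
  · by_cases hg : g = 0
    · rw [if_pos hg, if_pos hg]
    · unfold dropOne
      rw [h (g - 1) (n + 1) (k + 1) (by lia) (by lia)]
  · refine splitSum_congr g J K fun g₁ n₁ k₁ J₁ K₁ g₂ n₂ k₂ J₂ K₂ h1 h2 h3 => ?_
    by_cases hz : g₁ = 0 ∧ n₁ = 0 ∧ k₁ = 0
    · rw [bos_dropOne_zero ω hz, bos_dropOne_zero ω' hz, zero_mul, zero_mul]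
    by_cases hz' : g₂ = 0 ∧ n₂ = 0 ∧ k₂ = 0
    · rw [hu.fer_eq_zero hz', hu'.fer_eq_zero hz', σF_zero, mul_zero, mul_zero]
    rw [h.bos (by lia), h.fer (by lia)]
  · refine splitSum_congr g J K fun g₁ n₁ k₁ J₁ K₁ g₂ n₂ k₂ J₂ K₂ h1 h2 h3 => ?_
    by_cases hz : g₁ = 0 ∧ n₁ = 0 ∧ k₁ = 0
    · rw [bos_dropOne_zero ω hz, bos_dropOne_zero ω' hz, σB_zero, zero_mul, zero_mul]
    by_cases hz' : g₂ = 0 ∧ n₂ = 0 ∧ k₂ = 0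
    · rw [hu.fer_eq_zero hz', hu'.fer_eq_zero hz', mul_zero, mul_zero]
    rw [h.bos (by lia), h.fer (by lia)]

/-- Stable correlators with a bosonic entry are fixed by the bosonic recursion, those with only
fermionic entries by the fermionic one, and the remaining ones by the unstable data or oddness. -/
lemma AgreeBelow.eq_of_topologicalRecursion (h : AgreeBelow ω ω' N) (hu : HasUnstableData C ω)
    (hu' : HasUnstableData C ω') (hr : TopologicalRecursion C ω) (hr' : TopologicalRecursion C ω')
    {g n k : ℕ} (hnk : n + k ≠ 0) (hN : 2 * g + n + k = N) : ω g n k = ω' g n k := by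
  rcases Nat.even_or_odd' k with ⟨m, rfl | rfl⟩
  swap
  · rw [hu.odd _ _ _ ⟨m, rfl⟩, hu'.odd _ _ _ ⟨m, rfl⟩]
  by_cases hs : 2 < 2 * g + n + 2 * m
  · funext a b
    rcases n with _ | n
    · rcases m with _ | m
      · lia
      · have hW : ∀ b₁ b₂ K, wHat C ω g a b₁ b₂ (k := 2 * m) K = wHat C ω' g a b₁ b₂ K :=
          fun b₁ b₂ K => by
            unfold wHat
            rw [h.QFB hu hu' (by lia)]
        change ω g 0 (2 * m + 2) a b = ω' g 0 (2 * m + 2) a b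
        rw [← Fin.cons_self_tail (α := fun _ : Fin (2 * m + 2) => ℤ) b,
          ← Fin.cons_self_tail (α := fun _ : Fin (2 * m + 1) => ℤ) (Fin.tail b),
          hr.fermionic g 0 m (by lia), hr'.fermionic g 0 m (by lia)]
        simp only [hW]
    · rw [← Fin.cons_self_tail a, hr.bosonic g n m hs, hr'.bosonic g n m hs, h.QBB hN, QFF_dropOne,
        QFF_dropOne, h.QFF hu hu' hN]
  · obtain rfl : g = 0 := by lia
    have : (n = 1 ∧ m = 0) ∨ (n = 2 ∧ m = 0) ∨ (n = 0 ∧ m = 1) := by lia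
    rcases this with ⟨rfl, rfl⟩ | ⟨rfl, rfl⟩ | ⟨rfl, rfl⟩
    · funext a b
      exact (hu.one a b).trans (hu'.one a b).symm
    · funext a b
      exact (hu.two a b).trans (hu'.two a b).symm
    · funext a b
      exact (hu.ferm a b).trans (hu'.ferm a b).symm

theorem TopologicalRecursion.unique (hu : HasUnstableData C ω) (hu' : HasUnstableData C ω')
    (hr : TopologicalRecursion C ω) (hr' : TopologicalRecursion C ω') (g n k : ℕ)
    (hnk : n + k ≠ 0) : ω g n k = ω' g n k := by
  have : ∀ N, AgreeBelow ω ω' N := by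
    intro N
    induction N with
    | zero => exact fun g n k _ hlt => absurd hlt (Nat.not_lt_zero _)
    | succ N ih =>
      intro g n k h0 hlt
      rcases Nat.lt_succ_iff_lt_or_eq.1 hlt with hlt | heq
      · exact ih g n k h0 hlt
      · exact ih.eq_of_topologicalRecursion hu hu' hr hr' h0 heq
  exact this _ g n k hnk (Nat.lt_succ_self _)

end

end

end SuperTR

/-- Every local super spectral curve has a solution of the super loop equations that respects the
polarization; it satisfies the super topological recursion, it is the only such solution, and it is
the only family determined by the recursion.  (The constants `ω_{g,0|0}` occur in no equation.) -/
theorem corollary4p4 (C : SuperTR.LocalSuperSpectralCurve) :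
    ∃ ω : SuperTR.Correlators,
      SuperTR.IsPolarizedSolution C ω ∧
      SuperTR.TopologicalRecursion C ω ∧
      (∀ ω' : SuperTR.Correlators, SuperTR.IsPolarizedSolution C ω' →
        ∀ g n k : ℕ, n + k ≠ 0 → ω' g n k = ω g n k) ∧
      (∀ ω' : SuperTR.Correlators, SuperTR.HasUnstableData C ω' →
        SuperTR.TopologicalRecursion C ω' →
        ∀ g n k : ℕ, n + k ≠ 0 → ω' g n k = ω g n k) := by
  obtain ⟨ω, hω⟩ := SuperTR.exists_isPolarizedSolution C
  exact ⟨ω, hω, hω.topologicalRecursion,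
    fun ω' hω' => SuperTR.TopologicalRecursion.unique hω'.unstable hω.unstable
      hω'.topologicalRecursion hω.topologicalRecursion,
    fun ω' hu hr => SuperTR.TopologicalRecursion.unique hu hω.unstable hr hω.topologicalRecursion⟩
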